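/- **Setting.** Let $K$ be a field of characteristic $0$ (for instance $K=\mathbb C$), $n\ge 0$, and let $\mathbf{ex}\subseteq[1,n]$ be the set of mutable indices (for instance $[1,m]$). Let $B=(b_{ij})_{i\in\mathbf{ex},\,j\in[1,n]}$ and $\Lambda=(\lambda_{ij})_{i,j\in[1,n]}$ be integer matrices that form a *compatible pair*: the principal part of $B$ is skew-symmetrizable, $\Lambda$ is skew-symmetric, and $(B\Lambda)_{ij}=d_i\delta_{ij}$ with integers $d_i>0$. *Algebras.* $\mathfrak A\subset K(x_1,\dots,x_n)$ is the cluster algebra of the seed $(\mathbf x,B)$: the $K$-subalgebra generated by all cluster variables, frozen ones included but not inverted, of all mutation-equivalent seeds. The field $K(x_1,\dots,x_n)$ carries the Poisson bracket with $\{x_i,x_j\}=\lambda_{ij}x_ix_j$. Let $q=v^2\in K^\times$ with $v\in K^\times$ not a root of unity. $\mathfrak A_q$ is the quantum cluster algebra over $K$ of the quantum seed $(\mathbf x,B,\Lambda)$ (Berenstein–Zelevinsky): the $K$-subalgebra, generated by all cluster variables of all mutation-equivalent quantum seeds, of the skew field of fractions of the quantum torus with $x_ix_j=q^{\lambda_{ij}}x_jx_i$.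 *Torus action.* The torus acts through the automorphisms $x_i\mapsto\alpha^{w_i}x_i$, with $\alpha\in K^\times$ and $w\in T:=\ker B\subset\mathbb Z^n$. The seed is *super-toric*: for every $k=1,\dots,n$ one has $\operatorname{rk}\bigl(T_{[1,k]}+\operatorname{Im}\Lambda_{[1,k]}\bigr)=k$, where $T_{[1,k]}$ is the projection of $T$ to the first $k$ coordinates and $\Lambda_{[1,k]}$ is the $k\times k$ leading principal submatrix. *COS.* A *COS of depth $r\le n$* in $\mathfrak A$ (resp. $\mathfrak A_q$) is a chain $\mathcal I_n\subset\mathcal I_{n-1}\subset\cdots\subset\mathcal I_{n-r+1}$ of proper torus invariant Poisson prime ideals of $\mathfrak A$ (resp. torus invariant two-sided prime ideals of $\mathfrak A_q$) with $\mathcal I_k\cap\{x_1,\dots,x_n\}=\{x_k,\dots,x_n\}$ for all $n-r+1\le k\le n$. *Strata.* For a torus invariant ideal $\mathcal J$, the stratum $P.spec_{\mathcal J}(\mathfrak A)$ (resp. $spec_{\mathcal J}(\mathfrak A_q)$) is the set of Poisson prime ideals (resp. two-sided prime ideals) $P$ such that $\mathcal J$ is the largest torus invariant ideal contained in $P$.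 All (Poisson) spectra carry the Zariski topology, with closed sets $\{P: P\supseteq I\}$, and strata carry the subspace topology. **Theorem.** Let $(B,\Lambda)$ be a compatible pair and let the seed be super-toric. (a) Suppose that $\mathfrak A$ is Noetherian and closed under the Poisson bracket, and let $(\mathcal I_k)$ be a COS of depth $r$ in $\mathfrak A$. Then for every $n-r+1\le k\le n$ the stratum $P.spec_{\mathcal I_k}(\mathfrak A)$ is homeomorphic to the Poisson spectrum of the Poisson torus $(K[x_1^{\pm1},\dots,x_{k-1}^{\pm1}],\Lambda_{[1,k-1]})$ with $\{x_i,x_j\}=\lambda_{ij}x_ix_j$. (b) Suppose that $\mathfrak A_q$ is left and right Noetherian and that all prime ideals of $\mathfrak A_q$ are completely prime, and let $(\mathcal I_k)$ be a COS of depth $r$ in $\mathfrak A_q$. Then for every $n-r+1\le k\le n$ the stratum $spec_{\mathcal I_k}(\mathfrak A_q)$ is homeomorphic to the spectrum of the quantum torus $K_{\Lambda_{[1,k-1]}}[x_1^{\pm1},\dots,x_{k-1}^{\pm1}]$ with $x_ix_j=q^{\lambda_{ij}}x_jx_i$. -/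

import Mathlib

open scoped nonZeroDivisors Matrix

namespace ClusterSpectra

noncomputable section

/-! ### Exchange matrices, compatible pairs, matrix mutation

The index set of an extended cluster is `Fin n`; the mutable (exchangeable) indices form the finite
set `ex`, all other indices are frozen. An exchange matrix has its rows labelled by `ex` and its
columns by `Fin n`. -/

section Combinatorics

variable {n : ℕ} {ex : Finset (Fin n)}

/-- `(B, Λ)` is a compatible pair: the principal part of `B` is skew-symmetrizable, `Λ` is
skew-symmetric, and `B * Λ` is a positive diagonal matrix on the mutable columns and zero on the
frozen ones. -/
structure IsCompatiblePair (B : Matrix ex (Fin n) ℤ) (Λ : Matrix (Fin n) (Fin n) ℤ) : Prop where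
  skewSymmetrizable : ∃ d : ex → ℤ, (∀ i, 0 < d i) ∧
    ∀ i j : ex, B i (j : Fin n) * d j = -(B j (i : Fin n) * d i)
  skewSymm : Λᵀ = -Λ
  mul_eq : ∃ d : ex → ℤ, (∀ i, 0 < d i) ∧
    ∀ (i : ex) (j : Fin n), (B * Λ) i j = if (i : Fin n) = j then d i else 0

/-- Mutation of the exchange matrix in direction `k`. -/
def mutateMatrix (B : Matrix ex (Fin n) ℤ) (k : ex) : Matrix ex (Fin n) ℤ := fun i j =>
  if i = k ∨ j = (k : Fin n) then -B i j
  else B i j + (|B i (k : Fin n)| * B k j + B i (k : Fin n) * |B k j|) / 2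

/-- The matrix `E_{k,ε}` for `ε = +1`. -/
def mutationE (B : Matrix ex (Fin n) ℤ) (k : ex) : Matrix (Fin n) (Fin n) ℤ := fun i j =>
  if j ≠ (k : Fin n) then (if i = j then 1 else 0)
  else if i = (k : Fin n) then -1 else max 0 (-B k i)

/-- Mutation `Eᵀ Λ E` of the skew-symmetric matrix in direction `k`. -/
def mutateForm (B : Matrix ex (Fin n) ℤ) (Λ : Matrix (Fin n) (Fin n) ℤ) (k : ex) :
    Matrix (Fin n) (Fin n) ℤ :=
  (mutationE B k)ᵀ * Λ * mutationE B k

/-- The principal submatrix `Λ_{[1,k]}`. -/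
def principal (Λ : Matrix (Fin n) (Fin n) ℤ) (k : ℕ) (h : k ≤ n) : Matrix (Fin k) (Fin k) ℤ :=
  Λ.submatrix (Fin.castLE h) (Fin.castLE h)

/-- The projection to the first `k` coordinates of the lattice `T = ker B ⊆ ℤ^n` of weights of
global toric actions. -/
def toricLattice (B : Matrix ex (Fin n) ℤ) (k : ℕ) (h : k ≤ n) : Submodule ℤ (Fin k → ℤ) :=
  (LinearMap.ker B.mulVecLin).map (LinearMap.funLeft ℤ ℤ (Fin.castLE h))

/-- The seed is super-toric: `rk (T_{[1,k]} + Im Λ_{[1,k]}) = k` for `k = 1, …, n`. -/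
def IsSuperToric (B : Matrix ex (Fin n) ℤ) (Λ : Matrix (Fin n) (Fin n) ℤ) : Prop :=
  ∀ (k : ℕ) (h : k ≤ n), 1 ≤ k →
    Module.finrank ℤ ↥(toricLattice B k h ⊔ LinearMap.range (principal Λ k h).mulVecLin) = k

end Combinatorics

/-! ### Global toric actions -/

section ToricAction

variable {K : Type*} [Field K] {F : Type*} [Ring F] [Algebra K F] {n : ℕ} {ex : Finset (Fin n)}

/-- The automorphisms `x_i ↦ α ^ w_i • x_i`, for `w ∈ ker B` and `α ∈ Kˣ`, of the (skew) field `F`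
generated by the cluster `x`. They generate the torus that acts on the cluster algebra. -/
def toricAutomorphisms (B : Matrix ex (Fin n) ℤ) (x : Fin n → F) : Set (F ≃ₐ[K] F) :=
  {φ | ∃ w : Fin n → ℤ, B *ᵥ w = 0 ∧ ∃ α : Kˣ, ∀ i, φ (x i) = ((α ^ w i : Kˣ) : K) • x i}

/-- A subset of `F` is stable under all global toric actions. -/
def IsTorusStable (K : Type*) [Field K] [Algebra K F] (B : Matrix ex (Fin n) ℤ) (x : Fin n → F)
    (S : Set F) : Prop :=
  ∀ φ ∈ toricAutomorphisms (K := K) B x, ∀ a ∈ S, φ a ∈ S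

end ToricAction

/-! ### Cluster algebras -/

section Cluster

variable (K : Type*) [Field K] {n : ℕ} {ex : Finset (Fin n)}

/-- The field `K(x_1, …, x_n)`. -/
abbrev RationalFunctions (n : ℕ) : Type _ := FractionRing (MvPolynomial (Fin n) K)

/-- A seed: an extended cluster in `K(x_1, …, x_n)` with an exchange matrix. -/
structure Seed (ex : Finset (Fin n)) where
  x : Fin n → RationalFunctions K n
  B : Matrix ex (Fin n) ℤ

variable {K}

/-- Seed mutation: `x_k` is replaced by `P_k / x_k`, where `P_k` is the exchange polynomial. -/
def Seed.mutate (s : Seed K ex) (k : ex) : Seed K ex where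
  x := Function.update s.x (k : Fin n)
    ((∏ j, s.x j ^ (s.B k j).toNat + ∏ j, s.x j ^ (-s.B k j).toNat) / s.x k)
  B := mutateMatrix s.B k

variable (K)

/-- The variable `x_i` of the initial cluster. -/
def initVar (i : Fin n) : RationalFunctions K n := algebraMap (MvPolynomial (Fin n) K) _ (MvPolynomial.X i)

/-- The initial seed `(x, B)`. -/
def Seed.init (B : Matrix ex (Fin n) ℤ) : Seed K ex := ⟨initVar K, B⟩

/-- The set of all (mutable and frozen) cluster variables of the seeds that are mutation equivalent
to `(x, B)`. -/
def clusterVariables (B : Matrix ex (Fin n) ℤ) : Set (RationalFunctions K n) :=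
  {y | ∃ s, Relation.ReflTransGen (fun s t : Seed K ex => ∃ k, t = s.mutate k) (Seed.init K B) s ∧
    ∃ i, y = s.x i}

/-- The cluster algebra of the initial seed `(x, B)` (coefficients are not inverted). -/
def clusterAlgebra (B : Matrix ex (Fin n) ℤ) : Subalgebra K (RationalFunctions K n) :=
  Algebra.adjoin K (clusterVariables K B)

/-- The initial cluster variable `x_i` as an element of the cluster algebra. -/
def clusterVar (B : Matrix ex (Fin n) ℤ) (i : Fin n) : clusterAlgebra K B :=
  ⟨initVar K i, Algebra.subset_adjoin ⟨Seed.init K B, .refl, i, rfl⟩⟩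

/-- The derivation `∂ / ∂ x_i` of `K(x_1, …, x_n)`, given by the quotient rule. -/
def partialDeriv (i : Fin n) (f : RationalFunctions K n) : RationalFunctions K n :=
  let p := (IsLocalization.sec (MvPolynomial (Fin n) K)⁰ f).1
  let q : MvPolynomial (Fin n) K := (IsLocalization.sec (MvPolynomial (Fin n) K)⁰ f).2
  algebraMap _ _ (MvPolynomial.pderiv i p * q - p * MvPolynomial.pderiv i q) /
    algebraMap _ _ (q ^ 2)

/-- The quotient rule for `partialDeriv`, for every representation of `f` as a fraction. -/
theorem partialDeriv_div (i : Fin n) (a b : MvPolynomial (Fin n) K) (hb : b ≠ 0) :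
    partialDeriv K i (algebraMap _ _ a / algebraMap _ _ b) =
      algebraMap _ (RationalFunctions K n) (MvPolynomial.pderiv i a * b - a * MvPolynomial.pderiv i b) /
        algebraMap _ _ (b ^ 2) := by
  set f : RationalFunctions K n := algebraMap _ _ a / algebraMap _ _ b with hf
  unfold partialDeriv
  have hs := IsLocalization.sec_spec (MvPolynomial (Fin n) K)⁰ f
  set p := (IsLocalization.sec (MvPolynomial (Fin n) K)⁰ f).1
  have hq0 := nonZeroDivisors.coe_ne_zero (IsLocalization.sec (MvPolynomial (Fin n) K)⁰ f).2
  set q : MvPolynomial (Fin n) K :=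
    ((IsLocalization.sec (MvPolynomial (Fin n) K)⁰ f).2 : MvPolynomial (Fin n) K)
  have hinj := IsFractionRing.injective (MvPolynomial (Fin n) K) (RationalFunctions K n)
  have hb' : algebraMap (MvPolynomial (Fin n) K) (RationalFunctions K n) b ≠ 0 := by
    simpa using hb
  have hq' : algebraMap (MvPolynomial (Fin n) K) (RationalFunctions K n) q ≠ 0 := by
    simpa using hq0
  have h1 : a * q = p * b := by
    apply hinj
    rw [map_mul, map_mul, ← hs, hf]
    field_simp
  have h2 := congrArg (MvPolynomial.pderiv i) h1
  simp only [Derivation.leibniz, smul_eq_mul] at h2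
  rw [div_eq_div_iff (by simpa using hq0) (by simpa using hb), ← map_mul, ← map_mul]
  congr 1
  linear_combination (-(b * q)) * h2 +
    (b * MvPolynomial.pderiv i q + q * MvPolynomial.pderiv i b) * h1

/-- The log-canonical Poisson bracket on `K(x_1, …, x_n)` with `{x_i, x_j} = λ_ij x_i x_j`:
`{f, g} = ∑ λ_ij x_i x_j (∂f / ∂x_i) (∂g / ∂x_j)`. -/
def logBracket (Λ : Matrix (Fin n) (Fin n) ℤ) (f g : RationalFunctions K n) : RationalFunctions K n :=
  ∑ i, ∑ j, (Λ i j : RationalFunctions K n) *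
    (initVar K i * partialDeriv K i f) * (initVar K j * partialDeriv K j g)

/-- The cluster algebra is closed under the bracket, i.e. it is a Poisson cluster algebra. -/
def IsPoissonClusterAlgebra (B : Matrix ex (Fin n) ℤ) (Λ : Matrix (Fin n) (Fin n) ℤ) : Prop :=
  ∀ a ∈ clusterAlgebra K B, ∀ b ∈ clusterAlgebra K B, logBracket K Λ a b ∈ clusterAlgebra K B

variable {K}

/-- `{I, A} ⊆ I`. -/
def IsPoissonIdeal {B : Matrix ex (Fin n) ℤ} (Λ : Matrix (Fin n) (Fin n) ℤ)
    (I : Ideal (clusterAlgebra K B)) : Prop :=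
  ∀ a ∈ I, ∀ b : clusterAlgebra K B, ∃ c ∈ I, (c : RationalFunctions K n) = logBracket K Λ a b

/-- `I` is stable under the global toric actions. -/
def IsToricIdeal {B : Matrix ex (Fin n) ℤ} (I : Ideal (clusterAlgebra K B)) : Prop :=
  IsTorusStable K B (initVar K) (Subtype.val '' (I : Set (clusterAlgebra K B)))

/-- Torus invariant Poisson prime ideals (TIPPs). -/
structure IsTIPP {B : Matrix ex (Fin n) ℤ} (Λ : Matrix (Fin n) (Fin n) ℤ)
    (I : Ideal (clusterAlgebra K B)) : Prop where
  isPrime : I.IsPrime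
  isPoisson : IsPoissonIdeal Λ I
  isToric : IsToricIdeal I

/-- A co-dimension one stratification of depth `r`: TIPPs `I_n ⊂ I_{n-1} ⊂ … ⊂ I_{n-r+1}` such that
`I_k` contains exactly the variables `x_k, …, x_n` of the cluster. Only the values `I k` with
`n - r + 1 ≤ k ≤ n` matter. The variable `x_j` is indexed by `i : Fin n` with `j = i + 1`. -/
structure IsPoissonCOS {B : Matrix ex (Fin n) ℤ} (Λ : Matrix (Fin n) (Fin n) ℤ) (r : ℕ)
    (I : ℕ → Ideal (clusterAlgebra K B)) : Prop where
  depth_le : r ≤ n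
  isTIPP : ∀ k, n < k + r → k ≤ n → IsTIPP Λ (I k)
  mem_iff : ∀ k, n < k + r → k ≤ n → ∀ i : Fin n, clusterVar K B i ∈ I k ↔ k ≤ (i : ℕ) + 1
  le : ∀ k, n < k + r → k + 1 ≤ n → I (k + 1) ≤ I k

/-- The stratum `P.spec_J(A)`: Poisson prime ideals `P` such that `J` is the largest torus stable
ideal contained in `P`. It carries the subspace topology of the Zariski topology. -/
def poissonStratum {B : Matrix ex (Fin n) ℤ} (Λ : Matrix (Fin n) (Fin n) ℤ)
    (J : Ideal (clusterAlgebra K B)) : Set (PrimeSpectrum (clusterAlgebra K B)) :=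
  {P | IsPoissonIdeal Λ P.asIdeal ∧
    IsGreatest {I : Ideal (clusterAlgebra K B) | IsToricIdeal I ∧ I ≤ P.asIdeal} J}

end Cluster

/-! ### Poisson tori -/

section PoissonTorus

variable {K : Type*} [Field K] {k : ℕ}

/-- The bracket of the Poisson torus `(K[x_1^±1, …, x_k^±1], Λ)`: the bilinear extension of
`{x^m, x^m'} = Λ(m, m') x^(m + m')`, so that `{x_i, x_j} = λ_ij x_i x_j`. -/
def torusBracket (Λ : Matrix (Fin k) (Fin k) ℤ) (f g : AddMonoidAlgebra K (Fin k → ℤ)) :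
    AddMonoidAlgebra K (Fin k → ℤ) :=
  f.coeff.sum fun m a => g.coeff.sum fun m' b =>
    AddMonoidAlgebra.single (m + m') (((m ⬝ᵥ Λ *ᵥ m' : ℤ) : K) * a * b)

/-- The Poisson spectrum of the Poisson torus: the prime ideals that are stable under the bracket,
with the subspace topology of the Zariski topology. -/
def torusPoissonSpec (K : Type*) [Field K] (Λ : Matrix (Fin k) (Fin k) ℤ) :
    Set (PrimeSpectrum (AddMonoidAlgebra K (Fin k → ℤ))) :=
  {P | ∀ f ∈ P.asIdeal, ∀ g, torusBracket Λ f g ∈ P.asIdeal}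

end PoissonTorus

/-! ### Prime spectra of noncommutative rings -/

section NCSpec

variable {R : Type*} [Ring R]

/-- Prime two-sided ideals. -/
structure IsPrimeIdeal (P : TwoSidedIdeal R) : Prop where
  ne_top : P ≠ ⊤
  mem_or_mem : ∀ a b : R, (∀ r : R, a * r * b ∈ P) → a ∈ P ∨ b ∈ P

/-- Every prime ideal `P` is completely prime: `a * b ∈ P` implies `a ∈ P` or `b ∈ P`. -/
def PrimesAreCompletelyPrime (R : Type*) [Ring R] : Prop :=
  ∀ P : TwoSidedIdeal R, IsPrimeIdeal P → ∀ a b : R, a * b ∈ P → a ∈ P ∨ b ∈ P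

variable (R)

/-- The set of prime ideals of a ring. -/
def NCSpec : Type _ := {P : TwoSidedIdeal R // IsPrimeIdeal P}

/-- The Zariski topology: the closed sets are the sets `V(I)` of primes containing `I`. -/
instance : TopologicalSpace (NCSpec R) :=
  TopologicalSpace.generateFrom {U | ∃ I : TwoSidedIdeal R, U = {P : NCSpec R | ¬ I ≤ P.1}}

end NCSpec

/-! ### Quantum tori and their skew fields of fractions -/

section QuantumTorus
variable {K : Type*} [Field K] {n : ℕ}

/-- The quantum torus over `K`: finite linear combinations of symbols `X^m`, `m ∈ ℤ^n`, multiplied by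
`X^m * X^m' = v ^ Λ(m, m') • X^(m + m')`. For skew-symmetric `Λ` this gives
`X_i * X_j = v ^ (2 λ_ij) • X_j * X_i`, so that `q = v ^ 2`. -/
@[ext]
structure QTorus (v : Kˣ) (Λ : Matrix (Fin n) (Fin n) ℤ) where
  /-- The coefficients with respect to the basis `X^m`. -/
  coeff : (Fin n → ℤ) →₀ K

namespace QTorus
variable (v : Kˣ) (Λ : Matrix (Fin n) (Fin n) ℤ)

/-- The structure constant `v ^ Λ(m, m')`. -/
def cocycle (m m' : Fin n → ℤ) : K := ((v ^ (m ⬝ᵥ Λ *ᵥ m') : Kˣ) : K)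

/-- The bilinear extension of `(X^m, X^m') ↦ v ^ Λ(m, m') • X^(m + m')`. -/
def mulHom : ((Fin n → ℤ) →₀ K) →ₗ[K] ((Fin n → ℤ) →₀ K) →ₗ[K] ((Fin n → ℤ) →₀ K) :=
  Finsupp.lsum K fun m : Fin n → ℤ =>
    LinearMap.toSpanSingleton K (((Fin n → ℤ) →₀ K) →ₗ[K] ((Fin n → ℤ) →₀ K))
      (Finsupp.lsum K fun m' : Fin n → ℤ =>
        LinearMap.toSpanSingleton K ((Fin n → ℤ) →₀ K)
          (Finsupp.single (m + m') (cocycle v Λ m m')))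

variable {v Λ}

instance : Zero (QTorus v Λ) := ⟨⟨0⟩⟩
instance : Add (QTorus v Λ) := ⟨fun f g => ⟨f.coeff + g.coeff⟩⟩
instance : Neg (QTorus v Λ) := ⟨fun f => ⟨-f.coeff⟩⟩
instance : Sub (QTorus v Λ) := ⟨fun f g => ⟨f.coeff - g.coeff⟩⟩
instance : SMul ℕ (QTorus v Λ) := ⟨fun k f => ⟨k • f.coeff⟩⟩
instance : SMul ℤ (QTorus v Λ) := ⟨fun k f => ⟨k • f.coeff⟩⟩
instance : SMul K (QTorus v Λ) := ⟨fun c f => ⟨c • f.coeff⟩⟩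
instance : Mul (QTorus v Λ) := ⟨fun f g => ⟨mulHom v Λ f.coeff g.coeff⟩⟩
instance : One (QTorus v Λ) := ⟨⟨Finsupp.single 0 1⟩⟩

theorem coeff_injective : Function.Injective (coeff : QTorus v Λ → ((Fin n → ℤ) →₀ K)) :=
  fun _ _ => QTorus.ext

@[simp] theorem coeff_zero : (0 : QTorus v Λ).coeff = 0 := rfl
@[simp] theorem coeff_add (f g : QTorus v Λ) : (f + g).coeff = f.coeff + g.coeff := rfl
@[simp] theorem coeff_smul (c : K) (f : QTorus v Λ) : (c • f).coeff = c • f.coeff := rfl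
theorem coeff_one : (1 : QTorus v Λ).coeff = Finsupp.single 0 1 := rfl
theorem coeff_mul (f g : QTorus v Λ) : (f * g).coeff = mulHom v Λ f.coeff g.coeff := rfl

instance : AddCommGroup (QTorus v Λ) :=
  coeff_injective.addCommGroup coeff rfl (fun _ _ => rfl) (fun _ => rfl) (fun _ _ => rfl)
    (fun _ _ => rfl) (fun _ _ => rfl)

/-- Taking coefficients, as an additive map. -/
def coeffHom : QTorus v Λ →+ ((Fin n → ℤ) →₀ K) where
  toFun := coeff
  map_zero' := rfl
  map_add' _ _ := rfl

instance : Module K (QTorus v Λ) := coeff_injective.module K coeffHom fun _ _ => rfl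

theorem mulHom_single (m m' : Fin n → ℤ) (a b : K) :
    mulHom v Λ (Finsupp.single m a) (Finsupp.single m' b) =
      Finsupp.single (m + m') (a * b * cocycle v Λ m m') := by
  rw [mulHom, Finsupp.lsum_single, LinearMap.toSpanSingleton_apply, LinearMap.smul_apply,
    Finsupp.lsum_single, LinearMap.toSpanSingleton_apply, Finsupp.smul_single,
    Finsupp.smul_single, smul_eq_mul, smul_eq_mul, mul_assoc]

theorem cocycle_assoc (a b c : Fin n → ℤ) :
    cocycle v Λ a b * cocycle v Λ (a + b) c = cocycle v Λ b c * cocycle v Λ a (b + c) := by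
  simp only [cocycle, ← Units.val_mul, ← zpow_add, add_dotProduct, Matrix.mulVec_add,
    dotProduct_add]
  congr 2
  ring

theorem mulHom_assoc (f g h : (Fin n → ℤ) →₀ K) :
    mulHom v Λ (mulHom v Λ f g) h = mulHom v Λ f (mulHom v Λ g h) := by
  induction f using Finsupp.induction_linear with
  | zero => simp
  | add f f' hf hf' => simp only [map_add, LinearMap.add_apply, hf, hf']
  | single a c =>
  induction g using Finsupp.induction_linear with
  | zero => simp
  | add f f' hf hf' => simp only [map_add, LinearMap.add_apply, hf, hf']
  | single b d =>
  induction h using Finsupp.induction_linear with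
  | zero => simp
  | add f f' hf hf' => simp only [map_add, hf, hf']
  | single k e =>
  simp only [mulHom_single, add_assoc]
  congr 1
  linear_combination (c * d * e) * cocycle_assoc (v := v) (Λ := Λ) a b k

theorem one_mulHom (f : (Fin n → ℤ) →₀ K) : mulHom v Λ (Finsupp.single 0 1) f = f := by
  induction f using Finsupp.induction_linear with
  | zero => simp
  | add f f' hf hf' => simp only [map_add, hf, hf']
  | single a c => simp [mulHom_single, cocycle]

theorem mulHom_one (f : (Fin n → ℤ) →₀ K) : mulHom v Λ f (Finsupp.single 0 1) = f := by
  induction f using Finsupp.induction_linear with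
  | zero => simp
  | add f f' hf hf' => simp only [map_add, LinearMap.add_apply, hf, hf']
  | single a c => simp [mulHom_single, cocycle]

instance : Ring (QTorus v Λ) where
  __ := (inferInstance : AddCommGroup (QTorus v Λ))
  __ := (inferInstance : Mul (QTorus v Λ))
  __ := (inferInstance : One (QTorus v Λ))
  left_distrib f g h := QTorus.ext (by simp only [coeff_mul, coeff_add, map_add])
  right_distrib f g h := QTorus.ext (by
    simp only [coeff_mul, coeff_add, map_add, LinearMap.add_apply])
  zero_mul f := QTorus.ext (by simp only [coeff_mul, coeff_zero, map_zero, LinearMap.zero_apply])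
  mul_zero f := QTorus.ext (by simp only [coeff_mul, coeff_zero, map_zero])
  mul_assoc f g h := QTorus.ext (by simp only [coeff_mul, mulHom_assoc])
  one_mul f := QTorus.ext (by rw [coeff_mul, coeff_one, one_mulHom])
  mul_one f := QTorus.ext (by rw [coeff_mul, coeff_one, mulHom_one])
  neg_add_cancel := neg_add_cancel
  sub_eq_add_neg := sub_eq_add_neg
  zsmul := fun k f => k • f
  zsmul_zero' := zero_zsmul
  zsmul_succ' := fun k f => by
    rw [show ((k.succ : ℕ) : ℤ) = (k : ℤ) + 1 by push_cast; rfl, add_zsmul, one_zsmul]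
  zsmul_neg' := fun k f => by
    rw [Int.negSucc_eq, neg_zsmul]; push_cast; rfl

instance : Algebra K (QTorus v Λ) :=
  Algebra.ofModule
    (fun r f g => QTorus.ext (by
      simp only [coeff_mul, coeff_smul, map_smul, LinearMap.smul_apply]))
    (fun r f g => QTorus.ext (by simp only [coeff_mul, coeff_smul, map_smul]))

instance : Nontrivial (QTorus v Λ) :=
  ⟨⟨0, 1, fun h => by
    have := congrArg (fun f : QTorus v Λ => f.coeff 0) h
    simp [coeff_one] at this⟩⟩

theorem coeff_mul_apply (f g : QTorus v Λ) (m : Fin n → ℤ) :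
    (f * g).coeff m = ∑ a ∈ f.coeff.support, ∑ b ∈ g.coeff.support,
      if a + b = m then f.coeff a * g.coeff b * cocycle v Λ a b else 0 := by
  classical
  rw [coeff_mul]
  conv_lhs => rw [← f.coeff.sum_single, ← g.coeff.sum_single]
  simp only [Finsupp.sum, map_sum, LinearMap.sum_apply, mulHom_single, Finsupp.finsetSum_apply,
    Finsupp.single_apply]
  rw [Finset.sum_comm]

theorem cocycle_ne_zero (a b : Fin n → ℤ) : cocycle v Λ a b ≠ 0 := Units.ne_zero _

instance : NoZeroDivisors (QTorus v Λ) where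
  eq_zero_or_eq_zero_of_mul_eq_zero := by
    intro f g h
    by_contra! hne
    have hf : f.coeff.support.Nonempty :=
      Finsupp.support_nonempty_iff.2 fun h0 => hne.1 (QTorus.ext h0)
    have hg : g.coeff.support.Nonempty :=
      Finsupp.support_nonempty_iff.2 fun h0 => hne.2 (QTorus.ext h0)
    obtain ⟨a, ha, b, hb, hu⟩ := UniqueSums.uniqueAdd_of_nonempty hf hg
    have h0 : (f * g).coeff (a + b) = 0 := by rw [h]; rfl
    rw [coeff_mul_apply, Finset.sum_eq_single_of_mem a ha, Finset.sum_eq_single_of_mem b hb] at h0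
    · simp only [if_true, mul_eq_zero] at h0
      rcases h0 with (h0 | h0) | h0
      · exact Finsupp.mem_support_iff.1 ha h0
      · exact Finsupp.mem_support_iff.1 hb h0
      · exact cocycle_ne_zero _ _ h0
    · intro b' hb' hne'
      rw [if_neg]
      intro he
      exact hne' (hu ha hb' he).2
    · intro a' ha' hne'
      refine Finset.sum_eq_zero fun b' hb' => ?_
      rw [if_neg]
      intro he
      exact hne' (hu ha' hb' he).1

/-- The box `[-N, N]^n` of exponents. -/
def box (n N : ℕ) : Finset (Fin n → ℤ) := Fintype.piFinset fun _ => Finset.Icc (-(N : ℤ)) N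

theorem card_box (N : ℕ) : (box n N).card = (2 * N + 1) ^ n := by
  simp only [box, Fintype.card_piFinset, Int.card_Icc, Finset.prod_const, Finset.card_univ,
    Fintype.card_fin]
  congr 1
  omega

theorem exists_subset_box (s : Finset (Fin n → ℤ)) : ∃ N, s ⊆ box n N := by
  refine ⟨∑ m ∈ s, ∑ i, (m i).natAbs, fun m hm => ?_⟩
  simp only [box, Fintype.mem_piFinset, Finset.mem_Icc]
  intro i
  have h1 : (m i).natAbs ≤ ∑ i, (m i).natAbs :=
    Finset.single_le_sum (f := fun i => (m i).natAbs) (fun _ _ => Nat.zero_le _)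
      (Finset.mem_univ i)
  have h2 : ∑ i, (m i).natAbs ≤ ∑ m ∈ s, ∑ i, (m i).natAbs :=
    Finset.single_le_sum (f := fun m : Fin n → ℤ => ∑ i, (m i).natAbs)
      (fun _ _ => Nat.zero_le _) hm
  omega

theorem exists_card_lt (n N : ℕ) :
    ∃ L : ℕ, (2 * (L + N) + 1) ^ n < 2 * (2 * L + 1) ^ n := by
  refine ⟨2 * n * N + N, ?_⟩
  set L := 2 * n * N + N
  have hpos : (0 : ℝ) < 2 * (L + N) + 1 := by positivity
  have hb : 1 + (n : ℝ) * (-(2 * N / (2 * (L + N) + 1))) ≤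
      (1 + -(2 * N / (2 * (L + N) + 1) : ℝ)) ^ n := by
    apply one_add_mul_le_pow
    have : (2 * N / (2 * (L + N) + 1) : ℝ) ≤ 1 := by
      rw [div_le_one hpos]
      have : (0 : ℝ) ≤ L := by positivity
      linarith
    linarith
  have h1 : (1 + -(2 * N / (2 * (L + N) + 1) : ℝ)) = (2 * L + 1) / (2 * (L + N) + 1) := by
    field_simp
    ring
  have h2 : (1 / 2 : ℝ) < 1 + (n : ℝ) * (-(2 * N / (2 * (L + N) + 1))) := by
    have : (n : ℝ) * (2 * N / (2 * (L + N) + 1)) < 1 / 2 := by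
      rw [← mul_div_assoc, div_lt_iff₀ hpos]
      have : (L : ℝ) = 2 * n * N + N := by simp [L]
      rw [this]
      have : (0 : ℝ) ≤ N := by positivity
      nlinarith
    linarith
  rw [h1, div_pow] at hb
  have h3 := h2.trans_le hb
  rw [lt_div_iff₀ (by positivity)] at h3
  have : ((2 * (L + N) + 1) ^ n : ℝ) < 2 * (2 * L + 1) ^ n := by linarith
  exact_mod_cast this

theorem supp_mul_subset_box {f g : QTorus v Λ} {L N : ℕ} (hf : f.coeff.support ⊆ box n L)
    (hg : g.coeff.support ⊆ box n N) : (f * g).coeff.support ⊆ box n (L + N) := by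
  intro m hm
  rw [Finsupp.mem_support_iff, coeff_mul_apply] at hm
  obtain ⟨a, ha, hm⟩ := Finset.exists_ne_zero_of_sum_ne_zero hm
  obtain ⟨b, hb, hm⟩ := Finset.exists_ne_zero_of_sum_ne_zero hm
  have he : a + b = m := by
    by_contra he
    simp [he] at hm
  have ha' := hf ha
  have hb' := hg hb
  simp only [box, Fintype.mem_piFinset, Finset.mem_Icc] at ha' hb' ⊢
  intro i
  have := ha' i
  have := hb' i
  have : m i = a i + b i := by rw [← he]; rfl
  push_cast
  omega

theorem ore_condition (r s : QTorus v Λ) (hs : s ≠ 0) :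
    ∃ p q : QTorus v Λ, p ≠ 0 ∧ p * r = q * s := by
  classical
  by_cases hr : r = 0
  · exact ⟨1, 0, one_ne_zero, by simp [hr]⟩
  obtain ⟨N, hN⟩ := exists_subset_box (r.coeff.support ∪ s.coeff.support)
  have hrN := Finset.union_subset_left hN
  have hsN := Finset.union_subset_right hN
  obtain ⟨L, hL⟩ := exists_card_lt n N
  let V := Finsupp.supported K K (box n L : Set (Fin n → ℤ))
  let W := Finsupp.supported K K (box n (L + N) : Set (Fin n → ℤ))
  let T : (V × V) →ₗ[K] ((Fin n → ℤ) →₀ K) :=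
    (((mulHom v Λ).flip r.coeff).comp V.subtype).coprod
      (-(((mulHom v Λ).flip s.coeff).comp V.subtype))
  have hTe : ∀ p q : V, T (p, q) =
      ((⟨p⟩ : QTorus v Λ) * r).coeff - ((⟨q⟩ : QTorus v Λ) * s).coeff := by
    intro p q
    simp [T, sub_eq_add_neg, coeff_mul]
  have hV : ∀ p : V, (p : (Fin n → ℤ) →₀ K).support ⊆ box n L := fun p => by
    have := (Finsupp.mem_supported K _).1 p.2
    exact_mod_cast this
  have hT : ∀ x, T x ∈ W := by
    rintro ⟨p, q⟩
    rw [hTe]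
    refine W.sub_mem ?_ ?_
    · exact (Finsupp.mem_supported K _).2
        (by exact_mod_cast supp_mul_subset_box (f := ⟨p⟩) (hV p) hrN)
    · exact (Finsupp.mem_supported K _).2
        (by exact_mod_cast supp_mul_subset_box (f := ⟨q⟩) (hV q) hsN)
  let eV : V ≃ₗ[K] ((box n L : Set (Fin n → ℤ)) →₀ K) := Finsupp.supportedEquivFinsupp _
  let eW : W ≃ₗ[K] ((box n (L + N) : Set (Fin n → ℤ)) →₀ K) := Finsupp.supportedEquivFinsupp _
  have : Module.Finite K V := Module.Finite.equiv eV.symm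
  have : Module.Finite K W := Module.Finite.equiv eW.symm
  have dV : Module.finrank K V = (2 * L + 1) ^ n := by
    rw [eV.finrank_eq, Module.finrank_finsupp_self]
    simp [card_box]
  have dW : Module.finrank K W = (2 * (L + N) + 1) ^ n := by
    rw [eW.finrank_eq, Module.finrank_finsupp_self]
    simp [card_box]
  have : Module.Free K V := Module.Free.of_equiv eV.symm
  have hlt : Module.finrank K W < Module.finrank K (V × V) := by
    rw [Module.finrank_prod, dV, dW]
    omega
  obtain ⟨⟨p, q⟩, hx, hx0⟩ : ∃ x : V × V, T x = 0 ∧ x ≠ 0 := by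
    by_contra! hcon
    have hinj : Function.Injective (T.codRestrict W hT) := by
      rw [injective_iff_map_eq_zero]
      exact fun x hx => hcon x (congrArg Subtype.val hx)
    exact absurd (LinearMap.finrank_le_finrank_of_injective hinj) hlt.not_ge
  have hx' : (⟨p⟩ : QTorus v Λ) * r = (⟨q⟩ : QTorus v Λ) * s := by
    rw [hTe] at hx
    exact QTorus.ext (sub_eq_zero.1 hx)
  refine ⟨⟨p⟩, ⟨q⟩, fun hp => hx0 ?_, hx'⟩
  rw [hp, zero_mul] at hx'
  have hq : (⟨q⟩ : QTorus v Λ) = 0 := (mul_eq_zero.1 hx'.symm).resolve_right hs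
  ext1
  · exact Subtype.ext (congrArg coeff hp)
  · exact Subtype.ext (congrArg coeff hq)

instance : OreLocalization.OreSet (QTorus v Λ)⁰ where
  ore_right_cancel r₁ r₂ s h := ⟨1, by
    have hs : (s : QTorus v Λ) ≠ 0 := nonZeroDivisors.coe_ne_zero s
    exact congrArg _ (mul_right_cancel₀ hs h)⟩
  oreNum r s := (ore_condition r s (nonZeroDivisors.coe_ne_zero s)).choose_spec.choose
  oreDenom r s := ⟨(ore_condition r s (nonZeroDivisors.coe_ne_zero s)).choose,
    mem_nonZeroDivisors_of_ne_zero
      (ore_condition r s (nonZeroDivisors.coe_ne_zero s)).choose_spec.choose_spec.1⟩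
  ore_eq r s := (ore_condition r s (nonZeroDivisors.coe_ne_zero s)).choose_spec.choose_spec.2

end QTorus

end QuantumTorus

/-! ### Quantum cluster algebras -/

section QuantumCluster

variable {K : Type*} [Field K] {n : ℕ} {ex : Finset (Fin n)}

/-- The skew field of fractions of the quantum torus. -/
abbrev QField (v : Kˣ) (Λ : Matrix (Fin n) (Fin n) ℤ) : Type _ :=
  OreLocalization (QTorus v Λ)⁰ (QTorus v Λ)

/-- The toric frame with `X_i X_j = v ^ (2 λ_ij) • X_j X_i`: the normalized Laurent monomial
`M(c) = v ^ (-∑_{i<j} c_i c_j λ_ij) • X_1 ^ c_1 ⋯ X_n ^ c_n`. -/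
def toricFrame {F : Type*} [DivisionRing F] [Algebra K F] (v : Kˣ)
    (Λ : Matrix (Fin n) (Fin n) ℤ) (X : Fin n → F) (c : Fin n → ℤ) : F :=
  ((v ^ (-∑ i, ∑ j, if i < j then c i * c j * Λ i j else 0) : Kˣ) : K) •
    (List.ofFn fun i => X i ^ c i).prod

/-- A quantum seed, given by the images `X_i = M(e_i)` under its toric frame, its exchange matrix
and its commutation matrix. -/
structure QSeed (F : Type*) (ex : Finset (Fin n)) where
  X : Fin n → F
  B : Matrix ex (Fin n) ℤ
  Λ : Matrix (Fin n) (Fin n) ℤ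

/-- Quantum seed mutation: `X_k` is replaced by
`M(-e_k + ∑_{b_ki > 0} b_ki e_i) + M(-e_k - ∑_{b_ki < 0} b_ki e_i)`. -/
def QSeed.mutate {F : Type*} [DivisionRing F] [Algebra K F] (v : Kˣ) (s : QSeed F ex) (k : ex) :
    QSeed F ex where
  X := Function.update s.X (k : Fin n)
    (toricFrame v s.Λ s.X (fun i => (if i = (k : Fin n) then -1 else 0) + max (s.B k i) 0) +
      toricFrame v s.Λ s.X (fun i => (if i = (k : Fin n) then -1 else 0) + max (-s.B k i) 0))
  B := mutateMatrix s.B k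
  Λ := mutateForm s.B s.Λ k

variable (v : Kˣ) (B : Matrix ex (Fin n) ℤ) (Λ : Matrix (Fin n) (Fin n) ℤ)

/-- The variable `X_i` of the initial quantum cluster. -/
def initQVar (i : Fin n) : QField v Λ :=
  OreLocalization.numeratorHom (⟨Finsupp.single (Pi.single i 1) 1⟩ : QTorus v Λ)

/-- The initial quantum seed. -/
def QSeed.init : QSeed (QField v Λ) ex := ⟨initQVar v Λ, B, Λ⟩

/-- The set of all (mutable and frozen) cluster variables of the quantum seeds that are mutation
equivalent to the initial one. -/
def quantumClusterVariables : Set (QField v Λ) :=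
  {y | ∃ s, Relation.ReflTransGen (fun s t : QSeed (QField v Λ) ex => ∃ k, t = s.mutate v k)
    (QSeed.init v B Λ) s ∧ ∃ i, y = s.X i}

/-- The quantum cluster algebra of the initial seed `(x, B, Λ)`, over the field `K`, with quantum
parameter `q = v ^ 2`. -/
def quantumClusterAlgebra : Subalgebra K (QField v Λ) :=
  Algebra.adjoin K (quantumClusterVariables v B Λ)

/-- The initial cluster variable `X_i` as an element of the quantum cluster algebra. -/
def quantumClusterVar (i : Fin n) : quantumClusterAlgebra v B Λ :=
  ⟨initQVar v Λ i, Algebra.subset_adjoin ⟨QSeed.init v B Λ, .refl, i, rfl⟩⟩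

variable {v B Λ}

/-- `I` is stable under the global toric actions. -/
def IsQuantumToricIdeal (I : TwoSidedIdeal (quantumClusterAlgebra v B Λ)) : Prop :=
  IsTorusStable K B (initQVar v Λ) (Subtype.val '' (I : Set (quantumClusterAlgebra v B Λ)))

/-- A co-dimension one stratification of depth `r`: torus invariant prime ideals
`I_n ⊂ I_{n-1} ⊂ … ⊂ I_{n-r+1}` such that `I_k` contains exactly the variables `x_k, …, x_n` of the
cluster. Only the values `I k` with `n - r + 1 ≤ k ≤ n` matter. -/
structure IsQuantumCOS (r : ℕ) (I : ℕ → TwoSidedIdeal (quantumClusterAlgebra v B Λ)) : Prop where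
  depth_le : r ≤ n
  isPrime : ∀ k, n < k + r → k ≤ n → IsPrimeIdeal (I k)
  isToric : ∀ k, n < k + r → k ≤ n → IsQuantumToricIdeal (I k)
  mem_iff : ∀ k, n < k + r → k ≤ n →
    ∀ i : Fin n, quantumClusterVar v B Λ i ∈ I k ↔ k ≤ (i : ℕ) + 1
  le : ∀ k, n < k + r → k + 1 ≤ n → I (k + 1) ≤ I k

/-- The stratum `spec_J(A_q)`: prime ideals `P` such that `J` is the largest torus stable ideal
contained in `P`. It carries the subspace topology of the Zariski topology. -/
def quantumStratum (J : TwoSidedIdeal (quantumClusterAlgebra v B Λ)) :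
    Set (NCSpec (quantumClusterAlgebra v B Λ)) :=
  {P | IsGreatest {I : TwoSidedIdeal (quantumClusterAlgebra v B Λ) |
    IsQuantumToricIdeal I ∧ I ≤ P.1} J}

end QuantumCluster

end

end ClusterSpectra

open scoped nonZeroDivisors Matrix

namespace ClusterSpectra

noncomputable section

/-! The ideal `I_k` of a stratification is the kernel of the successive substitutions `x_n = 0, …,
x_k = 0`. Their image consists of Laurent polynomials in `x_1, …, x_{k-1}` and contains all
polynomials in these variables, so inverting monomials gives the whole torus. The stratum of `I_k`
consists of the (Poisson) primes that contain `I_k` and none of `x_1, …, x_{k-1}`, and these are the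
(Poisson) primes of the localization.

Laurent phenomenon. Substitutions make sense only for Laurent expansions. An element of the torus of
a seed and of all adjacent tori also lies in the tori two mutations away; therefore the intersection
of these tori (the upper bound) is invariant under mutation, and every cluster variable lies in it.
The rank two statements are `mem_mutFrame₂_of_pos` and `mem_mutFrame₂_of_eq_zero`; the case of
negative `b_ji` follows by passing to `-B`. Everything is done for a frame `M`, a family of
independent vectors with `M a * M b = v ^ Λ(a,b) • M (a + b)`. No condition on `v` is needed there,
so `v = 1` covers the commutative cluster algebra.

Separation. Let a toric ideal be contained in a completely prime ideal `P` (Poisson in the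
commutative case) without `x_1, …, x_j`. A polynomial in these variables in the toric ideal splits
into torus weight components; conjugation by `x_i`, or the bracket with `x_i`, splits each component
further inside `P`. By the super-toric condition these operators separate all exponents
(`IsSuperToric.eq_zero`), so a nonzero polynomial would put a monomial into `P`, which complete
primeness forbids (`IsLaurentAlgebra.eq_zero_of_stable`). Applied to `I_k` this shows that `I_k`
contains no nonzero polynomial in `x_1, …, x_{k-1}`; applied to a prime `P ⊇ I_k` it shows that
`I_k` is the largest toric ideal in `P`.

Residues. If the substitutions down to `x_{j+1} = 0` are defined, no element of the image has a pole
along `x_j`: multiplying by `x_j` lowers the pole order, and a product with `x_j` lies in the next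
ideal, so its part free of `x_j` vanishes. Hence `x_j = 0` can be substituted, and its kernel is the
next ideal (`IsResidue.exists_step`).

Localization. The residue map makes the torus an Ore localization of a quotient (`IsOreQuotient`).
Contraction and extension give the homeomorphism `IsOreQuotient.homeomorph`; contractions of primes
are prime by a Noetherian argument. In the Poisson case the usual commutative statements apply, and
`IsResidue.comap_isBracketStable_iff` matches the Poisson conditions. -/

/-! ### Bilinear forms and spans of families indexed by a lattice -/

section Form

variable {n : ℕ}

/-- The bilinear form on `ℤ^n` with Gram matrix `Λ`. -/
def form (Λ : Matrix (Fin n) (Fin n) ℤ) (a b : Fin n → ℤ) : ℤ := a ⬝ᵥ Λ *ᵥ b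

variable {Λ : Matrix (Fin n) (Fin n) ℤ}

theorem form_add_left (a b c : Fin n → ℤ) : form Λ (a + b) c = form Λ a c + form Λ b c :=
  add_dotProduct _ _ _

theorem form_add_right (a b c : Fin n → ℤ) : form Λ a (b + c) = form Λ a b + form Λ a c := by
  simp [form, Matrix.mulVec_add, dotProduct_add]

theorem form_smul_left (r : ℤ) (a b : Fin n → ℤ) : form Λ (r • a) b = r * form Λ a b :=
  smul_dotProduct r a _

theorem form_smul_right (r : ℤ) (a b : Fin n → ℤ) : form Λ a (r • b) = r * form Λ a b := by
  rw [form, Matrix.mulVec_smul, dotProduct_smul, smul_eq_mul, form]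

theorem form_neg_left (a b : Fin n → ℤ) : form Λ (-a) b = -form Λ a b := by
  simp [form]

theorem form_neg_right (a b : Fin n → ℤ) : form Λ a (-b) = -form Λ a b := by
  simp [form, Matrix.mulVec_neg]

theorem form_sub_right (a b c : Fin n → ℤ) : form Λ a (b - c) = form Λ a b - form Λ a c := by
  rw [sub_eq_add_neg, form_add_right, form_neg_right, sub_eq_add_neg]

@[simp] theorem form_zero_left (a : Fin n → ℤ) : form Λ 0 a = 0 := by simp [form]

@[simp] theorem form_zero_right (a : Fin n → ℤ) : form Λ a 0 = 0 := by simp [form]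

theorem form_single (i j : Fin n) : form Λ (Pi.single i 1) (Pi.single j 1) = Λ i j := by
  simp [form]

theorem form_swap (h : Λᵀ = -Λ) (a b : Fin n → ℤ) : form Λ b a = -form Λ a b := by
  have h1 : a ⬝ᵥ Λ *ᵥ b = b ⬝ᵥ Λᵀ *ᵥ a := by
    rw [Matrix.mulVec_transpose, Matrix.dotProduct_mulVec, dotProduct_comm]
  rw [form, form, h1, h, Matrix.neg_mulVec, dotProduct_neg, neg_neg]

theorem form_self (h : Λᵀ = -Λ) (a : Fin n → ℤ) : form Λ a a = 0 := by
  have := form_swap h a a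
  omega

end Form

/-! ### Spans of subfamilies, gradings and leading terms. -/

section Span

variable {K : Type*} [Field K] {F : Type*} [AddCommGroup F] [Module K F] {V : Type*}

/-- The span of the part of the family `M` with indices in `C`. -/
def sp (K : Type*) [Field K] [Module K F] (M : V → F) (C : Set V) : Submodule K F :=
  Submodule.span K (M '' C)

variable {M : V → F} {C D : Set V}

theorem mem_sp {a : V} (h : a ∈ C) : M a ∈ sp K M C := Submodule.subset_span ⟨a, h, rfl⟩

theorem sp_mono (h : C ⊆ D) : sp K M C ≤ sp K M D := Submodule.span_mono (Set.image_mono h)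

theorem sp_le {N : Submodule K F} : sp K M C ≤ N ↔ ∀ a ∈ C, M a ∈ N := by
  rw [sp, Submodule.span_le, Set.image_subset_iff]
  rfl

theorem exists_sp_split (P : Set V) {f : F} (hf : f ∈ sp K M C) :
    ∃ g ∈ sp K M (C ∩ P), ∃ h ∈ sp K M (C ∩ Pᶜ), f = g + h := by
  have : sp K M C = sp K M (C ∩ P) ⊔ sp K M (C ∩ Pᶜ) := by
    rw [sp, sp, sp, ← Submodule.span_union, ← Set.image_union, Set.inter_union_compl]
  rw [this, Submodule.mem_sup] at hf
  obtain ⟨g, hg, h, hh, e⟩ := hf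
  exact ⟨g, hg, h, hh, e.symm⟩

theorem mem_sp_iff {f : F} : f ∈ sp K M C ↔
    ∃ c : V →₀ K, ↑c.support ⊆ C ∧ Finsupp.linearCombination K M c = f := by
  rw [sp, Finsupp.mem_span_image_iff_linearCombination]
  rfl

theorem sp_inter (hM : LinearIndependent K M) {f : F} (h1 : f ∈ sp K M C) (h2 : f ∈ sp K M D) :
    f ∈ sp K M (C ∩ D) := by
  rw [mem_sp_iff] at *
  obtain ⟨c, hc, rfl⟩ := h1
  obtain ⟨d, hd, e⟩ := h2
  have := hM e
  subst this
  exact ⟨d, Set.subset_inter hc hd, rfl⟩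

theorem sp_disjoint (hM : LinearIndependent K M) (h : Disjoint C D) {f : F} (h1 : f ∈ sp K M C)
    (h2 : f ∈ sp K M D) : f = 0 := by
  have := sp_inter hM h1 h2
  rw [h.inter_eq] at this
  simpa [sp] using this

/-- A property of all homogeneous components, for a grading `β`, holds for the whole sum. -/
theorem mem_of_components {W : Type*} (β : V → W) {N : Submodule K F} {f : F}
    (hf : f ∈ sp K M Set.univ)
    (H : ∀ r, ∀ g ∈ sp K M {x | β x = r}, ∀ g' ∈ sp K M {x | β x = r}ᶜ, f = g + g' → g ∈ N) :
    f ∈ N := by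
  classical
  obtain ⟨c, -, rfl⟩ := mem_sp_iff.1 hf
  have hc : c = ∑ r ∈ c.support.image β, c.filter fun x => β x = r := by
    ext x
    rw [Finsupp.finsetSum_apply]
    simp only [Finsupp.filter_apply]
    by_cases hx : x ∈ c.support
    · rw [Finset.sum_eq_single_of_mem (β x) (Finset.mem_image_of_mem _ hx)]
      · simp
      · intro r _ hr
        simp [hr.symm]
    · simp [Finsupp.notMem_support_iff.1 hx]
  have hs := congrArg (Finsupp.linearCombination K M) hc
  rw [map_sum] at hs
  rw [hs]
  refine Submodule.sum_mem _ fun r _ => H r _ (mem_sp_iff.2 ⟨_, ?_, rfl⟩) _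
    (mem_sp_iff.2 ⟨c.filter fun x => ¬ β x = r, ?_, rfl⟩) ?_
  · intro x hx
    have := (Finsupp.mem_support_iff.1 hx)
    rw [Finsupp.filter_apply] at this
    by_contra h
    exact this (if_neg h)
  · intro x hx
    have := (Finsupp.mem_support_iff.1 hx)
    rw [Finsupp.filter_apply] at this
    by_contra h
    exact this (if_neg h)
  · rw [← map_add, Finsupp.filter_add_filter_not]

theorem sp_unique (hM : LinearIndependent K M) (h : Disjoint C D) {f g f' g' : F}
    (hf : f ∈ sp K M C) (hg : g ∈ sp K M D) (hf' : f' ∈ sp K M C) (hg' : g' ∈ sp K M D)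
    (e : f + g = f' + g') : f = f' ∧ g = g' := by
  have h1 : f - f' = g' - g := by
    rw [sub_eq_sub_iff_add_eq_add, e, add_comm]
  have h2 := sp_disjoint hM h (sub_mem hf hf') (h1 ▸ sub_mem hg' hg)
  refine ⟨sub_eq_zero.1 h2, ?_⟩
  rw [h2] at h1
  exact (sub_eq_zero.1 h1.symm).symm

/-- The leading term of a combination of vectors `N a = u a • M (σ a) + (terms of higher degree)`. -/
theorem exists_leading_mem (hM : LinearIndependent K M) {U : Type*} {N : U → F} {σ : U → V}
    (hσ : Function.Injective σ) (l : V → ℤ) {c : U →₀ K} {u : U → K} (hu : ∀ a, u a ≠ 0)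
    (hN : ∀ a ∈ c.support, N a - u a • M (σ a) ∈ sp K M {b | l (σ a) < l b}) (hc : c ≠ 0)
    (h : Finsupp.linearCombination K N c ∈ sp K M C) :
    ∃ a ∈ c.support, (∀ a' ∈ c.support, l (σ a) ≤ l (σ a')) ∧ σ a ∈ C := by
  classical
  obtain ⟨a, ha, hmin⟩ := Finset.exists_min_image c.support (fun a => l (σ a))
    (Finsupp.support_nonempty_iff.2 hc)
  refine ⟨a, ha, hmin, ?_⟩
  by_contra hC
  have key : c a • u a • M (σ a) = Finsupp.linearCombination K N c
      - ∑ a' ∈ c.support.erase a, c a' • u a' • M (σ a')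
      - ∑ a' ∈ c.support, c a' • (N a' - u a' • M (σ a')) := by
    rw [Finsupp.linearCombination_apply, Finsupp.sum]
    simp only [smul_sub, Finset.sum_sub_distrib]
    rw [← Finset.add_sum_erase c.support (fun a' => c a' • u a' • M (σ a')) ha]
    abel
  -- If `σ a ∉ C`, nothing on the right of `key` involves the index `σ a`: the other leading terms
  -- because `σ` is injective, the tails because `l` is minimal at `a`. Independence then kills the
  -- coefficient of `M (σ a)`.
  have hmem : c a • u a • M (σ a) ∈ sp K M {σ a}ᶜ := by
    rw [key]
    refine sub_mem (sub_mem (sp_mono ?_ h) ?_) ?_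
    · intro b hb hb'
      rw [Set.mem_singleton_iff] at hb'
      exact hC (hb' ▸ hb)
    · refine Submodule.sum_mem _ fun a' ha' => Submodule.smul_mem _ _ (Submodule.smul_mem _ _ (mem_sp ?_))
      intro e
      exact (Finset.mem_erase.1 ha').1 (hσ e)
    · refine Submodule.sum_mem _ fun a' ha' => Submodule.smul_mem _ _ (sp_mono ?_ (hN a' ha'))
      intro b hb e
      rw [Set.mem_singleton_iff] at e
      rw [Set.mem_ofPred_eq, e] at hb
      exact absurd (hmin a' ha') (not_le.2 hb)
  have h0 := sp_disjoint hM (disjoint_compl_right (a := {σ a}))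
    (Submodule.smul_mem _ (c a) (Submodule.smul_mem _ (u a) (mem_sp rfl))) hmem
  rw [smul_eq_zero, smul_eq_zero] at h0
  rcases h0 with h0 | h0 | h0
  · exact Finsupp.mem_support_iff.1 ha h0
  · exact hu a h0
  · exact hM.ne_zero _ h0

end Span

/-! ### Frames -/

section Frame

variable {K : Type*} [Field K] {F : Type*} [Ring F] [Algebra K F] {n : ℕ}

/-- The scalar `v ^ e`. -/
def vpow (v : Kˣ) (e : ℤ) : K := ((v ^ e : Kˣ) : K)

theorem vpow_add (v : Kˣ) (a b : ℤ) : vpow v (a + b) = vpow v a * vpow v b := by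
  simp [vpow, zpow_add]

@[simp] theorem vpow_zero (v : Kˣ) : vpow v 0 = 1 := by simp [vpow]

theorem vpow_ne_zero (v : Kˣ) (a : ℤ) : vpow v a ≠ 0 := Units.ne_zero _

/-- A (based, injective) quantum torus inside an algebra. -/
structure IsFrame (v : Kˣ) (Λ : Matrix (Fin n) (Fin n) ℤ) (M : (Fin n → ℤ) → F) : Prop where
  skew : Λᵀ = -Λ
  map_zero : M 0 = 1
  mul : ∀ a b, M a * M b = vpow v (form Λ a b) • M (a + b)
  indep : LinearIndependent K M

variable {v : Kˣ} {Λ : Matrix (Fin n) (Fin n) ℤ} {M : (Fin n → ℤ) → F}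

namespace IsFrame

variable (h : IsFrame v Λ M)
include h

theorem mul_neg (a : Fin n → ℤ) : M a * M (-a) = 1 := by
  rw [h.mul, add_neg_cancel, h.map_zero, form_neg_right, form_self h.skew, neg_zero, vpow_zero,
    one_smul]

theorem neg_mul (a : Fin n → ℤ) : M (-a) * M a = 1 := by
  simpa using h.mul_neg (-a)

theorem ne_zero (a : Fin n → ℤ) : M a ≠ 0 := h.indep.ne_zero a

theorem map_add (a b : Fin n → ℤ) : M (a + b) = vpow v (-form Λ a b) • (M a * M b) := by
  rw [h.mul, smul_smul, ← vpow_add]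
  simp

theorem mul_mem {C D G : Set (Fin n → ℤ)} {f g : F} (hf : f ∈ sp K M C) (hg : g ∈ sp K M D)
    (hG : ∀ a ∈ C, ∀ b ∈ D, a + b ∈ G) : f * g ∈ sp K M G := by
  have := Submodule.mul_mem_mul hf hg
  rw [sp, sp, Submodule.span_mul_span] at this
  refine Submodule.span_le.2 ?_ this
  rintro _ ⟨_, ⟨a, ha, rfl⟩, _, ⟨b, hb, rfl⟩, rfl⟩
  change M a * M b ∈ _
  rw [h.mul]
  exact Submodule.smul_mem _ _ (mem_sp (hG a ha b hb))

theorem pow (a : Fin n → ℤ) (i : ℕ) : M a ^ i = M (i • a) := by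
  induction i with
  | zero => simp [h.map_zero]
  | succ i ih =>
    rw [pow_succ, ih, h.mul, succ_nsmul, ← natCast_zsmul, form_smul_left, form_self h.skew]
    simp

theorem comm (a b : Fin n → ℤ) : M a * M b = vpow v (2 * form Λ a b) • (M b * M a) := by
  rw [h.mul, h.mul, smul_smul, ← vpow_add, add_comm b a, form_swap h.skew a b]
  congr 2
  ring

theorem aeval_mem_of_natDegree_le (b : Fin n → ℤ) {P : Polynomial K} {m : ℕ}
    (hP : P.natDegree ≤ m) : Polynomial.aeval (M b) P ∈ sp K M {a | ∃ i : ℕ, i ≤ m ∧ a = i • b} := by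
  rw [Polynomial.aeval_eq_sum_range' (n := m + 1) (by omega)]
  refine Submodule.sum_mem _ fun i hi => Submodule.smul_mem _ _ ?_
  rw [h.pow]
  exact mem_sp ⟨i, Nat.lt_succ_iff.1 (Finset.mem_range.1 hi), rfl⟩

theorem aeval_mem (b : Fin n → ℤ) (P : Polynomial K) :
    Polynomial.aeval (M b) P ∈ sp K M {a | ∃ i : ℕ, a = i • b} :=
  sp_mono (by rintro _ ⟨i, -, hi⟩; exact ⟨i, hi⟩) (h.aeval_mem_of_natDegree_le b le_rfl)

theorem aeval_mul_X_pow_mem (b : Fin n → ℤ) (P : Polynomial K) (N : ℕ) :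
    Polynomial.aeval (M b) (P * Polynomial.X ^ N) ∈ sp K M {a | ∃ i : ℕ, N ≤ i ∧ a = i • b} := by
  rw [map_mul, map_pow, Polynomial.aeval_X, h.pow]
  refine h.mul_mem (D := {N • b}) (h.aeval_mem b P) (mem_sp rfl) ?_
  rintro _ ⟨i, rfl⟩ _ rfl
  exact ⟨i + N, by omega, by rw [add_smul]⟩

/-- After removing the constant term `1` only positive powers of `M b` remain, so `M x` is the
leading term for every functional that is positive on `b`. This is the input for
`exists_leading_mem`. -/
theorem aeval_mul_sub_mem (b x : Fin n → ℤ) {P : Polynomial K} (hP : P.coeff 0 = 1) :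
    Polynomial.aeval (M b) P * M x - M x ∈ sp K M {a | ∃ i : ℕ, 1 ≤ i ∧ a = x + i • b} := by
  obtain ⟨Q, hQ⟩ := Polynomial.X_dvd_iff.2 (show (P - 1).coeff 0 = 0 by simp [hP])
  have : Polynomial.aeval (M b) P * M x - M x =
      Polynomial.aeval (M b) (Q * Polynomial.X ^ 1) * M x := by
    rw [pow_one, mul_comm Q, ← hQ]
    simp [sub_mul]
  rw [this]
  refine h.mul_mem (D := {x}) (h.aeval_mul_X_pow_mem b Q 1) (mem_sp rfl) ?_
  rintro _ ⟨i, hi, rfl⟩ _ rfl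
  exact ⟨i, hi, add_comm _ _⟩

/-- The powers of `M b` are monomials with distinct exponents since `b ≠ 0`, hence independent. -/
theorem aeval_ne_zero {b : Fin n → ℤ} (hb : b ≠ 0) {P : Polynomial K} (hP : P ≠ 0) :
    Polynomial.aeval (M b) P ≠ 0 := by
  intro h0
  have hinj : Function.Injective fun i : ℕ => i • b := by
    intro i j hij
    obtain ⟨t, ht⟩ := Function.ne_iff.1 hb
    have := congrFun hij t
    simp only [Pi.smul_apply, nsmul_eq_mul] at this
    exact_mod_cast mul_right_cancel₀ ht this
  have hi := h.indep.comp _ hinj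
  rw [Polynomial.aeval_eq_sum_range] at h0
  simp only [h.pow] at h0
  refine hP (Polynomial.ext fun i => ?_)
  by_cases hi' : i ∈ Finset.range (P.natDegree + 1)
  · exact linearIndependent_iff'.1 hi _ _ h0 i hi'
  · exact Polynomial.coeff_eq_zero_of_natDegree_lt (by simpa using hi')

end IsFrame

end Frame

/-! ### Combinatorics of mutation -/

section Mutation

variable {n : ℕ} {ex : Finset (Fin n)}

/-- Compatible pairs, with the diagonal entries of `B * Λ` of constant sign. -/
structure IsCompat (B : Matrix ex (Fin n) ℤ) (Λ : Matrix (Fin n) (Fin n) ℤ) (d : ex → ℤ) : Prop where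
  skew : Λᵀ = -Λ
  form_row : ∀ (i : ex) (a : Fin n → ℤ), form Λ (B i) a = d i * a i
  sign : ∀ i j, 0 < d i * d j

theorem IsCompatiblePair.exists_isCompat {B : Matrix ex (Fin n) ℤ} {Λ : Matrix (Fin n) (Fin n) ℤ}
    (h : IsCompatiblePair B Λ) : ∃ d, IsCompat B Λ d := by
  obtain ⟨d, hd, e⟩ := h.mul_eq
  refine ⟨d, h.skewSymm, fun i a => ?_, fun i j => mul_pos (hd i) (hd j)⟩
  rw [form, Matrix.dotProduct_mulVec]
  have : B i ᵥ* Λ = fun j => if (i : Fin n) = j then d i else 0 := funext fun j => e i j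
  rw [this]
  simp [dotProduct]

/-- The action of the matrix `E_{k,+}` on `ℤ^n`. -/
def flip (B : Matrix ex (Fin n) ℤ) (k : ex) (a : Fin n → ℤ) : Fin n → ℤ := fun i =>
  if i = (k : Fin n) then -a k else a i + a k * max 0 (-B k i)

variable {B : Matrix ex (Fin n) ℤ} {Λ : Matrix (Fin n) (Fin n) ℤ} {d : ex → ℤ} {k : ex}

theorem flip_self (a : Fin n → ℤ) : flip B k a k = -a k := by simp [flip]

theorem flip_of_ne (a : Fin n → ℤ) {i : Fin n} (hi : i ≠ k) :
    flip B k a i = a i + a k * max 0 (-B k i) := by simp [flip, hi]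

theorem mutationE_mulVec (a : Fin n → ℤ) : mutationE B k *ᵥ a = flip B k a := by
  ext i
  rw [Matrix.mulVec, dotProduct, ← Finset.add_sum_erase _ _ (Finset.mem_univ (k : Fin n))]
  by_cases hi : i = k
  · subst hi
    rw [flip_self, Finset.sum_eq_zero]
    · simp [mutationE]
    · intro j hj
      have := Finset.ne_of_mem_erase hj
      simp [mutationE, this, this.symm]
  · rw [flip_of_ne _ hi, Finset.sum_eq_single i]
    · simp [mutationE, hi]
      ring
    · intro j hj hij
      have := Finset.ne_of_mem_erase hj
      simp [mutationE, this, hij.symm]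
    · intro h
      simp [hi] at h

theorem form_mutateForm (a b : Fin n → ℤ) :
    form (mutateForm B Λ k) a b = form Λ (flip B k a) (flip B k b) := by
  simp only [form, mutateForm, ← Matrix.mulVec_mulVec, mutationE_mulVec]
  rw [Matrix.mulVec_transpose, dotProduct_comm, ← Matrix.dotProduct_mulVec, dotProduct_comm,
    mutationE_mulVec]

theorem flip_add (a b : Fin n → ℤ) : flip B k (a + b) = flip B k a + flip B k b := by
  rw [← mutationE_mulVec, Matrix.mulVec_add, mutationE_mulVec, mutationE_mulVec]

theorem flip_neg (a : Fin n → ℤ) : flip B k (-a) = -flip B k a := by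
  rw [← mutationE_mulVec, Matrix.mulVec_neg, mutationE_mulVec]

theorem flip_flip (a : Fin n → ℤ) : flip B k (flip B k a) = a := by
  ext i
  by_cases hi : i = k
  · subst hi
    simp [flip]
  · rw [flip_of_ne _ hi, flip_of_ne _ hi, flip_self]
    ring

theorem flip_injective : Function.Injective (flip B k) :=
  Function.LeftInverse.injective flip_flip

theorem flip_of_eq_zero {a : Fin n → ℤ} (h : a k = 0) : flip B k a = a := by
  ext i
  by_cases hi : i = k
  · rw [hi, flip_self, h, neg_zero]
  · rw [flip_of_ne _ hi, h]
    ring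

namespace IsCompat

variable (h : IsCompat B Λ d)
include h

theorem d_ne (i : ex) : d i ≠ 0 := fun e => by simpa [e] using h.sign i i

theorem skewB (i j : ex) : d i * B j i = -(d j * B i j) := by
  rw [← h.form_row, ← h.form_row, form_swap h.skew]

theorem diag (i : ex) : B i i = 0 := by
  have := h.skewB i i
  have h2 : d i * B i i = 0 := by linarith
  exact (mul_eq_zero.1 h2).resolve_left (h.d_ne i)

theorem form_row_right (i : ex) (a : Fin n → ℤ) : form Λ a (B i) = -(d i * a i) := by
  rw [form_swap h.skew, h.form_row]

/-- Opposite entries of the exchange matrix have opposite signs. -/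
theorem pos_iff (i j : ex) : 0 < B i j ↔ B j i < 0 := by
  have h1 := h.skewB i j
  have h2 := h.sign i j
  have h3 : (d i * d j) * B i j = -(d i * d i) * B j i := by linear_combination d i * h1
  have h4 := h.sign i i
  constructor
  · intro h5
    by_contra h6
    nlinarith [mul_pos h2 h5]
  · intro h5
    by_contra h6
    nlinarith [mul_pos_of_neg_of_neg (neg_lt_zero.2 h4) h5]

theorem row_ne_zero (i : ex) : B i ≠ 0 := by
  intro e
  have := h.form_row i (Pi.single i 1)
  rw [e, form_zero_left] at this
  simp at this
  exact h.d_ne i this.symm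

/-- By `skewB` the numbers `d i * (-B j i)` and `d j * B i j` agree, and by `pos_iff` both maxima
vanish together; the sign of `d` is thus irrelevant. This identity keeps `d` unchanged under
mutation. -/
theorem max_eq (i j : ex) : d i * max 0 (-B j i) = d j * max 0 (B i j) := by
  have h1 := h.skewB i j
  have h2 := h.pos_iff i j
  have h3 := h.pos_iff j i
  rcases lt_trichotomy (B j i) 0 with h4 | h4 | h4
  · rw [max_eq_right (by omega), max_eq_right (by omega)]
    linarith
  · rw [h4] at h1 ⊢
    have : B i j = 0 := by
      have : d j * B i j = 0 := by linarith
      exact (mul_eq_zero.1 this).resolve_left (h.d_ne j)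
    simp [this]
  · have := h3.1 h4
    rw [max_eq_left (by omega), max_eq_left (by omega)]
    simp

end IsCompat

theorem mutateMatrix_self (j : Fin n) : mutateMatrix B k k j = -B k j := by simp [mutateMatrix]

theorem mutateMatrix_col (i : ex) : mutateMatrix B k i k = -B i k := by simp [mutateMatrix]

theorem mutateMatrix_of_ne {i : ex} (hi : i ≠ k) {j : Fin n} (hj : j ≠ k) :
    mutateMatrix B k i j = B i j + (|B i k| * B k j + B i k * |B k j|) / 2 := by
  simp [mutateMatrix, hi, hj]

/-- Removes the integer division from the mutation rule, with the sign choice `max 0 (-y)` that also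
defines `flip`. -/
theorem half_abs (x y : ℤ) : (|x| * y + x * |y|) / 2 = x * max 0 (-y) + max 0 x * y := by
  rcases le_total 0 x with hx | hx <;> rcases le_total 0 y with hy | hy
  · rw [abs_of_nonneg hx, abs_of_nonneg hy, max_eq_left (by omega), max_eq_right hx]
    omega
  · rw [abs_of_nonneg hx, abs_of_nonpos hy, max_eq_right (by omega), max_eq_right hx]
    simp
  · rw [abs_of_nonpos hx, abs_of_nonneg hy, max_eq_left (by omega), max_eq_left hx]
    simp
  · rw [abs_of_nonpos hx, abs_of_nonpos hy, max_eq_right (by omega), max_eq_left hx]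
    have : -x * y + x * -y = 2 * (x * -y) := by ring
    rw [this, Int.mul_ediv_cancel_left _ (by norm_num)]
    simp

theorem mutateMatrix_of_ne' {i : ex} (hi : i ≠ k) {j : Fin n} (hj : j ≠ k) :
    mutateMatrix B k i j = B i j + (B i k * max 0 (-B k j) + max 0 (B i k) * B k j) := by
  rw [mutateMatrix_of_ne hi hj, half_abs]

/-- The summand `B i k * max 0 (-B k j)` of the mutation rule cancels against `flip`, because column
`k` changes sign. Rows of the mutated matrix thus go to combinations of old rows, on which
`form_row` evaluates the form. -/
theorem flip_mutate_row (h0 : B k k = 0) {i : ex} (hi : i ≠ k) :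
    flip B k (mutateMatrix B k i) = B i + max 0 (B i k) • B k := by
  ext j
  by_cases hj : j = k
  · subst hj
    rw [flip_self, mutateMatrix_col]
    simp [h0]
  · rw [flip_of_ne _ hj, mutateMatrix_of_ne' hi hj, mutateMatrix_col]
    simp
    ring

theorem flip_mutate_row_self (h0 : B k k = 0) : flip B k (mutateMatrix B k k) = -B k := by
  have : mutateMatrix B k k = -B k := funext fun j => mutateMatrix_self j
  rw [this, flip_of_eq_zero]
  simp [h0]

theorem IsCompat.mutate (h : IsCompat B Λ d) (k : ex) :
    IsCompat (mutateMatrix B k) (mutateForm B Λ k) d where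
  skew := by
    rw [mutateForm, Matrix.transpose_mul, Matrix.transpose_mul, Matrix.transpose_transpose, h.skew]
    simp [Matrix.mul_assoc]
  sign := h.sign
  form_row i a := by
    rw [form_mutateForm]
    by_cases hi : i = k
    · subst hi
      rw [flip_mutate_row_self (h.diag i), form_neg_left, h.form_row, flip_self]
      ring
    · rw [flip_mutate_row (h.diag k) hi, form_add_left, form_smul_left, h.form_row, h.form_row,
        flip_self, flip_of_ne]
      · linear_combination a k * h.max_eq i k
      · exact fun e => hi (Subtype.ext e)

theorem mutateMatrix_mutateMatrix (h0 : B k k = 0) : mutateMatrix (mutateMatrix B k) k = B := by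
  ext i j
  by_cases hi : i = k
  · subst hi
    rw [mutateMatrix_self, mutateMatrix_self, neg_neg]
  by_cases hj : j = k
  · subst hj
    rw [mutateMatrix_col, mutateMatrix_col, neg_neg]
  rw [mutateMatrix_of_ne hi hj, mutateMatrix_of_ne hi hj, mutateMatrix_col, mutateMatrix_self,
    half_abs]
  have := half_abs (-B i k) (-B k j)
  rw [this]
  rcases le_total 0 (B i k) with hx | hx <;> rcases le_total 0 (B k j) with hy | hy
  · rw [max_eq_left (by omega), max_eq_right (by omega), max_eq_right (by omega), max_eq_left (by omega)]; ring
  · rw [max_eq_right (by omega), max_eq_right (by omega), max_eq_left (by omega), max_eq_left (by omega)]; ring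
  · rw [max_eq_left (by omega), max_eq_left (by omega), max_eq_right (by omega), max_eq_right (by omega)]; ring
  · rw [max_eq_right (by omega), max_eq_left (by omega), max_eq_left (by omega), max_eq_right (by omega)]; ring

theorem ext_form {Λ' : Matrix (Fin n) (Fin n) ℤ} (h : ∀ a b, form Λ a b = form Λ' a b) : Λ = Λ' := by
  ext i j
  have := h (Pi.single i 1) (Pi.single j 1)
  rwa [form_single, form_single] at this

/-- The transvection `a ↦ a + a_k b_k` preserves the form. -/
theorem IsCompat.form_transvection (h : IsCompat B Λ d) (a b : Fin n → ℤ) :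
    form Λ (a + a k • B k) (b + b k • B k) = form Λ a b := by
  simp only [form_add_left, form_add_right, form_smul_left, form_smul_right, h.form_row,
    h.form_row_right, Pi.add_apply, Pi.smul_apply, h.diag, smul_eq_mul]
  ring

/-- The two base changes use `max 0 (B k i)` and `max 0 (-B k i)`, whose difference is `B k i`.
Double mutation of `Λ` is therefore a transvection, not the identity, on exponents. -/
theorem flip_flip_mutate (h0 : B k k = 0) (a : Fin n → ℤ) :
    flip B k (flip (mutateMatrix B k) k a) = a + a k • B k := by
  ext i
  by_cases hi : i = k
  · subst hi
    simp [flip, h0]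
  · rw [flip_of_ne _ hi, flip_of_ne _ hi, flip_self, mutateMatrix_self]
    rcases le_total 0 (B k i) with hx | hx
    · rw [max_eq_right (by omega), max_eq_left (by omega)]
      simp
    · rw [max_eq_left (by omega), max_eq_right (by omega)]
      simp

theorem IsCompat.mutateForm_mutateForm (h : IsCompat B Λ d) (k : ex) :
    mutateForm (mutateMatrix B k) (mutateForm B Λ k) k = Λ := by
  refine ext_form fun a b => ?_
  rw [form_mutateForm, form_mutateForm, flip_flip_mutate (h.diag k), flip_flip_mutate (h.diag k),
    h.form_transvection]

/-- The base changes for the two signs differ by a transvection, which preserves the form; so the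
mutation of `Λ` is the same for `B` and `-B`. -/
theorem flip_neg_matrix (h0 : B k k = 0) (a : Fin n → ℤ) :
    flip (-B) k a = flip B k a + (flip B k a) k • -B k := by
  ext i
  by_cases hi : i = k
  · subst hi
    simp [flip, h0]
  · rw [Pi.add_apply, flip_of_ne _ hi, flip_of_ne _ hi, flip_self]
    rcases le_total 0 (B k i) with hx | hx
    · simp [hx]
    · simp [hx]

theorem IsCompat.neg (h : IsCompat B Λ d) : IsCompat (-B) Λ (-d) where
  skew := h.skew
  sign i j := by simpa using h.sign i j
  form_row i a := by
    have : (-B) i = -(B i) := rfl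
    rw [this, form_neg_left, h.form_row, Pi.neg_apply, neg_mul]

theorem IsCompat.mutateForm_neg (h : IsCompat B Λ d) (k : ex) :
    mutateForm (-B) Λ k = mutateForm B Λ k := by
  refine ext_form fun a b => ?_
  rw [form_mutateForm, form_mutateForm, flip_neg_matrix (h.diag k), flip_neg_matrix (h.diag k)]
  exact h.neg.form_transvection (k := k) _ _

theorem mutateMatrix_neg (k : ex) : mutateMatrix (-B) k = -mutateMatrix B k := by
  ext i j
  rw [Matrix.neg_apply]
  by_cases hi : i = k
  · subst hi
    rw [mutateMatrix_self, mutateMatrix_self, Matrix.neg_apply]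
  by_cases hj : j = k
  · subst hj
    rw [mutateMatrix_col, mutateMatrix_col, Matrix.neg_apply]
  rw [mutateMatrix_of_ne hi hj, mutateMatrix_of_ne hi hj, Matrix.neg_apply, Matrix.neg_apply,
    Matrix.neg_apply, half_abs, half_abs]
  rcases le_total 0 (B i k) with hx | hx <;> rcases le_total 0 (B k j) with hy | hy
  · rw [max_eq_right (by omega), max_eq_left (by omega), max_eq_left (by omega), max_eq_right (by omega)]; ring
  · rw [max_eq_left (by omega), max_eq_left (by omega), max_eq_right (by omega), max_eq_right (by omega)]; ring
  · rw [max_eq_right (by omega), max_eq_right (by omega), max_eq_left (by omega), max_eq_left (by omega)]; ring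
  · rw [max_eq_left (by omega), max_eq_right (by omega), max_eq_right (by omega), max_eq_left (by omega)]; ring

end Mutation

/-! ### Mutation of frames -/

section MutFrame

variable {K : Type*} [Field K] {F : Type*} [DivisionRing F] [Algebra K F] {n : ℕ}
  {ex : Finset (Fin n)}

theorem zpow_mul_of_quasi_comm {v : Kˣ} {e : ℤ} {u x : F} (hu : u ≠ 0)
    (h : u * x = vpow v e • (x * u)) (m : ℤ) : u ^ m * x = vpow v (m * e) • (x * u ^ m) := by
  have hnat : ∀ (e : ℤ) (w : F), w * x = vpow v e • (x * w) →
      ∀ m : ℕ, w ^ m * x = vpow v (m * e) • (x * w ^ m) := by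
    intro e w hw m
    induction m with
    | zero => simp
    | succ m ih =>
      rw [pow_succ, mul_assoc, hw, mul_smul_comm, ← mul_assoc, ih, smul_mul_assoc, smul_smul,
        ← vpow_add, mul_assoc]
      congr 2
      push_cast
      ring
  have hinv : u⁻¹ * x = vpow v (-e) • (x * u⁻¹) := by
    have h1 : x * u⁻¹ = vpow v e • (u⁻¹ * x) := by
      calc x * u⁻¹ = u⁻¹ * (u * x) * u⁻¹ := by rw [← mul_assoc, inv_mul_cancel₀ hu, one_mul]
        _ = _ := by
          rw [h, mul_smul_comm, smul_mul_assoc, mul_assoc, mul_assoc, mul_inv_cancel₀ hu, mul_one]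
    rw [h1, smul_smul, ← vpow_add]
    simp
  obtain ⟨m, rfl | rfl⟩ := m.eq_nat_or_neg
  · simpa using hnat e u h m
  · simpa using hnat (-e) u⁻¹ hinv m

/-- The polynomials `∏_{i<m} (1 + v ^ (d (2 i + 1)) X)`. -/
def mutPoly (v : Kˣ) (d : ℤ) (m : ℕ) : Polynomial K :=
  ∏ i ∈ Finset.range m, (1 + Polynomial.C (vpow v (d * (2 * i + 1))) * Polynomial.X)

theorem mutPoly_zero (v : Kˣ) (d : ℤ) : mutPoly v d 0 = 1 := by simp [mutPoly]

theorem mutPoly_succ (v : Kˣ) (d : ℤ) (m : ℕ) : mutPoly v d (m + 1) =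
    mutPoly v d m * (1 + Polynomial.C (vpow v (d * (2 * m + 1))) * Polynomial.X) := by
  rw [mutPoly, Finset.prod_range_succ, mutPoly]

theorem mutPoly_one (v : Kˣ) (d : ℤ) : mutPoly v d 1 =
    1 + Polynomial.C (vpow v d) * Polynomial.X := by
  simp [mutPoly]

theorem mutPoly_coeff_zero (v : Kˣ) (d : ℤ) (m : ℕ) : (mutPoly v d m).coeff 0 = 1 := by
  rw [Polynomial.coeff_zero_eq_eval_zero, mutPoly, Polynomial.eval_prod]
  simp

theorem natDegree_mutPoly_le (v : Kˣ) (d : ℤ) (m : ℕ) : (mutPoly v d m).natDegree ≤ m := by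
  refine (Polynomial.natDegree_prod_le _ _).trans ?_
  refine (Finset.sum_le_card_nsmul _ _ 1 fun i _ => ?_).trans (by simp)
  compute_degree

/-- The exponents `d * (2 * i + 1)` for `i < m` add up to `d * m ^ 2`. -/
theorem mutPoly_coeff_top (v : Kˣ) (d : ℤ) (m : ℕ) :
    (mutPoly v d m).coeff m = vpow v (d * (m * m)) := by
  induction m with
  | zero => simp [mutPoly_zero]
  | succ m ih =>
    have h0 := Polynomial.coeff_eq_zero_of_natDegree_lt
      (Nat.lt_succ_of_le (natDegree_mutPoly_le v d m))
    rw [mutPoly_succ, mul_add, mul_one, Polynomial.coeff_add, h0, zero_add, ← mul_assoc,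
      Polynomial.coeff_mul_X, Polynomial.coeff_mul_C, ih, ← vpow_add]
    congr 1
    push_cast
    ring

theorem mutPoly_ne_zero (v : Kˣ) (d : ℤ) (m : ℕ) : mutPoly v d m ≠ 0 := by
  intro h
  have := mutPoly_coeff_zero v d m
  rw [h] at this
  simp at this

theorem mutPoly_dvd (v : Kˣ) (d : ℤ) {m N : ℕ} (h : m ≤ N) : mutPoly v d m ∣ mutPoly v d N :=
  Finset.prod_dvd_prod_of_subset _ _ _ (Finset.range_mono h)

/-- The vector `e_i`. -/
abbrev unitVec (i : Fin n) : Fin n → ℤ := Pi.single i 1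

theorem update_eq_sub (a : Fin n → ℤ) (k : Fin n) :
    Function.update a k 0 = a - a k • unitVec k := by
  ext i
  by_cases hi : i = k
  · subst hi
    simp
  · simp [hi]

/-- The new variable in the mutation of a frame. -/
def mutVar (B : Matrix ex (Fin n) ℤ) (M : (Fin n → ℤ) → F) (k : ex) : F :=
  M (fun i => (if i = (k : Fin n) then -1 else 0) + max (B k i) 0) +
    M (fun i => (if i = (k : Fin n) then -1 else 0) + max (-B k i) 0)

/-- The mutated frame. -/
def mutFrame (v : Kˣ) (B : Matrix ex (Fin n) ℤ) (Λ : Matrix (Fin n) (Fin n) ℤ)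
    (M : (Fin n → ℤ) → F) (k : ex) (a : Fin n → ℤ) : F :=
  vpow v (-form Λ (Function.update a k 0) (a k • flip B k (unitVec k))) •
    (M (Function.update a k 0) * mutVar B M k ^ a k)

variable {v : Kˣ} {B : Matrix ex (Fin n) ℤ} {Λ : Matrix (Fin n) (Fin n) ℤ} {d : ex → ℤ} {k : ex}
  {M : (Fin n → ℤ) → F}

theorem IsCompat.exp_neg (hc : IsCompat B Λ d) :
    (fun i => (if i = (k : Fin n) then -1 else 0) + max (-B k i) 0) = flip B k (unitVec k) := by
  ext i
  by_cases hi : i = k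
  · subst hi
    simp [flip, hc.diag]
  · simp [flip, hi, max_comm]

theorem IsCompat.exp_pos (hc : IsCompat B Λ d) :
    (fun i => (if i = (k : Fin n) then -1 else 0) + max (B k i) 0) =
      B k + flip B k (unitVec k) := by
  rw [← hc.exp_neg]
  ext i
  rcases le_total 0 (B k i) with hx | hx
  · simp [hx, add_comm]
  · simp [hx]

theorem IsFrame.row_comm (h : IsFrame v Λ M) (hc : IsCompat B Λ d) (a : Fin n → ℤ) :
    M a * M (B k) = vpow v (-(2 * (d k * a k))) • (M (B k) * M a) := by
  rw [h.comm, hc.form_row_right]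
  congr 2
  ring

/-- The exponents of the two exchange monomials differ by `B k`, so the new variable is a binomial
in `M (B k)` times one monomial. The factor `v ^ d k` arises from `Λ(B k, flip B k e_k) = -d k`. -/
theorem mutVar_eq (h : IsFrame v Λ M) (hc : IsCompat B Λ d) :
    mutVar B M k = Polynomial.aeval (M (B k)) (mutPoly v (d k) 1) * M (flip B k (unitVec k)) := by
  rw [mutPoly_one, mutVar, hc.exp_neg, hc.exp_pos, h.map_add, hc.form_row, flip_self, add_comm]
  simp [add_mul, Algebra.smul_def, mul_assoc]

theorem mutVar_ne_zero (h : IsFrame v Λ M) (hc : IsCompat B Λ d) : mutVar B M k ≠ 0 := by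
  rw [mutVar_eq h hc]
  exact mul_ne_zero (h.aeval_ne_zero (hc.row_ne_zero k) (mutPoly_ne_zero _ _ _)) (h.ne_zero _)

/-- Both exchange monomials pick up the same factor when passing `M a`, since their exponents differ
by `B k` and `Λ(B k, a) = d k * a k = 0`. -/
theorem mutVar_comm (h : IsFrame v Λ M) (hc : IsCompat B Λ d) {a : Fin n → ℤ} (ha : a k = 0) :
    mutVar B M k * M a = vpow v (2 * form Λ (flip B k (unitVec k)) a) • (M a * mutVar B M k) := by
  rw [mutVar, hc.exp_neg, hc.exp_pos, add_mul, mul_add, smul_add, h.comm _ a, h.comm _ a,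
    form_add_left, hc.form_row, ha]
  simp

theorem mutFrame_of_eq_zero {a : Fin n → ℤ} (ha : a k = 0) : mutFrame v B Λ M k a = M a := by
  rw [mutFrame, ha, ← ha, Function.update_eq_self, ha]
  simp

theorem mutFrame_mul (h : IsFrame v Λ M) (hc : IsCompat B Λ d) (a b : Fin n → ℤ) :
    mutFrame v B Λ M k a * mutFrame v B Λ M k b =
      vpow v (form (mutateForm B Λ k) a b) • mutFrame v B Λ M k (a + b) := by
  -- `flip` splits an exponent into its part without `k` and `a k` copies of the exponent attached
  -- to the new variable, so all powers of `v` can be compared through `Λ`.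
  have key : ∀ a : Fin n → ℤ, flip B k a = Function.update a k 0 + a k • flip B k (unitVec k) := by
    intro a
    ext i
    by_cases hi : i = k
    · subst hi
      simp [flip]
    · simp [flip, hi]
  have hb0 : Function.update b (k : Fin n) 0 k = 0 := by simp
  have hab : Function.update (a + b) (k : Fin n) 0 =
      Function.update a (k : Fin n) 0 + Function.update b (k : Fin n) 0 := by
    ext i
    by_cases hi : i = k
    · subst hi
      simp
    · simp [hi]
  have h1 := zpow_mul_of_quasi_comm (mutVar_ne_zero h hc) (mutVar_comm h hc hb0) (a k)
  rw [form_mutateForm, key a, key b, mutFrame, mutFrame, mutFrame, hab]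
  set a0 := Function.update a (k : Fin n) 0
  set b0 := Function.update b (k : Fin n) 0
  set E := flip B k (unitVec k)
  set X := mutVar B M k
  rw [smul_mul_assoc, mul_smul_comm, mul_assoc, ← mul_assoc (X ^ a k), h1, smul_mul_assoc,
    mul_smul_comm, mul_assoc, ← mul_assoc (M a0), h.mul, Pi.add_apply,
    ← zpow_add₀ (mutVar_ne_zero h hc), smul_mul_assoc, smul_smul, smul_smul, smul_smul, smul_smul,
    ← vpow_add, ← vpow_add, ← vpow_add, ← vpow_add]
  congr 2
  simp only [form_add_left, form_add_right, form_smul_left, form_smul_right, form_self h.skew,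
    form_swap h.skew E a0, form_swap h.skew E b0]
  ring

/-- A quantum binomial formula: each further factor of the new variable contributes a binomial in `M
(B k)`, which has to be moved to the left past a monomial. -/
theorem mutFrame_of_nonneg (h : IsFrame v Λ M) (hc : IsCompat B Λ d) {m : ℕ} {a : Fin n → ℤ}
    (ha : a k = m) : mutFrame v B Λ M k a =
      Polynomial.aeval (M (B k)) (mutPoly v (d k) m) * M (flip B k a) := by
  induction m generalizing a with
  | zero =>
    rw [mutFrame_of_eq_zero (by simpa using ha), mutPoly_zero, map_one, one_mul,
      flip_of_eq_zero (by simpa using ha)]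
  | succ m ih =>
    have hu : mutFrame v B Λ M k (unitVec k) = mutVar B M k := by
      have : Function.update (unitVec (k : Fin n)) k 0 = 0 := by
        rw [update_eq_sub]
        simp
      rw [mutFrame, this, h.map_zero]
      simp
    have ha' : (a - unitVec (k : Fin n)) k = m := by simp [ha]
    have h1 := mutFrame_mul (k := k) h hc (a - unitVec (k : Fin n)) (unitVec k)
    rw [sub_add_cancel, hu, ih ha', mutVar_eq h hc, mutPoly_one] at h1
    -- Here the monomial has `k`-coordinate `-m`, so passing `M (B k)` across it gives `v ^ (2 * d k
    -- * m)` and turns `v ^ d k` into the coefficient of the next factor of `mutPoly`.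
    have h2 : M (flip B k (a - unitVec (k : Fin n))) * Polynomial.aeval (M (B k))
        (1 + Polynomial.C (vpow v (d k)) * Polynomial.X) = Polynomial.aeval (M (B k))
        (1 + Polynomial.C (vpow v (d k * (2 * m + 1))) * Polynomial.X) *
          M (flip B k (a - unitVec (k : Fin n))) := by
      simp only [map_add, map_one, map_mul, Polynomial.aeval_C, Polynomial.aeval_X, mul_add,
        add_mul, one_mul, mul_one, ← Algebra.smul_def, mul_smul_comm, smul_mul_assoc,
        h.row_comm hc, flip_self, ha', smul_smul, ← vpow_add]
      congr 3
      ring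
    rw [mul_assoc, ← mul_assoc (M _), h2, mul_assoc, h.mul, ← flip_add, sub_add_cancel,
      ← form_mutateForm, mul_smul_comm, mul_smul_comm, ← mul_assoc, ← map_mul,
      ← mutPoly_succ] at h1
    exact (smul_right_injective F (vpow_ne_zero v _) h1).symm

/-- Once all exponents at `k` are made nonnegative, every mutated monomial is a polynomial in `M (B
k)` with constant term `1` times `M (flip B k a)`. These leading terms are distinct, so a nontrivial
relation contradicts `exists_leading_mem` for `C = ∅`. -/
theorem mutFrame_indep (h : IsFrame v Λ M) (hc : IsCompat B Λ d) :
    LinearIndependent K (mutFrame v B Λ M k) := by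
  rw [linearIndependent_iff]
  intro c hc0
  by_contra hne
  obtain ⟨N, hN⟩ : ∃ N : ℕ, ∀ a ∈ c.support, 0 ≤ a k + N := by
    refine ⟨∑ a ∈ c.support, (a k).natAbs, fun a ha => ?_⟩
    have := Finset.single_le_sum (f := fun a : Fin n → ℤ => (a k).natAbs)
      (fun _ _ => Nat.zero_le _) ha
    omega
  set z := (N : ℤ) • unitVec (k : Fin n)
  have hz : z k = N := by simp [z]
  obtain ⟨a, -, -, ha⟩ := exists_leading_mem (K := K) (M := M) (C := ∅) h.indep
    (N := fun a => mutFrame v B Λ M k a * mutFrame v B Λ M k z) (σ := fun a => flip B k (a + z))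
    (fun a b e => add_right_cancel (flip_injective e))
    -- This functional takes the value `d k ^ 2 > 0` on `B k`, whatever the sign of `d k`, so powers
    -- of `M (B k)` raise the degree.
    (fun a => d k * form Λ a (unitVec k)) (c := c)
    (u := fun a => vpow v (form (mutateForm B Λ k) a z)) (fun a => vpow_ne_zero _ _) (by
      intro a ha
      have h1 : (a + z) k = ((a k + N).toNat : ℤ) := by
        rw [Pi.add_apply, hz]
        have := hN a ha
        omega
      simp only [mutFrame_mul h hc, mutFrame_of_nonneg h hc h1, ← smul_sub]
      refine Submodule.smul_mem _ _ (sp_mono ?_ (h.aeval_mul_sub_mem _ _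
        (mutPoly_coeff_zero _ _ _)))
      rintro _ ⟨i, hi, rfl⟩
      rw [Set.mem_ofPred_eq, form_add_left, ← natCast_zsmul, form_smul_left, hc.form_row]
      have h2 : 0 < d k * d k := hc.sign k k
      have h3 : (1 : ℤ) ≤ i := by exact_mod_cast hi
      simp
      nlinarith) hne (by
      have : Finsupp.linearCombination K (fun a => mutFrame v B Λ M k a * mutFrame v B Λ M k z) c =
          Finsupp.linearCombination K (mutFrame v B Λ M k) c * mutFrame v B Λ M k z := by
        simp [Finsupp.linearCombination_apply, Finsupp.sum, Finset.sum_mul]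
      rw [this, hc0, zero_mul]
      exact zero_mem _)
  exact ha

theorem IsFrame.mutate (h : IsFrame v Λ M) (hc : IsCompat B Λ d) (k : ex) :
    IsFrame v (mutateForm B Λ k) (mutFrame v B Λ M k) where
  skew := (hc.mutate k).skew
  map_zero := by rw [mutFrame_of_eq_zero rfl, h.map_zero]
  mul := mutFrame_mul h hc
  indep := mutFrame_indep h hc

/-- The inverse of the mutated monomial at `a` is the one at `-a`, to which `mutFrame_of_nonneg`
applies. -/
theorem mutFrame_of_nonpos (h : IsFrame v Λ M) (hc : IsCompat B Λ d) {m : ℕ} {a : Fin n → ℤ}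
    (ha : a k = -m) : mutFrame v B Λ M k a *
      Polynomial.aeval (M (B k)) (mutPoly v (d k) m) = M (flip B k a) := by
  have h1 := (h.mutate hc k).mul_neg a
  rw [mutFrame_of_nonneg (a := -a) (m := m) h hc (by simp [ha]), flip_neg, ← mul_assoc] at h1
  have h2 := h.neg_mul (flip B k a)
  rw [← mul_one (_ * _), ← h2, ← mul_assoc, h1, one_mul]

theorem mutFrame_unitVec_self (h : IsFrame v Λ M) (hc : IsCompat B Λ d) :
    mutFrame v B Λ M k (unitVec k) = mutVar B M k := by
  rw [mutFrame_of_nonneg (m := 1) h hc (by simp), mutVar_eq h hc]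

end MutFrame

/-! ### Intersections of adjacent quantum tori -/

section Adjacent

variable {K : Type*} [Field K] {F : Type*} [DivisionRing F] [Algebra K F] {n : ℕ}
  {ex : Finset (Fin n)} {v : Kˣ} {B : Matrix ex (Fin n) ℤ} {Λ : Matrix (Fin n) (Fin n) ℤ}
  {d : ex → ℤ} {k : ex} {M : (Fin n → ℤ) → F}

theorem mutFrame_mem (h : IsFrame v Λ M) (hc : IsCompat B Λ d) {a : Fin n → ℤ} (ha : 0 ≤ a k) :
    mutFrame v B Λ M k a ∈ sp K M {x | ∃ t : ℕ, (t : ℤ) ≤ a k ∧ x = flip B k a + t • B k} := by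
  obtain ⟨m, hm⟩ := Int.eq_ofNat_of_zero_le ha
  rw [mutFrame_of_nonneg h hc hm]
  refine h.mul_mem (D := {flip B k a})
    (h.aeval_mem_of_natDegree_le _ (natDegree_mutPoly_le _ _ m)) (mem_sp rfl) ?_
  rintro _ ⟨i, hi, rfl⟩ _ rfl
  exact ⟨i, by omega, add_comm _ _⟩

/-- `B k` has `k`-coordinate `0`, so `M (B k)` is a monomial of both frames, and
`mutFrame_of_nonpos` can be read as an expansion in the mutated frame. -/
theorem mem_mutFrame (h : IsFrame v Λ M) (hc : IsCompat B Λ d) {a : Fin n → ℤ} (ha : 0 ≤ a k) :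
    M a ∈ sp K (mutFrame v B Λ M k) {x | ∃ t : ℕ, (t : ℤ) ≤ a k ∧ x = flip B k a + t • B k} := by
  obtain ⟨m, hm⟩ := Int.eq_ofNat_of_zero_le ha
  have h1 := mutFrame_of_nonpos (m := m) (a := flip B k a) h hc (by rw [flip_self, hm])
  rw [flip_flip, ← mutFrame_of_eq_zero (v := v) (B := B) (Λ := Λ) (M := M) (hc.diag k)] at h1
  rw [← h1]
  refine (h.mutate hc k).mul_mem (C := {flip B k a}) (mem_sp rfl)
    ((h.mutate hc k).aeval_mem_of_natDegree_le _ (natDegree_mutPoly_le _ _ m)) ?_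
  rintro _ rfl _ ⟨i, hi, rfl⟩
  exact ⟨i, by omega, rfl⟩

/-- An element of two adjacent quantum tori is a polynomial in the two exchanged variables. -/
theorem exists_add_of_mem_adjacent (h : IsFrame v Λ M) (hc : IsCompat B Λ d) {f : F}
    (hf : f ∈ sp K M Set.univ) (hf' : f ∈ sp K (mutFrame v B Λ M k) Set.univ) :
    ∃ g ∈ sp K (mutFrame v B Λ M k) {a | 0 ≤ a k}, ∃ g' ∈ sp K M {a | 0 < a k}, f = g + g' := by
  obtain ⟨g, hg, u, hu, rfl⟩ := exists_sp_split {a | 0 ≤ a k} hf'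
  rw [Set.univ_inter] at hg hu
  refine ⟨g, hg, u, ?_, rfl⟩
  have hgM : g ∈ sp K M Set.univ :=
    sp_le.2 (fun a ha => sp_mono (Set.subset_univ _) (mutFrame_mem h hc ha)) hg
  have huM : u ∈ sp K M Set.univ := by simpa using sub_mem hf hgM
  obtain ⟨p, hp, q, hq, e⟩ := exists_sp_split {a | 0 < a k} huM
  rw [Set.univ_inter] at hp hq
  obtain ⟨c, hc0, hcu⟩ := mem_sp_iff.1 hu
  -- `N` bounds the powers of the inverse of the new variable in `u`, so `P` is divisible by each of
  -- the polynomials needed to turn a term of `u` into a combination of monomials of `M`.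
  set N := ∑ a ∈ c.support, (a k).natAbs
  set P := Polynomial.aeval (M (B k)) (mutPoly v (d k) N)
  have hP0 : P ≠ 0 := h.aeval_ne_zero (hc.row_ne_zero k) (mutPoly_ne_zero _ _ _)
  have hk : ∀ i : ℕ, (i • B k) k = 0 := fun i => by simp [hc.diag k]
  have h1 : u * P ∈ sp K M {a | 0 < a k} := by
    rw [← hcu, Finsupp.linearCombination_apply, Finsupp.sum, Finset.sum_mul]
    refine Submodule.sum_mem _ fun a ha => ?_
    rw [smul_mul_assoc]
    refine Submodule.smul_mem _ _ ?_
    have ha' : a k < 0 := by simpa using hc0 ha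
    have hle : (a k).natAbs ≤ N := Finset.single_le_sum (f := fun a : Fin n → ℤ => (a k).natAbs)
      (fun _ _ => Nat.zero_le _) ha
    obtain ⟨Q, hQ⟩ := mutPoly_dvd v (d k) hle
    simp only [P]
    rw [hQ, map_mul, ← mul_assoc, mutFrame_of_nonpos h hc (by omega)]
    refine h.mul_mem (C := {flip B k a}) (mem_sp rfl) (h.aeval_mem _ Q) ?_
    rintro _ rfl _ ⟨i, rfl⟩
    rw [Set.mem_ofPred_eq, Pi.add_apply, hk, flip_self]
    omega
  have h2 : p * P ∈ sp K M {a | 0 < a k} := by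
    refine h.mul_mem hp (h.aeval_mem _ _) ?_
    rintro a ha _ ⟨i, rfl⟩
    rw [Set.mem_ofPred_eq, Pi.add_apply, hk, add_zero]
    exact ha
  have h3 : q * P ∈ sp K M {a | 0 < a k}ᶜ := by
    refine h.mul_mem hq (h.aeval_mem _ _) ?_
    rintro a ha _ ⟨i, rfl⟩
    rw [Set.mem_compl_iff, Set.mem_ofPred_eq, Pi.add_apply, hk, add_zero]
    exact ha
  -- Multiplication by `P` preserves exponents at `k`, as `B k k = 0`. Since `u * P` has only
  -- positive ones, the part `q` of `u` with nonpositive exponents satisfies `q * P = 0`.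
  have h4 : q * P ∈ sp K M {a | 0 < a k} := by
    have : q * P = u * P - p * P := by rw [e]; noncomm_ring
    rw [this]
    exact sub_mem h1 h2
  have h5 := (mul_eq_zero.1 (sp_disjoint h.indep disjoint_compl_right h4 h3)).resolve_right hP0
  rw [e, h5, add_zero]
  exact hp

/-- Homogeneous components of an element of two adjacent quantum tori are divisible by the
corresponding exchange polynomial. -/
theorem exists_component_eq_mul (h : IsFrame v Λ M) (hc : IsCompat B Λ d) {f g g' : F}
    (hf : f ∈ sp K M Set.univ) (hf' : f ∈ sp K (mutFrame v B Λ M k) Set.univ)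
    {C : Set (Fin n → ℤ)} {m : ℤ} (hCm : ∀ a ∈ C, a k = m)
    (hC : ∀ a, ∀ t : ℕ, a + t • B k ∈ C ↔ a ∈ C) (hg : g ∈ sp K M C) (hg' : g' ∈ sp K M Cᶜ)
    (e : f = g + g') :
    ∃ r ∈ sp K M C, g = Polynomial.aeval (M (B k)) (mutPoly v (d k) (-m).toNat) * r := by
  rcases le_or_gt m 0 with hm | hm
  swap
  · refine ⟨g, hg, ?_⟩
    rw [Int.toNat_of_nonpos (by omega), mutPoly_zero, map_one, one_mul]
  obtain ⟨u, hu, w, hw, e'⟩ := exists_add_of_mem_adjacent h hc hf hf'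
  obtain ⟨u1, hu1, u2, hu2, rfl⟩ := exists_sp_split {a | flip B k a ∈ C} hu
  -- An index `a` with `flip B k a ∈ C` has `a k = -m`, so its mutated monomial is the exchange
  -- polynomial of index `-m` times a monomial in `C`. The other terms contribute nothing to the
  -- component `C`.
  have h1 : u1 ∈ (sp K M C).map
      (LinearMap.mulLeft K (Polynomial.aeval (M (B k)) (mutPoly v (d k) (-m).toNat))) := by
    refine sp_le.2 (fun a ha => ?_) hu1
    have h2 := hCm _ ha.2
    rw [flip_self] at h2
    exact ⟨_, mem_sp ha.2, (mutFrame_of_nonneg h hc (by omega)).symm⟩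
  obtain ⟨r, hr, rfl⟩ := h1
  rw [LinearMap.mulLeft_apply] at *
  refine ⟨r, hr, ?_⟩
  have h2 : Polynomial.aeval (M (B k)) (mutPoly v (d k) (-m).toNat) * r ∈ sp K M C := by
    refine h.mul_mem (h.aeval_mem _ _) hr ?_
    rintro _ ⟨i, rfl⟩ a ha
    rw [add_comm]
    exact (hC a i).2 ha
  have h3 : u2 ∈ sp K M Cᶜ := by
    refine sp_le.2 (fun a ha => sp_mono ?_ (mutFrame_mem h hc ha.1)) hu2
    rintro _ ⟨t, -, rfl⟩ hx
    exact ha.2 ((hC _ t).1 hx)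
  have h4 : w ∈ sp K M Cᶜ := by
    refine sp_mono ?_ hw
    intro a ha ha'
    have := hCm a ha'
    rw [Set.mem_ofPred_eq] at ha
    omega
  rw [e', add_assoc] at e
  exact (sp_unique h.indep disjoint_compl_right h2 (add_mem h3 h4) hg hg' e).1.symm

end Adjacent

/-! ### Coprimality of exchange polynomials. -/

section Coprime

variable {K : Type*} [Field K] {F : Type*} [DivisionRing F] [Algebra K F] {n : ℕ}
  {v : Kˣ} {Λ : Matrix (Fin n) (Fin n) ℤ} {M : (Fin n → ℤ) → F}

theorem commute_aeval {x y : F} (h : Commute x y) (P : Polynomial K) :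
    Commute x (Polynomial.aeval y P) := by
  rw [Polynomial.aeval_eq_sum_range]
  exact Commute.sum_right _ _ _ fun i _ => ((h.pow_right i).smul_right _)

/-- `1 + α M(b)` is prime to the polynomials in `M(b')`, if `b` and `b'` are separated by some
linear functional `l`. -/
theorem mem_of_one_add_mul_mem (h : IsFrame v Λ M) {b b' : Fin n → ℤ} {l : (Fin n → ℤ) →+ ℤ}
    (hb : l b ≠ 0) (hb' : l b' = 0) (hbb : form Λ b b' = 0) {C : Set (Fin n → ℤ)}
    (hCb : ∀ a ∈ C, a + b ∈ C) (P : Polynomial K) (α : K) {r : F} (hr : r ∈ sp K M C)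
    (hr' : ∃ t ∈ sp K M C, (1 + α • M b) * r = Polynomial.aeval (M b') P * t) :
    ∃ t ∈ sp K M C, r = Polynomial.aeval (M b') P * t := by
  set p := Polynomial.aeval (M b') P with hp
  set y := -(α • M b) with hy
  have hyp : Commute y p := by
    refine commute_aeval ?_ P
    rw [hy, ← neg_smul]
    refine Commute.smul_left ?_ _
    rw [Commute, SemiconjBy, h.comm, hbb]
    simp
  have hyC : ∀ N : ℕ, ∀ t ∈ sp K M C, y ^ N * t ∈ sp K M C := by
    intro N t ht
    induction N with
    | zero => simpa
    | succ N ih =>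
      rw [pow_succ', mul_assoc, hy, neg_mul, smul_mul_assoc]
      refine neg_mem (Submodule.smul_mem _ _ (h.mul_mem (C := {b}) (mem_sp rfl) ih ?_))
      rintro _ rfl a ha
      rw [add_comm]
      exact hCb a ha
  -- The hypothesis says `r ≡ y * r` modulo left multiples of `p`; since `y` commutes with `p`, this
  -- can be iterated.
  have hN : ∀ N : ℕ, ∃ t ∈ sp K M C, r - y ^ N * r = p * t := by
    intro N
    induction N with
    | zero => exact ⟨0, zero_mem _, by simp⟩
    | succ N ih =>
      obtain ⟨t, ht, e⟩ := ih
      obtain ⟨t', ht', e'⟩ := hr'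
      refine ⟨t + y ^ N * t', add_mem ht (hyC N t' ht'), ?_⟩
      rw [mul_add, ← e, ← mul_assoc, ← (hyp.pow_left N).eq, mul_assoc, ← e', hy]
      simp only [pow_succ]
      noncomm_ring
  obtain ⟨c, hcC, rfl⟩ := mem_sp_iff.1 hr
  set r := Finsupp.linearCombination K M c with hrc
  let D : Set (Fin n → ℤ) := {x | ∃ a ∈ c.support, l x = l a}
  -- `N` exceeds all differences of `l`-degrees in the support of `r`, so `r` and `y ^ N * r` have
  -- no `l`-degree in common.
  set N := 1 + 2 * ∑ a ∈ c.support, (l a).natAbs with hNdef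
  obtain ⟨t, ht, e⟩ := hN N
  have hrD : r ∈ sp K M D := mem_sp_iff.2 ⟨c, fun a ha => ⟨a, ha, rfl⟩, rfl⟩
  have hyD : y ^ N * r ∈ sp K M Dᶜ := by
    have h1 : y ^ N = (-α) ^ N • M (N • b) := by
      rw [hy, ← neg_smul, smul_pow, h.pow]
    rw [h1, smul_mul_assoc]
    have h2 : r ∈ sp K M c.support := mem_sp_iff.2 ⟨c, le_rfl, rfl⟩
    refine Submodule.smul_mem _ _ (h.mul_mem (C := {N • b}) (mem_sp rfl) h2 ?_)
    rintro _ rfl a ha ⟨a', ha', h3⟩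
    have h4 : ∀ a ∈ c.support, (l a).natAbs ≤ ∑ a ∈ c.support, (l a).natAbs := fun a ha =>
      Finset.single_le_sum (f := fun a : Fin n → ℤ => (l a).natAbs) (fun _ _ => Nat.zero_le _) ha
    have h5 := h4 a ha
    have h6 := h4 a' ha'
    rw [map_add, map_nsmul, nsmul_eq_mul] at h3
    have h7 : (N : ℤ).natAbs * (l b).natAbs = (l a' - l a).natAbs := by
      rw [← Int.natAbs_mul, ← h3, add_sub_cancel_right]
    have h8 : 1 ≤ (l b).natAbs := Int.natAbs_pos.2 hb
    have h9 : N ≤ (l a' - l a).natAbs := by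
      rw [← h7, Int.natAbs_natCast]
      exact Nat.le_mul_of_pos_right _ h8
    omega
  obtain ⟨t1, ht1, t2, ht2, rfl⟩ := exists_sp_split D ht
  refine ⟨t1, sp_mono Set.inter_subset_left ht1, ?_⟩
  -- Since `l b' = 0`, multiplication by `p` preserves `l`-degrees; the part of the equation with
  -- degrees of `r` exhibits `r` as a multiple of `p`.
  have hlD : ∀ i : ℕ, ∀ a, i • b' + a ∈ D ↔ a ∈ D := by
    intro i a
    change (∃ a' ∈ c.support, l (i • b' + a) = l a') ↔ ∃ a' ∈ c.support, l a = l a'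
    rw [map_add, map_nsmul, hb', smul_zero, zero_add]
  have hp1 : p * t1 ∈ sp K M D := by
    refine h.mul_mem (h.aeval_mem _ P) ht1 ?_
    rintro _ ⟨i, rfl⟩ a ha
    exact (hlD i a).2 ha.2
  have hp2 : p * t2 ∈ sp K M Dᶜ := by
    refine h.mul_mem (h.aeval_mem _ P) ht2 ?_
    rintro _ ⟨i, rfl⟩ a ha ha'
    exact ha.2 ((hlD i a).1 ha')
  rw [sub_eq_add_neg, mul_add] at e
  exact (sp_unique h.indep disjoint_compl_right hrD (neg_mem hyD) hp1 hp2 e).1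

/-- `mutPoly` is a product of factors `1 + α X`, which are stripped off one at a time. -/
theorem exists_eq_mutPoly_mul (h : IsFrame v Λ M) {b b' : Fin n → ℤ} {l : (Fin n → ℤ) →+ ℤ}
    (hb : l b ≠ 0) (hb' : l b' = 0) (hbb : form Λ b b' = 0) {C : Set (Fin n → ℤ)}
    (hCb : ∀ a ∈ C, a + b ∈ C) (P : Polynomial K) (d : ℤ) (m : ℕ) {r : F} (hr : r ∈ sp K M C)
    (hr' : ∃ t ∈ sp K M C, Polynomial.aeval (M b) (mutPoly v d m) * r =
      Polynomial.aeval (M b') P * t) :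
    ∃ t ∈ sp K M C, r = Polynomial.aeval (M b') P * t := by
  induction m with
  | zero => simpa [mutPoly_zero] using hr'
  | succ m ih =>
    refine ih (mem_of_one_add_mul_mem h hb hb' hbb hCb P (vpow v (d * (2 * m + 1))) ?_ ?_)
    · refine h.mul_mem (h.aeval_mem _ _) hr ?_
      rintro _ ⟨i, rfl⟩ a ha
      rw [add_comm]
      induction i with
      | zero => simpa
      | succ i ih' =>
        rw [succ_nsmul, ← add_assoc]
        exact hCb _ ih'
    · rw [mutPoly_succ, mul_comm (mutPoly v d m), map_mul, mul_assoc] at hr'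
      simpa [← Algebra.smul_def] using hr'

end Coprime

/-! ### Two consecutive mutations -/

section RankTwo

variable {K : Type*} [Field K] {F : Type*} [DivisionRing F] [Algebra K F] {n : ℕ}
  {ex : Finset (Fin n)} {v : Kˣ} {B : Matrix ex (Fin n) ℤ} {Λ : Matrix (Fin n) (Fin n) ℤ}
  {d : ex → ℤ} {M : (Fin n → ℤ) → F} {i j : ex}

/-- The frame obtained by mutation in direction `i`, then in direction `j`. -/
def mutFrame₂ (v : Kˣ) (B : Matrix ex (Fin n) ℤ) (Λ : Matrix (Fin n) (Fin n) ℤ)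
    (M : (Fin n → ℤ) → F) (i j : ex) : (Fin n → ℤ) → F :=
  mutFrame v (mutateMatrix B i) (mutateForm B Λ i) (mutFrame v B Λ M i) j

theorem IsFrame.mutate₂ (h : IsFrame v Λ M) (hc : IsCompat B Λ d) (i j : ex) :
    IsFrame v (mutateForm (mutateMatrix B i) (mutateForm B Λ i) j) (mutFrame₂ v B Λ M i j) :=
  (h.mutate hc i).mutate (hc.mutate i) j

theorem IsFrame.mul_mem_univ (h : IsFrame v Λ M) {f g : F} (hf : f ∈ sp K M Set.univ)
    (hg : g ∈ sp K M Set.univ) : f * g ∈ sp K M Set.univ :=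
  h.mul_mem hf hg fun _ _ _ _ => Set.mem_univ _

theorem IsFrame.pow_mem_univ (h : IsFrame v Λ M) {f : F} (hf : f ∈ sp K M Set.univ) (m : ℕ) :
    f ^ m ∈ sp K M Set.univ := by
  induction m with
  | zero =>
    rw [pow_zero, ← h.map_zero]
    exact mem_sp (Set.mem_univ _)
  | succ m ih =>
    rw [pow_succ]
    exact h.mul_mem_univ ih hf

theorem mutFrame_mem_mutFrame₂ (h : IsFrame v Λ M) (hc : IsCompat B Λ d) {a : Fin n → ℤ}
    (ha : 0 ≤ a j) : mutFrame v B Λ M i a ∈ sp K (mutFrame₂ v B Λ M i j) Set.univ :=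
  sp_mono (Set.subset_univ _) (mem_mutFrame (h.mutate hc i) (hc.mutate i) ha)

theorem mem_mutFrame₂ (h : IsFrame v Λ M) (hc : IsCompat B Λ d) (hij : i ≠ j) {a : Fin n → ℤ}
    (hi : 0 ≤ a i) (hj : 0 ≤ a j) : M a ∈ sp K (mutFrame₂ v B Λ M i j) Set.univ := by
  refine sp_le.2 ?_ (mem_mutFrame (k := i) h hc hi)
  rintro _ ⟨t, ht, rfl⟩
  refine mutFrame_mem_mutFrame₂ h hc ?_
  have hne : (j : Fin n) ≠ i := fun e => hij (Subtype.ext e.symm)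
  rw [Pi.add_apply, flip_of_ne _ hne, ← natCast_zsmul, Pi.smul_apply, smul_eq_mul]
  -- For negative `B i j` the summand `t * B i j` is compensated by `a i * (-B i j)`, because `t ≤ a
  -- i`.
  rcases le_total 0 (B i j) with hb | hb
  · have := le_max_left 0 (-B i j)
    positivity
  · rw [max_eq_right (by omega)]
    nlinarith

theorem mutFrame_mem_mutFrame (h : IsFrame v Λ M) (hc : IsCompat B Λ d) (hij : i ≠ j)
    {a : Fin n → ℤ} (hi : 0 ≤ a i) (hj : 0 ≤ a j) :
    mutFrame v B Λ M i a ∈ sp K (mutFrame v B Λ M j) Set.univ := by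
  refine sp_le.2 ?_ (mutFrame_mem (k := i) h hc hi)
  rintro _ ⟨t, ht, rfl⟩
  refine sp_mono (Set.subset_univ _) (mem_mutFrame h hc ?_)
  have hne : (j : Fin n) ≠ i := fun e => hij (Subtype.ext e.symm)
  rw [Pi.add_apply, flip_of_ne _ hne, ← natCast_zsmul, Pi.smul_apply, smul_eq_mul]
  rcases le_total 0 (B i j) with hb | hb
  · have := le_max_left 0 (-B i j)
    positivity
  · rw [max_eq_right (by omega)]
    nlinarith

/-- The cluster variable obtained by mutation in direction `j` is Laurent in the cluster obtained by
mutation in directions `i`, `j`. -/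
theorem mutVar_mem_mutFrame₂ (h : IsFrame v Λ M) (hc : IsCompat B Λ d) (hij : i ≠ j)
    (hpos : 0 < B j i) : mutVar B M j ∈ sp K (mutFrame₂ v B Λ M i j) Set.univ := by
  have hne : (j : Fin n) ≠ i := fun e => hij (Subtype.ext e.symm)
  have hne' : (i : Fin n) ≠ j := hne.symm
  have hneg : B i j < 0 := (hc.pos_iff j i).1 hpos
  have h1 := h.mutate hc i
  have hc1 := hc.mutate i
  have h2 := h.mutate₂ hc i j
  obtain ⟨c, hcB⟩ := Int.eq_ofNat_of_zero_le hpos.le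
  set M1 := mutFrame v B Λ M i with hM1
  -- The second mutation involves a binomial in `M1 (-x)`. Since `x i = c = b_ji` and `flip B i x =
  -- -(B j + c • B i)`, the unit `M1 x` is a polynomial of degree `c` in `M (B i)` times a monomial.
  set x := -mutateMatrix B i j with hx
  set E := flip B j (unitVec j) with hE
  set E1 := flip (mutateMatrix B i) j (unitVec j) with hE1
  have hxi : x i = c := by
    rw [hx, Pi.neg_apply, mutateMatrix_col, hcB, neg_neg]
  have hxj : x j = 0 := by
    rw [hx, Pi.neg_apply, hc1.diag, neg_zero]
  have hfx : flip B i x = -(B j + (c : ℤ) • B i) := by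
    rw [hx, flip_neg, flip_mutate_row (hc.diag i) hij.symm, hcB, max_eq_right (by simp)]
  have hEi : E i = 0 := by
    rw [hE, flip_of_ne _ hne']
    simp [unitVec, hne', hpos.le]
  have hEj : E j = -1 := by
    rw [hE, flip_self]
    simp
  have hE1j : E1 j = -1 := by
    rw [hE1, flip_self]
    simp
  have hterm : ∀ t : ℕ, M (t • B i) * M (flip B i x) * M (B j) =
      vpow v (-(d i * (t * c))+ -(d i * (c * c - t * c))) • M (((t : ℤ) - c) • B i) := by
    intro t
    have e1 : form Λ (t • B i) (flip B i x) = -(d i * (t * c)) := by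
      rw [hfx, ← natCast_zsmul, form_smul_left, hc.form_row]
      simp only [Pi.neg_apply, Pi.add_apply, Pi.smul_apply, hc.diag, hcB, smul_eq_mul]
      ring
    have e2 : form Λ (t • B i + flip B i x) (B j) = -(d i * (c * c - t * c)) := by
      rw [hfx, ← natCast_zsmul, form_add_left, form_neg_left, form_add_left, form_smul_left,
        form_smul_left, form_self h.skew, hc.form_row, hcB]
      ring
    rw [h.mul, smul_mul_assoc, h.mul, smul_smul, ← vpow_add, e1, e2]
    congr 2
    rw [hfx, ← natCast_zsmul, sub_smul]
    abel
  -- In the top term the coefficient `v ^ (d i * c ^ 2)` cancels the powers of `v` from reordering,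
  -- leaving exactly `1`; the lower terms are negative powers of `M (B i)`.
  obtain ⟨w, hw, hq⟩ : ∃ w ∈ sp K M {y | ∃ s : ℤ, s < 0 ∧ y = s • B i},
      M1 x * M (B j) = 1 + w := by
    rw [hM1, mutFrame_of_nonneg h hc hxi, Polynomial.aeval_eq_sum_range' (n := c + 1)
      (Nat.lt_succ_of_le (natDegree_mutPoly_le _ _ _)), Finset.sum_range_succ, mutPoly_coeff_top]
    simp only [h.pow, add_mul, Finset.sum_mul, smul_mul_assoc, hterm]
    refine ⟨∑ t ∈ Finset.range c, (mutPoly v (d i) c).coeff t • vpow v (-(d i * (t * c)) +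
      -(d i * (c * c - t * c))) • M (((t : ℤ) - c) • B i), ?_, ?_⟩
    · refine Submodule.sum_mem _ fun t ht => Submodule.smul_mem _ _ (Submodule.smul_mem _ _
        (mem_sp ⟨_, ?_, rfl⟩))
      have := Finset.mem_range.1 ht
      omega
    · rw [add_comm, smul_smul, ← vpow_add, sub_self (c : ℤ), zero_smul, h.map_zero]
      have : (d i * (c * c) + (-(d i * (c * c)) + -(d i * (c * c - c * c))) : ℤ) = 0 := by ring
      rw [this]
      simp
  -- As `b_ij < 0`, a negative multiple of `B i` raises the `j`-coordinate `-1` of `E` by at least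
  -- one, while the `i`-coordinate stays `0`.
  have hwE : w * M E ∈ sp K (mutFrame₂ v B Λ M i j) Set.univ := by
    have h3 : w * M E ∈ sp K M {y | y i = 0 ∧ 0 ≤ y j} := by
      refine h.mul_mem (D := {E}) hw (mem_sp rfl) ?_
      rintro _ ⟨s, hs, rfl⟩ _ rfl
      constructor
      · simp [hEi, hc.diag]
      · simp only [Pi.add_apply, Pi.smul_apply, hEj, smul_eq_mul]
        nlinarith
    refine sp_le.2 (fun y hy => ?_) h3
    exact mem_mutFrame₂ h hc hij hy.1.ge hy.2
  have hM1E : M E = M1 E := (mutFrame_of_eq_zero hEi).symm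
  -- The binomial times `M1 E1` is the new variable of the second mutation, and `E - E1` has
  -- `j`-coordinate `0`, so its monomial survives the second mutation.
  have hself : (1 + vpow v (d j) • M1 (-x)) * M1 E ∈ sp K (mutFrame₂ v B Λ M i j) Set.univ := by
    have e1 : mutVar (mutateMatrix B i) M1 j = (1 + vpow v (d j) • M1 (-x)) * M1 E1 := by
      rw [mutVar_eq h1 hc1, mutPoly_one, hx, neg_neg, ← hE1]
      simp [Algebra.smul_def]
    have e2 : M1 E = vpow v (-form (mutateForm B Λ i) E1 (E - E1)) • (M1 E1 * M1 (E - E1)) := by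
      rw [← h1.map_add, add_sub_cancel]
    rw [e2, mul_smul_comm, ← mul_assoc, ← e1]
    refine Submodule.smul_mem _ _ (h2.mul_mem_univ ?_ ?_)
    · rw [← mutFrame_unitVec_self h1 hc1]
      exact mem_sp (Set.mem_univ _)
    · refine mutFrame_mem_mutFrame₂ h hc ?_
      rw [Pi.sub_apply, hEj, hE1j]
      simp
  -- Multiplying by `M1 x` turns the summand containing `M (B j)` into `1 + w`. The `1` combines
  -- with `M1 x` to the expression in `hself`, and `w` leaves the term in `hwE`.
  have hfin : M1 x * mutVar B M j ∈ sp K (mutFrame₂ v B Λ M i j) Set.univ := by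
    have e1 : mutVar B M j = (1 + vpow v (d j) • M (B j)) * M E := by
      rw [mutVar_eq h hc, mutPoly_one, ← hE]
      simp [Algebra.smul_def]
    have e2 : M1 x * mutVar B M j = vpow v (d j) • (w * M E) +
        M1 x * ((1 + vpow v (d j) • M1 (-x)) * M1 E) := by
      rw [e1, ← mul_assoc, ← mul_assoc, mul_add, mul_add, mul_smul_comm, mul_smul_comm, hq,
        h1.mul_neg, hM1E]
      simp only [mul_one, smul_add, add_mul, smul_mul_assoc, one_mul]
      abel
    rw [e2]
    refine add_mem (Submodule.smul_mem _ _ hwE) (h2.mul_mem_univ ?_ hself)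
    exact mutFrame_mem_mutFrame₂ h hc hxj.ge
  have h3 : mutVar B M j = M1 (-x) * (M1 x * mutVar B M j) := by
    rw [← mul_assoc, h1.neg_mul, one_mul]
  rw [h3]
  refine h2.mul_mem_univ (mutFrame_mem_mutFrame₂ h hc ?_) hfin
  rw [Pi.neg_apply, hxj, neg_zero]

theorem mutFrame_mem_mutFrame₂_of_nonneg (h : IsFrame v Λ M) (hc : IsCompat B Λ d) (hij : i ≠ j)
    (hpos : 0 < B j i) {a : Fin n → ℤ} (hi : 0 ≤ a i) (hj : 0 ≤ a j) :
    mutFrame v B Λ M j a ∈ sp K (mutFrame₂ v B Λ M i j) Set.univ := by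
  have hne' : (i : Fin n) ≠ j := fun e => hij (Subtype.ext e)
  have h2 := h.mutate hc j
  have h12 := h.mutate₂ hc i j
  obtain ⟨l, hl⟩ := Int.eq_ofNat_of_zero_le hj
  have e : a = (a - l • unitVec (j : Fin n)) + l • unitVec (j : Fin n) := by simp
  rw [e, h2.map_add, ← h2.pow, mutFrame_unitVec_self h hc, mutFrame_of_eq_zero]
  · refine Submodule.smul_mem _ _ (h12.mul_mem_univ (mem_mutFrame₂ h hc hij ?_ ?_)
      (h12.pow_mem_univ (mutVar_mem_mutFrame₂ h hc hij hpos) l))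
    · simpa [hne'] using hi
    · simp [hl]
  · simp [hl]

theorem exists_inverse_mod_X_pow {P : Polynomial K} (hP : P.coeff 0 = 1) (m : ℕ) :
    ∃ G H : Polynomial K, G * P + H * Polynomial.X ^ m = 1 := by
  have : IsCoprime P Polynomial.X := by
    obtain ⟨Q, hQ⟩ := Polynomial.X_dvd_iff.2 (show (P - 1).coeff 0 = 0 by simp [hP])
    exact ⟨1, -Q, by linear_combination hQ⟩
  obtain ⟨G, H, e⟩ := this.pow_right (n := m)
  exact ⟨G, H, e⟩

/-- Only `a j = -l < 0` needs work. With `y = M (B j)`, the pole along `x_j` is harmless after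
multiplication by `mutPoly` of index `l` in `y`. That polynomial is invertible modulo `y ^ m`, which
splits the monomial into a harmless multiple and a multiple of `y ^ m`; as `b_ji > 0`, the latter
factor compensates the pole of order `m = a i` along `x_i`. -/
theorem mutFrame_mem_sup (h : IsFrame v Λ M) (hc : IsCompat B Λ d) (hij : i ≠ j)
    (hpos : 0 < B j i) {a : Fin n → ℤ} (hi : 0 ≤ a i) :
    mutFrame v B Λ M i a ∈ (sp K (mutFrame₂ v B Λ M i j) Set.univ ⊓
      sp K (mutFrame v B Λ M j) Set.univ) ⊔ sp K M {x | 0 ≤ x i} := by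
  have hne : (j : Fin n) ≠ i := fun e => hij (Subtype.ext e.symm)
  have hne' : (i : Fin n) ≠ j := hne.symm
  have h1 := h.mutate hc i
  have h2 := h.mutate hc j
  have h12 := h.mutate₂ hc i j
  rcases le_total 0 (a j) with hj | hj
  · exact Submodule.mem_sup_left
      ⟨mutFrame_mem_mutFrame₂ h hc hj, mutFrame_mem_mutFrame h hc hij hi hj⟩
  obtain ⟨l, hl⟩ := Int.exists_eq_neg_ofNat hj
  set e := unitVec (j : Fin n) with he
  set a' := a + (l : ℤ) • e with ha'
  have hej : e j = 1 := by simp [he]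
  have hei : e i = 0 := by simp [he, hne']
  have ha'j : a' j = 0 := by simp [ha', hl, hej]
  have ha'i : a' i = a i := by simp [ha', hei]
  obtain ⟨m, hm⟩ := Int.eq_ofNat_of_zero_le hi
  set z := mutFrame v B Λ M i a' with hz
  have hzS : z ∈ sp K (mutFrame₂ v B Λ M i j) Set.univ ⊓ sp K (mutFrame v B Λ M j) Set.univ :=
    ⟨mutFrame_mem_mutFrame₂ h hc ha'j.ge,
      mutFrame_mem_mutFrame h hc hij (by omega) ha'j.ge⟩
  have hzM : z ∈ sp K M {x | x i = -m} := by
    refine sp_mono ?_ (mutFrame_mem h hc (by omega))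
    rintro _ ⟨t, -, rfl⟩
    rw [Set.mem_ofPred_eq, Pi.add_apply, flip_self, ha'i, hm]
    simp [hc.diag]
  have e1 : mutFrame v B Λ M i a = vpow v (-form (mutateForm B Λ i) (-((l : ℤ) • e)) a') •
      (M (-((l : ℤ) • e)) * z) := by
    have : M (-((l : ℤ) • e)) = mutFrame v B Λ M i (-((l : ℤ) • e)) :=
      (mutFrame_of_eq_zero (by simp [hei])).symm
    rw [this, hz, ← h1.map_add, ha']
    congr 1
    abel
  rw [e1]
  refine Submodule.smul_mem _ _ ?_
  obtain ⟨G, H, hGH⟩ := exists_inverse_mod_X_pow (mutPoly_coeff_zero v (d j) l) m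
  set y := M (B j)
  have e2 : M (-((l : ℤ) • e)) * z = Polynomial.aeval y G *
      (Polynomial.aeval y (mutPoly v (d j) l) * M (-((l : ℤ) • e))) * z +
      Polynomial.aeval y (H * Polynomial.X ^ m) * M (-((l : ℤ) • e)) * z := by
    rw [← mul_assoc, ← map_mul, ← add_mul, ← add_mul, ← map_add, hGH, map_one, one_mul]
  rw [e2]
  refine add_mem (Submodule.mem_sup_left ?_) (Submodule.mem_sup_right ?_)
  · have hG : Polynomial.aeval y G ∈ sp K (mutFrame₂ v B Λ M i j) Set.univ ⊓
        sp K (mutFrame v B Λ M j) Set.univ := by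
      refine sp_le.2 ?_ (h.aeval_mem (B j) G)
      rintro _ ⟨t, rfl⟩
      have hj0 : (t • B j) j = 0 := by simp [hc.diag]
      have hi0 : 0 ≤ (t • B j) i := by
        rw [Pi.smul_apply, nsmul_eq_mul]
        positivity
      refine ⟨mem_mutFrame₂ h hc hij hi0 hj0.ge, ?_⟩
      rw [← mutFrame_of_eq_zero (v := v) (B := B) (Λ := Λ) (M := M) hj0]
      exact mem_sp (Set.mem_univ _)
    have hP : Polynomial.aeval y (mutPoly v (d j) l) * M (-((l : ℤ) • e)) ∈
        sp K (mutFrame₂ v B Λ M i j) Set.univ ⊓ sp K (mutFrame v B Λ M j) Set.univ := by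
      -- `u` is chosen so that `flip B j (l • e) - u = -(l • e)`, and neither `i` nor `j` occurs in
      -- it; hence `M (-u)` lies in both tori.
      set u := flip B j ((l : ℤ) • e) + (l : ℤ) • e with hu
      have huj : u j = 0 := by simp [hu, flip_self, hej]
      have hui : u i = 0 := by
        simp [hu, flip_of_ne _ hne', hei, hpos.le]
      have e3 : Polynomial.aeval y (mutPoly v (d j) l) * M (-((l : ℤ) • e)) =
          vpow v (-form Λ (flip B j ((l : ℤ) • e)) (-u)) •
            (mutFrame v B Λ M j ((l : ℤ) • e) * M (-u)) := by
        rw [mutFrame_of_nonneg (m := l) h hc (by simp [hej]), mul_assoc, ← mul_smul_comm,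
          ← h.map_add]
        congr 2
        rw [hu]
        abel
      rw [e3]
      have h3 : M (-u) = mutFrame v B Λ M j (-u) := (mutFrame_of_eq_zero (by simp [huj])).symm
      refine ⟨Submodule.smul_mem _ _ (h12.mul_mem_univ ?_ ?_),
        Submodule.smul_mem _ _ (h2.mul_mem_univ (mem_sp (Set.mem_univ _)) ?_)⟩
      · exact mutFrame_mem_mutFrame₂_of_nonneg h hc hij hpos (by simp [hei]) (by simp [hej])
      · exact mem_mutFrame₂ h hc hij (by simp [hui]) (by simp [huj])
      · rw [h3]
        exact mem_sp (Set.mem_univ _)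
    exact ⟨h12.mul_mem_univ (h12.mul_mem_univ hG.1 hP.1) hzS.1,
      h2.mul_mem_univ (h2.mul_mem_univ hG.2 hP.2) hzS.2⟩
  · refine h.mul_mem (h.mul_mem (D := {-((l : ℤ) • e)}) (G := {x | (m : ℤ) ≤ x i})
      (h.aeval_mul_X_pow_mem (B j) H m) (mem_sp rfl) ?_) hzM ?_
    · rintro _ ⟨t, ht, rfl⟩ _ rfl
      rw [Set.mem_ofPred_eq, Pi.add_apply, Pi.smul_apply, nsmul_eq_mul]
      have : (m : ℤ) ≤ t := by exact_mod_cast ht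
      simp [hei]
      nlinarith
    · intro x hx w hw
      rw [Set.mem_ofPred_eq] at *
      rw [Pi.add_apply]
      omega

/-- Up to elements of the target, `f` may be replaced by some `g` without poles along `x_i`, by
`mutFrame_mem_sup`. Decomposing `g` with respect to `j` gives pieces that are visibly in the target
and a rest, which vanishes because `flip` in direction `j` preserves the `i`-coordinate when `b_ji >
0`. -/
theorem mem_mutFrame₂_of_pos (h : IsFrame v Λ M) (hc : IsCompat B Λ d) (hij : i ≠ j)
    (hpos : 0 < B j i) {f : F} (hf : f ∈ sp K M Set.univ)
    (hfi : f ∈ sp K (mutFrame v B Λ M i) Set.univ)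
    (hfj : f ∈ sp K (mutFrame v B Λ M j) Set.univ) :
    f ∈ sp K (mutFrame₂ v B Λ M i j) Set.univ := by
  have hne' : (i : Fin n) ≠ j := fun e => hij (Subtype.ext e)
  have hflip : ∀ a : Fin n → ℤ, flip B j a i = a i := by
    intro a
    rw [flip_of_ne _ hne', max_eq_left (by omega)]
    simp
  obtain ⟨p, hp, q, hq, rfl⟩ := exists_add_of_mem_adjacent h hc hf hfi
  have hle0 : sp K (mutFrame v B Λ M i) {a | 0 ≤ a i} ≤
      (sp K (mutFrame₂ v B Λ M i j) Set.univ ⊓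
        sp K (mutFrame v B Λ M j) Set.univ) ⊔ sp K M {x | 0 ≤ x i} := by
    rw [sp_le]
    intro a ha
    exact mutFrame_mem_sup h hc hij hpos ha
  obtain ⟨s, hs, r, hr, rfl⟩ := Submodule.mem_sup.1 (hle0 hp)
  set g := r + q with hg
  have hgi : g ∈ sp K M {x | 0 ≤ x i} := by
    refine add_mem hr (sp_mono ?_ hq)
    intro a (ha : 0 < a i)
    exact ha.le
  rw [add_assoc, ← hg] at *
  refine add_mem hs.1 ?_
  have hgj : g ∈ sp K (mutFrame v B Λ M j) Set.univ := by
    simpa using sub_mem hfj hs.2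
  obtain ⟨g1, hg1, g2, hg2, e⟩ := exists_add_of_mem_adjacent h hc
    (sp_mono (Set.subset_univ _) hgi) hgj
  obtain ⟨k1, hk1, k2, hk2, e'⟩ := exists_sp_split {x | 0 < x j} hgi
  have hg1' : g1 ∈ sp K M {x | 0 < x j}ᶜ := by
    have hle : sp K (mutFrame v B Λ M j) {a | 0 ≤ a j} ≤ sp K M {x | 0 < x j}ᶜ := by
      rw [sp_le]
      intro a ha
      refine sp_mono ?_ (mutFrame_mem h hc ha)
      rw [Set.mem_ofPred_eq] at ha
      rintro _ ⟨t, -, rfl⟩ hx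
      rw [Set.mem_ofPred_eq, Pi.add_apply, flip_self] at hx
      simp [hc.diag] at hx
      omega
    exact hle hg1
  -- `g2` is the part of `g` with positive exponent at `j`, so it inherits nonnegative exponents at
  -- `i`.
  obtain ⟨e1, e2⟩ := sp_unique h.indep disjoint_compl_right hg2 hg1'
    (sp_mono Set.inter_subset_right hk1) (sp_mono Set.inter_subset_right hk2)
    (by rw [← e', e, add_comm])
  subst e1 e2
  rw [e]
  have hle1 : sp K M ({x | 0 ≤ x i} ∩ {x | 0 < x j}) ≤
      sp K (mutFrame₂ v B Λ M i j) Set.univ := by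
    rw [sp_le]
    intro a ha
    exact mem_mutFrame₂ h hc hij ha.1 (le_of_lt ha.2)
  refine add_mem ?_ (hle1 hk1)
  obtain ⟨p1, hp1, p2, hp2, rfl⟩ := exists_sp_split {x | 0 ≤ x i} hg1
  have hle2 : sp K (mutFrame v B Λ M j) ({a | 0 ≤ a j} ∩ {x | 0 ≤ x i}) ≤
      sp K (mutFrame₂ v B Λ M i j) Set.univ := by
    rw [sp_le]
    intro a ha
    exact mutFrame_mem_mutFrame₂_of_nonneg h hc hij hpos ha.2 ha.1
  refine add_mem (hle2 hp1) ?_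
  have hp1' : p1 ∈ sp K M {x | 0 ≤ x i} := by
    have hle : sp K (mutFrame v B Λ M j) ({a | 0 ≤ a j} ∩ {x | 0 ≤ x i}) ≤
        sp K M {x | 0 ≤ x i} := by
      rw [sp_le]
      intro a ha
      refine sp_mono ?_ (mutFrame_mem h hc ha.1)
      rintro _ ⟨t, -, rfl⟩
      have : 0 ≤ a i := ha.2
      rw [Set.mem_ofPred_eq, Pi.add_apply, hflip, Pi.smul_apply, nsmul_eq_mul]
      positivity
    exact hle hp1
  have hp2' : p2 ∈ sp K M {x | 0 ≤ x i} := by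
    simpa using sub_mem (sp_mono Set.inter_subset_left hk2) hp1'
  obtain ⟨c, hcs, rfl⟩ := mem_sp_iff.1 hp2
  by_cases hc0 : c = 0
  · rw [hc0, map_zero]
    exact zero_mem _
  -- If `p2 ≠ 0`, its term of lowest degree in `x_i` survives in `M` with a negative exponent,
  -- against `hp2'`.
  obtain ⟨a, ha, -, ha'⟩ := exists_leading_mem h.indep (flip_injective (B := B) (k := j))
    (fun x => x i) (u := fun _ => 1) (fun _ => one_ne_zero) (by
      intro a ha
      have haj : 0 ≤ a j := (hcs ha).1
      obtain ⟨m, hm⟩ := Int.eq_ofNat_of_zero_le haj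
      rw [mutFrame_of_nonneg h hc hm, one_smul]
      refine sp_mono ?_ (h.aeval_mul_sub_mem (B j) _ (mutPoly_coeff_zero v (d j) m))
      rintro _ ⟨t, ht, rfl⟩
      have : (1 : ℤ) ≤ t := by exact_mod_cast ht
      rw [Set.mem_ofPred_eq, Pi.add_apply, Pi.smul_apply, nsmul_eq_mul]
      nlinarith) hc0 hp2'
  rw [Set.mem_ofPred_eq, hflip] at ha'
  exact absurd ha' (hcs ha).2

/-- Each component of `f`, bihomogeneous in `x_i` and `x_j`, is divisible by the exchange
polynomials of both directions. The two are coprime, so their product divides it, and the resulting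
generators are products of monomials of the target torus. -/
theorem mem_mutFrame₂_of_eq_zero (h : IsFrame v Λ M) (hc : IsCompat B Λ d) (hij : i ≠ j)
    (hzero : B j i = 0) {f : F} (hf : f ∈ sp K M Set.univ)
    (hfi : f ∈ sp K (mutFrame v B Λ M i) Set.univ)
    (hfj : f ∈ sp K (mutFrame v B Λ M j) Set.univ) :
    f ∈ sp K (mutFrame₂ v B Λ M i j) Set.univ := by
  have hne : (j : Fin n) ≠ i := fun e => hij (Subtype.ext e.symm)
  have hne' : (i : Fin n) ≠ j := hne.symm
  have hzero' : B i j = 0 := by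
    have := hc.skewB i j
    rw [hzero] at this
    have h2 : d j * B i j = 0 := by linarith
    exact (mul_eq_zero.1 h2).resolve_left (hc.d_ne j)
  have h1 := h.mutate hc i
  have hc1 := hc.mutate i
  have h12 := h.mutate₂ hc i j
  refine mem_of_components (fun x => (x i, x j)) hf ?_
  rintro ⟨p, q⟩ g hg g' hg' e
  set C := {x : Fin n → ℤ | (x i, x j) = (p, q)} with hC
  have hCi : ∀ a, ∀ t : ℕ, a + t • B i ∈ C ↔ a ∈ C := by
    intro a t
    simp [hC, hc.diag, hzero']
  have hCj : ∀ a, ∀ t : ℕ, a + t • B j ∈ C ↔ a ∈ C := by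
    intro a t
    simp [hC, hc.diag, hzero]
  obtain ⟨r, hr, e1⟩ := exists_component_eq_mul h hc hf hfi
    (fun a ha => (Prod.ext_iff.1 ha).1) hCi hg hg' e
  obtain ⟨r', hr', e2⟩ := exists_component_eq_mul h hc hf hfj
    (fun a ha => (Prod.ext_iff.1 ha).2) hCj hg hg' e
  -- `Λ(·, e_i)` separates the two rows: it is `d i` on `B i` and `0` on `B j`.
  let l : (Fin n → ℤ) →+ ℤ :=
    { toFun := fun a => form Λ a (unitVec i)
      map_zero' := form_zero_left _
      map_add' := fun a b => form_add_left a b _ }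
  have hli : l (B i) ≠ 0 := by
    change form Λ (B i) (unitVec i) ≠ 0
    rw [hc.form_row]
    simpa using hc.d_ne i
  have hlj : l (B j) = 0 := by
    change form Λ (B j) (unitVec i) = 0
    rw [hc.form_row]
    simp [hne]
  obtain ⟨t, ht, rfl⟩ := exists_eq_mutPoly_mul h hli hlj (by rw [hc.form_row, hzero, mul_zero])
    (fun a ha => by have := (hCi a 1).2 ha; rwa [one_smul] at this) _ (d i) _ hr ⟨r', hr', e1.symm.trans e2⟩
  rw [e1]
  have hkey : ∀ x ∈ C, Polynomial.aeval (M (B i)) (mutPoly v (d i) (-p).toNat) *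
      (Polynomial.aeval (M (B j)) (mutPoly v (d j) (-q).toNat) * M x) ∈
        sp K (mutFrame₂ v B Λ M i j) Set.univ := by
    intro x hx
    obtain ⟨hxi, hxj⟩ := Prod.ext_iff.1 hx
    simp only at hxi hxj
    -- The exponent `x` is split into its multiples of `e_i` and `e_j` and a rest free of both; each
    -- exchange polynomial is then grouped with its own variable.
    set u := p • unitVec (i : Fin n) with hu
    set w := q • unitVec (j : Fin n) with hw
    have hui : u i = p := by simp [hu]
    have huj : u j = 0 := by simp [hu, hne]
    have hwi : w i = 0 := by simp [hw, hne']
    have hwj : w j = q := by simp [hw]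
    have hcomm : Commute (M u) (M (B j)) := by
      rw [Commute, SemiconjBy, h.row_comm hc, huj]
      simp
    have e3 : Polynomial.aeval (M (B i)) (mutPoly v (d i) (-p).toNat) *
        (Polynomial.aeval (M (B j)) (mutPoly v (d j) (-q).toNat) * M x) =
        vpow v (-form Λ u (x - u)) • vpow v (-form Λ w (x - u - w)) •
        (Polynomial.aeval (M (B i)) (mutPoly v (d i) (-p).toNat) * M u *
        (Polynomial.aeval (M (B j)) (mutPoly v (d j) (-q).toNat) * M w * M (x - u - w))) := by
      have e4 : M x = vpow v (-form Λ u (x - u)) • (M u * M (x - u)) := by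
        rw [← h.map_add, add_sub_cancel]
      have e5 : M (x - u) = vpow v (-form Λ w (x - u - w)) • (M w * M (x - u - w)) := by
        rw [← h.map_add, add_sub_cancel]
      rw [e4, e5]
      simp only [mul_smul_comm]
      congr 2
      rw [mul_assoc, ← mul_assoc _ (M u), ← (commute_aeval hcomm _).eq]
      simp only [mul_assoc]
    rw [e3]
    refine Submodule.smul_mem _ _ (Submodule.smul_mem _ _ (h12.mul_mem_univ ?_
      (h12.mul_mem_univ ?_ ?_)))
    · rcases le_total 0 p with hp | hp
      · rw [Int.toNat_of_nonpos (by omega), mutPoly_zero, map_one, one_mul]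
        exact mem_mutFrame₂ h hc hij (by omega) (by omega)
      · have := mutFrame_of_nonneg (k := i) (m := (-p).toNat) (a := flip B i u) h hc
          (by rw [flip_self, hui]; omega)
        rw [flip_flip] at this
        rw [← this]
        refine mutFrame_mem_mutFrame₂ h hc ?_
        rw [flip_of_ne _ hne, huj, hui, hzero']
        simp
    · rcases le_total 0 q with hq | hq
      · rw [Int.toNat_of_nonpos (by omega), mutPoly_zero, map_one, one_mul]
        exact mem_mutFrame₂ h hc hij (by omega) (by omega)
      · have h3 := mutFrame_of_nonneg (k := j) (m := (-q).toNat)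
          (a := flip (mutateMatrix B i) j w) h1 hc1 (by rw [flip_self, hwj]; omega)
        have h4 : mutateMatrix B i j = B j := by
          ext y
          by_cases hy : y = i
          · subst hy
            rw [mutateMatrix_col, hzero, neg_zero]
          · rw [mutateMatrix_of_ne' hij.symm hy, hzero]
            simp
        rw [flip_flip, h4, mutFrame_of_eq_zero hzero, mutFrame_of_eq_zero hwi] at h3
        rw [← h3]
        exact mem_sp (Set.mem_univ _)
    · refine mem_mutFrame₂ h hc hij ?_ ?_
      · rw [Pi.sub_apply, Pi.sub_apply]
        omega
      · rw [Pi.sub_apply, Pi.sub_apply]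
        omega
  have hmap : sp K M C ≤ (sp K (mutFrame₂ v B Λ M i j) Set.univ).comap
      (LinearMap.mulLeft K (Polynomial.aeval (M (B i)) (mutPoly v (d i) (-p).toNat)) ∘ₗ
        LinearMap.mulLeft K (Polynomial.aeval (M (B j)) (mutPoly v (d j) (-q).toNat))) :=
    sp_le.2 fun x hx => hkey x hx
  exact hmap ht

end RankTwo

/-! ### The quantum Laurent phenomenon -/

section Laurent

variable {K : Type*} [Field K] {F : Type*} [DivisionRing F] [Algebra K F] {n : ℕ}
  {ex : Finset (Fin n)} {v : Kˣ}

/-- Both sides become equal after right multiplication by the binomial `1 + v ^ d k • M (B k)`,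
which is nonzero in a division ring. -/
theorem mutVar_mutFrame {B : Matrix ex (Fin n) ℤ} {Λ : Matrix (Fin n) (Fin n) ℤ}
    {d : ex → ℤ} {M : (Fin n → ℤ) → F} {k : ex} (h : IsFrame v Λ M) (hc : IsCompat B Λ d) :
    mutVar (mutateMatrix B k) (mutFrame v B Λ M k) k = M (unitVec k) := by
  have hp : Polynomial.aeval (M (B k)) (mutPoly v (d k) 1) ≠ 0 :=
    h.aeval_ne_zero (hc.row_ne_zero k) (mutPoly_ne_zero _ _ _)
  have hrow : mutateMatrix B k k = -B k := funext fun j => mutateMatrix_self j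
  have h1 := mutFrame_of_nonpos (m := 1) (a := flip (mutateMatrix B k) k (unitVec k)) h hc
    (by rw [flip_self]; simp)
  rw [flip_flip_mutate (hc.diag k)] at h1
  have hB : mutFrame v B Λ M k (-B k) = M (-B k) := mutFrame_of_eq_zero (by simp [hc.diag])
  rw [mutVar_eq (h.mutate hc k) (hc.mutate k), hrow, hB]
  refine mul_right_cancel₀ hp ?_
  rw [mul_assoc, h1, mutPoly_one]
  simp only [map_add, map_one, map_mul, Polynomial.aeval_C, Polynomial.aeval_X, add_mul, mul_add,
    one_mul, mul_one, ← Algebra.smul_def, mul_smul_comm, smul_mul_assoc, h.mul, smul_smul,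
    ← vpow_add, form_neg_left, hc.form_row, hc.form_row_right]
  simp [hc.diag]
  abel

/-- A frame is determined by its values on unit vectors. Appending the power of the next variable to
a normalized prefix produces the exponents `c_i c_m Λ_im` with `i < m`, and their total is what the
normalization removes. -/
theorem toricFrame_eq {Λ : Matrix (Fin n) (Fin n) ℤ} {M : (Fin n → ℤ) → F} (h : IsFrame v Λ M)
    {X : Fin n → F} (hX : ∀ i, M (unitVec i) = X i) : toricFrame v Λ X = M := by
  funext c
  have hpow : ∀ i, X i ^ c i = M (c i • unitVec i) := by
    intro i
    rw [← hX]
    obtain ⟨m, hm | hm⟩ := (c i).eq_nat_or_neg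
    · rw [hm, zpow_natCast, h.pow, natCast_zsmul]
    · rw [hm, zpow_neg, zpow_natCast, h.pow, neg_smul, natCast_zsmul]
      exact inv_eq_of_mul_eq_one_right (h.mul_neg _)
  set L := List.ofFn fun i => X i ^ c i with hL
  have key : ∀ m : ℕ, m ≤ n → (L.take m).prod =
      vpow v (∑ i : Fin n, ∑ j : Fin n, if i < j ∧ (j : ℕ) < m then c i * c j * Λ i j else 0) •
        M (fun i : Fin n => if (i : ℕ) < m then c i else 0) := by
    intro m
    induction m with
    | zero =>
      intro _
      have : (fun i : Fin n => if (i : ℕ) < 0 then c i else 0) = 0 := by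
        ext i
        simp
      rw [this, h.map_zero]
      simp
    | succ m ih =>
      intro hm
      have hmn : m < n := hm
      have hlen : m < L.length := by simpa [hL] using hmn
      have hLm : L[m] = M (c ⟨m, hmn⟩ • unitVec ⟨m, hmn⟩) := by
        rw [← hpow]
        simp [hL]
      rw [List.prod_take_succ L m hlen, ih hmn.le, hLm, smul_mul_assoc, h.mul, smul_smul,
        ← vpow_add]
      congr 2
      · rw [form_smul_right, form]
        simp only [unitVec, Matrix.mulVec_single_one, dotProduct, Matrix.col_apply]
        rw [Finset.mul_sum, ← Finset.sum_add_distrib]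
        refine Finset.sum_congr rfl fun i _ => ?_
        have hsplit : ∀ j : Fin n, (if i < j ∧ (j : ℕ) < m + 1 then c i * c j * Λ i j else 0) =
            (if i < j ∧ (j : ℕ) < m then c i * c j * Λ i j else 0) +
            if j = ⟨m, hmn⟩ then (if (i : ℕ) < m then c i * c j * Λ i j else 0) else 0 := by
          intro j
          by_cases hj : j = ⟨m, hmn⟩
          · subst hj
            simp [Fin.lt_def]
          · have hj' : (j : ℕ) ≠ m := fun e => hj (Fin.ext e)
            have : (j : ℕ) < m + 1 ↔ (j : ℕ) < m := by omega
            simp [hj, this]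
        simp only [hsplit, Finset.sum_add_distrib, Finset.sum_ite_eq', Finset.mem_univ, if_true]
        congr 1
        split_ifs <;> ring
      · ext i
        by_cases hi : i = ⟨m, hmn⟩
        · subst hi
          simp
        · have hi' : (i : ℕ) ≠ m := fun e => hi (Fin.ext e)
          have : (i : ℕ) < m + 1 ↔ (i : ℕ) < m := by omega
          simp [hi, this]
  have hfin := key n le_rfl
  rw [List.take_of_length_le (by simp [hL])] at hfin
  simp only [Fin.is_lt, and_true, if_true] at hfin
  rw [toricFrame, hfin]
  change vpow v _ • _ = _
  rw [smul_smul, ← vpow_add, neg_add_cancel, vpow_zero, one_smul]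

/-- Seeds with a toric frame that is an embedding of the quantum torus. -/
structure QSeed.IsGood (v : Kˣ) (d : ex → ℤ) (s : QSeed F ex) : Prop where
  frame : IsFrame v s.Λ (toricFrame v s.Λ s.X)
  unit : ∀ i, toricFrame v s.Λ s.X (unitVec i) = s.X i
  compat : IsCompat s.B s.Λ d

theorem QSeed.IsGood.of_frame {s : QSeed F ex} {d : ex → ℤ} {M : (Fin n → ℤ) → F}
    (h : IsFrame v s.Λ M) (hX : ∀ i, M (unitVec i) = s.X i) (hc : IsCompat s.B s.Λ d) :
    s.IsGood v d := by
  have e := toricFrame_eq h hX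
  exact ⟨e ▸ h, e ▸ hX, hc⟩

variable {s : QSeed F ex} {d : ex → ℤ}

theorem QSeed.mutate_X_self (k : ex) :
    (s.mutate v k).X k = mutVar s.B (toricFrame v s.Λ s.X) k := by
  simp [QSeed.mutate, mutVar]

theorem QSeed.mutate_X_of_ne (k : ex) {i : Fin n} (hi : i ≠ k) : (s.mutate v k).X i = s.X i := by
  simp [QSeed.mutate, hi]

theorem QSeed.IsGood.mutFrame_unitVec (h : s.IsGood v d) (k : ex) (i : Fin n) :
    mutFrame v s.B s.Λ (toricFrame v s.Λ s.X) k (unitVec i) = (s.mutate v k).X i := by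
  by_cases hi : i = k
  · subst hi
    rw [mutFrame_unitVec_self h.frame h.compat, QSeed.mutate_X_self]
  · rw [QSeed.mutate_X_of_ne k hi, mutFrame_of_eq_zero (by simp [Ne.symm hi]), h.unit]

theorem QSeed.IsGood.toricFrame_mutate (h : s.IsGood v d) (k : ex) :
    toricFrame v (s.mutate v k).Λ (s.mutate v k).X =
      mutFrame v s.B s.Λ (toricFrame v s.Λ s.X) k :=
  toricFrame_eq (h.frame.mutate h.compat k) (h.mutFrame_unitVec k)

theorem QSeed.IsGood.mutate (h : s.IsGood v d) (k : ex) : (s.mutate v k).IsGood v d :=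
  .of_frame (h.frame.mutate h.compat k) (h.mutFrame_unitVec k) (h.compat.mutate k)

theorem QSeed.IsGood.mutate_mutate (h : s.IsGood v d) (k : ex) :
    (s.mutate v k).mutate v k = s := by
  obtain ⟨X, B, Λ⟩ := s
  have h1 : (((⟨X, B, Λ⟩ : QSeed F ex).mutate v k).mutate v k).X = X := by
    funext i
    by_cases hi : i = k
    · subst hi
      rw [QSeed.mutate_X_self, h.toricFrame_mutate]
      exact (mutVar_mutFrame h.frame h.compat).trans (h.unit _)
    · rw [QSeed.mutate_X_of_ne k hi, QSeed.mutate_X_of_ne k hi]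
  have h2 : (((⟨X, B, Λ⟩ : QSeed F ex).mutate v k).mutate v k).B = B :=
    mutateMatrix_mutateMatrix (h.compat.diag k)
  have h3 : (((⟨X, B, Λ⟩ : QSeed F ex).mutate v k).mutate v k).Λ = Λ :=
    h.compat.mutateForm_mutateForm k
  generalize ((⟨X, B, Λ⟩ : QSeed F ex).mutate v k).mutate v k = t at h1 h2 h3
  obtain ⟨X', B', Λ'⟩ := t
  subst h1 h2 h3
  rfl

/-- The quantum torus of a seed, as a subspace. -/
def QSeed.laurent (v : Kˣ) (s : QSeed F ex) : Submodule K F :=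
  sp K (toricFrame v s.Λ s.X) Set.univ

/-- The seed with the opposite exchange matrix. -/
def QSeed.opp (s : QSeed F ex) : QSeed F ex := ⟨s.X, -s.B, s.Λ⟩

theorem QSeed.IsGood.opp (h : s.IsGood v d) : s.opp.IsGood v (-d) :=
  ⟨h.frame, h.unit, h.compat.neg⟩

theorem QSeed.IsGood.opp_mutate (h : s.IsGood v d) (k : ex) :
    s.opp.mutate v k = (s.mutate v k).opp := by
  have h1 : (s.opp.mutate v k).X = (s.mutate v k).opp.X := by
    funext i
    by_cases hi : i = k
    · subst hi
      change (s.opp.mutate v k).X k = (s.mutate v k).X k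
      rw [QSeed.mutate_X_self, QSeed.mutate_X_self, mutVar, mutVar, add_comm]
      simp [QSeed.opp]
    · change _ = (s.mutate v k).X i
      rw [QSeed.mutate_X_of_ne k hi, QSeed.mutate_X_of_ne k hi]
      rfl
  have h2 : (s.opp.mutate v k).B = (s.mutate v k).opp.B := mutateMatrix_neg k
  have h3 : (s.opp.mutate v k).Λ = (s.mutate v k).opp.Λ := h.compat.mutateForm_neg k
  generalize s.opp.mutate v k = t at *
  generalize (s.mutate v k).opp = t' at *
  obtain ⟨X, B, Λ⟩ := t
  obtain ⟨X', B', Λ'⟩ := t'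
  subst h1 h2 h3
  rfl

theorem QSeed.IsGood.mem_laurent_mutate_mutate_of_nonneg (h : s.IsGood v d) {i j : ex} (hij : i ≠ j)
    (hB : 0 ≤ s.B j i) {f : F} (hf : f ∈ s.laurent v) (hfi : f ∈ (s.mutate v i).laurent v)
    (hfj : f ∈ (s.mutate v j).laurent v) : f ∈ ((s.mutate v i).mutate v j).laurent v := by
  rw [QSeed.laurent, h.toricFrame_mutate] at hfi hfj
  rw [QSeed.laurent, (h.mutate i).toricFrame_mutate, h.toricFrame_mutate]
  rcases hB.lt_or_eq with hB | hB
  · exact mem_mutFrame₂_of_pos h.frame h.compat hij hB hf hfi hfj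
  · exact mem_mutFrame₂_of_eq_zero h.frame h.compat hij hB.symm hf hfi hfj

/-- Passing to `-B` changes neither the clusters nor the tori but reverses the sign of `b_ji`, so
nonnegative `b_ji` suffices; for `i = j` the second mutation returns to the seed. -/
theorem QSeed.IsGood.mem_laurent_mutate_mutate (h : s.IsGood v d) (i j : ex)
    {f : F} (hf : f ∈ s.laurent v) (hfi : f ∈ (s.mutate v i).laurent v)
    (hfj : f ∈ (s.mutate v j).laurent v) : f ∈ ((s.mutate v i).mutate v j).laurent v := by
  by_cases hij : i = j
  · subst hij
    rwa [h.mutate_mutate]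
  rcases le_total 0 (s.B j i) with hB | hB
  · exact h.mem_laurent_mutate_mutate_of_nonneg hij hB hf hfi hfj
  · have h1 := h.opp.mem_laurent_mutate_mutate_of_nonneg hij (f := f)
      (by simpa [QSeed.opp] using hB) hf (by rw [h.opp_mutate]; exact hfi)
      (by rw [h.opp_mutate]; exact hfj)
    rw [h.opp_mutate, (h.mutate i).opp_mutate] at h1
    exact h1

theorem QSeed.IsGood.X_mem_laurent (h : s.IsGood v d) (i : Fin n) : s.X i ∈ s.laurent v := by
  rw [← h.unit]
  exact mem_sp (Set.mem_univ _)

theorem QSeed.IsGood.X_mem_laurent_mutate (h : s.IsGood v d) (k : ex) (i : Fin n) :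
    s.X i ∈ (s.mutate v k).laurent v := by
  rw [← h.unit, QSeed.laurent, h.toricFrame_mutate]
  refine sp_mono (Set.subset_univ _) (mem_mutFrame h.frame h.compat ?_)
  by_cases hi : i = k
  · subst hi
    simp
  · simp [Ne.symm hi]

/-- The upper bounds of mutation equivalent seeds coincide. -/
theorem QSeed.IsGood.upperBound_of_reachable (h : s.IsGood v d) {t : QSeed F ex}
    (hst : Relation.ReflTransGen (fun s t : QSeed F ex => ∃ k, t = s.mutate v k) s t) :
    t.IsGood v d ∧ ∀ f, (f ∈ t.laurent v ∧ ∀ k, f ∈ (t.mutate v k).laurent v) →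
      f ∈ s.laurent v ∧ ∀ k, f ∈ (s.mutate v k).laurent v := by
  induction hst with
  | refl => exact ⟨h, fun f hf => hf⟩
  | @tail t u _ htu ih =>
    obtain ⟨k, rfl⟩ := htu
    obtain ⟨ht, ih⟩ := ih
    refine ⟨ht.mutate k, fun f hf => ih f ?_⟩
    -- Seen from `t.mutate k`, the seed `t` is adjacent and `t.mutate j` is two steps away, through
    -- `k` and then `j`.
    have h1 := hf.2 k
    rw [ht.mutate_mutate] at h1
    refine ⟨h1, fun j => ?_⟩
    have h2 := (ht.mutate k).mem_laurent_mutate_mutate k j hf.1 (hf.2 k) (hf.2 j)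
    rwa [ht.mutate_mutate] at h2

/-- The Laurent phenomenon. -/
theorem QSeed.IsGood.mem_laurent_of_reachable (h : s.IsGood v d) {t : QSeed F ex}
    (hst : Relation.ReflTransGen (fun s t : QSeed F ex => ∃ k, t = s.mutate v k) s t)
    (i : Fin n) : t.X i ∈ s.laurent v := by
  obtain ⟨ht, h1⟩ := h.upperBound_of_reachable hst
  exact (h1 _ ⟨ht.X_mem_laurent i, fun k => ht.X_mem_laurent_mutate k i⟩).1

end Laurent

/-! ### Monomials and diagonal operators on quantum tori -/

namespace QTorus

variable {K : Type*} [Field K] {n : ℕ} {v : Kˣ} {Λ : Matrix (Fin n) (Fin n) ℤ}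

/-- The monomial `X^m`. -/
def mono (v : Kˣ) (Λ : Matrix (Fin n) (Fin n) ℤ) (m : Fin n → ℤ) : QTorus v Λ :=
  ⟨Finsupp.single m 1⟩

theorem mono_zero : mono v Λ 0 = 1 := rfl

theorem mono_mul (a b : Fin n → ℤ) :
    mono v Λ a * mono v Λ b = vpow v (form Λ a b) • mono v Λ (a + b) := by
  ext1
  rw [coeff_mul, mono, mono, mulHom_single, coeff_smul, mono, Finsupp.smul_single]
  simp [cocycle, vpow, form]

theorem linearCombination_mono (c : (Fin n → ℤ) →₀ K) :
    Finsupp.linearCombination K (mono v Λ) c = ⟨c⟩ := by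
  induction c using Finsupp.induction_linear with
  | zero => rw [map_zero]; rfl
  | add f g hf hg => rw [map_add, hf, hg]; rfl
  | single a r =>
    rw [Finsupp.linearCombination_single]
    ext1
    rw [coeff_smul, mono, Finsupp.smul_single, smul_eq_mul, mul_one]

theorem linearIndependent_mono : LinearIndependent K (mono v Λ) := by
  intro a b h
  rw [linearCombination_mono, linearCombination_mono] at h
  exact congrArg coeff h

theorem isFrame_mono (h : Λᵀ = -Λ) : IsFrame v Λ (mono v Λ) where
  skew := h
  map_zero := mono_zero
  mul := mono_mul
  indep := linearIndependent_mono

theorem mem_sp_mono {C : Set (Fin n → ℤ)} {f : QTorus v Λ} :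
    f ∈ sp K (mono v Λ) C ↔ ↑f.coeff.support ⊆ C := by
  rw [mem_sp_iff]
  constructor
  · rintro ⟨c, hc, rfl⟩
    rwa [linearCombination_mono]
  · intro h
    exact ⟨f.coeff, h, linearCombination_mono _⟩

theorem mem_sp_mono_univ (f : QTorus v Λ) : f ∈ sp K (mono v Λ) Set.univ :=
  mem_sp_mono.2 (Set.subset_univ _)

@[elab_as_elim]
theorem induction {p : QTorus v Λ → Prop} (f : QTorus v Λ) (add : ∀ f g, p f → p g → p (f + g))
    (smul : ∀ (c : K) f, p f → p (c • f)) (mono : ∀ m, p (mono v Λ m)) : p f := by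
  refine Submodule.span_induction (p := fun x _ => p x) ?_ ?_ (fun _ _ _ _ => add _ _)
    (fun c _ _ => smul c _) (mem_sp_mono_univ f)
  · rintro _ ⟨m, -, rfl⟩
    exact mono m
  · simpa using smul 0 _ (mono 0)

section Lift

variable {R : Type*} [Ring R] [Algebra K R]

/-- The algebra homomorphism from a quantum torus given by the images of the monomials. -/
def lift (M : (Fin n → ℤ) → R) (h0 : M 0 = 1)
    (hM : ∀ a b, M a * M b = vpow v (form Λ a b) • M (a + b)) : QTorus v Λ →ₐ[K] R :=
  AlgHom.ofLinearMap
    { toFun := fun f => Finsupp.linearCombination K M f.coeff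
      map_add' := fun f g => by rw [coeff_add, map_add]
      map_smul' := fun c f => by rw [coeff_smul, map_smul]; rfl }
    (by
      change Finsupp.linearCombination K M (1 : QTorus v Λ).coeff = 1
      rw [coeff_one, Finsupp.linearCombination_single, h0, one_smul])
    (by
      intro f g
      change Finsupp.linearCombination K M (mulHom v Λ f.coeff g.coeff) =
        Finsupp.linearCombination K M f.coeff * Finsupp.linearCombination K M g.coeff
      induction f.coeff using Finsupp.induction_linear with
      | zero => simp
      | add f f' hf hf' => simp only [map_add, LinearMap.add_apply, add_mul, hf, hf']
      | single a r =>
      induction g.coeff using Finsupp.induction_linear with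
      | zero => simp
      | add f f' hf hf' => simp only [map_add, mul_add, hf, hf']
      | single b s =>
      rw [mulHom_single, Finsupp.linearCombination_single, Finsupp.linearCombination_single,
        Finsupp.linearCombination_single, smul_mul_smul_comm, hM, smul_smul]
      rfl)

variable (M : (Fin n → ℤ) → R) (h0 : M 0 = 1)
    (hM : ∀ a b, M a * M b = vpow v (form Λ a b) • M (a + b))

theorem lift_apply (f : QTorus v Λ) : lift M h0 hM f = Finsupp.linearCombination K M f.coeff := rfl

@[simp] theorem lift_mono (m : Fin n → ℤ) : lift M h0 hM (mono v Λ m) = M m := by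
  rw [lift_apply, mono, Finsupp.linearCombination_single, one_smul]

theorem lift_injective (h : LinearIndependent K M) : Function.Injective (lift M h0 hM) :=
  fun _ _ e => coeff_injective (h e)

end Lift

/-- The diagonal operator `X^m ↦ χ(m) X^m`. -/
def diag (χ : (Fin n → ℤ) → K) : QTorus v Λ →ₗ[K] QTorus v Λ where
  toFun f := ⟨χ • f.coeff⟩
  map_add' f g := by ext1; exact smul_add _ _ _
  map_smul' c f := by
    ext1
    ext m
    simp [mul_left_comm]

theorem coeff_diag (χ : (Fin n → ℤ) → K) (f : QTorus v Λ) (m : Fin n → ℤ) :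
    (diag χ f).coeff m = χ m * f.coeff m := by
  simp [diag]

theorem diag_mono (χ : (Fin n → ℤ) → K) (m : Fin n → ℤ) :
    diag χ (mono v Λ m) = χ m • mono v Λ m := by
  ext1
  ext a
  rw [coeff_diag, coeff_smul, Finsupp.smul_apply, smul_eq_mul, mono, Finsupp.single_apply]
  split_ifs with h
  · rw [h]
  · simp

theorem support_diag_subset (χ : (Fin n → ℤ) → K) (f : QTorus v Λ) :
    (diag χ f).coeff.support ⊆ f.coeff.support := by
  intro m hm
  rw [Finsupp.mem_support_iff, coeff_diag] at hm
  exact Finsupp.mem_support_iff.2 (right_ne_zero_of_mul hm)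

theorem diag_mem_sp (χ : (Fin n → ℤ) → K) {f : QTorus v Λ} {C : Set (Fin n → ℤ)}
    (hf : f ∈ sp K (mono v Λ) C) : diag χ f ∈ sp K (mono v Λ) C := by
  rw [mem_sp_mono] at *
  exact fun m hm => hf (support_diag_subset χ f hm)

/-- A subspace that is stable under diagonal operators contains elements whose supports are contained
in their joint eigenspaces. -/
theorem exists_homogeneous (W : Submodule K (QTorus v Λ)) {G : Set ((Fin n → ℤ) → K)}
    (hW : ∀ χ ∈ G, ∀ f ∈ W, diag χ f ∈ W) {f : QTorus v Λ} (hf : f ∈ W) {m : Fin n → ℤ}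
    (hm : m ∈ f.coeff.support) : ∃ g ∈ W, m ∈ g.coeff.support ∧
      g.coeff.support ⊆ f.coeff.support ∧ ∀ m' ∈ g.coeff.support, ∀ χ ∈ G, χ m' = χ m := by
  induction hN : f.coeff.support.card using Nat.strong_induction_on generalizing f with
  | _ N ih =>
  subst hN
  by_cases h : ∀ m' ∈ f.coeff.support, ∀ χ ∈ G, χ m' = χ m
  · exact ⟨f, hf, hm, subset_rfl, h⟩
  push Not at h
  obtain ⟨m', hm', χ, hχ, hne⟩ := h
  -- This combination kills the exponent `m'` and keeps `m`, so the support shrinks.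
  set g := diag χ f - χ m' • f with hg
  have hgW : g ∈ W := sub_mem (hW χ hχ f hf) (W.smul_mem _ hf)
  have hcoeff : ∀ a, g.coeff a = (χ a - χ m') * f.coeff a := by
    intro a
    change (diag χ f).coeff a - (χ m' • f).coeff a = _
    rw [coeff_diag, coeff_smul, Finsupp.smul_apply, smul_eq_mul, sub_mul]
  have hsub : g.coeff.support ⊆ f.coeff.support := by
    intro a ha
    rw [Finsupp.mem_support_iff, hcoeff] at ha
    exact Finsupp.mem_support_iff.2 (right_ne_zero_of_mul ha)
  have hmg : m ∈ g.coeff.support := by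
    rw [Finsupp.mem_support_iff, hcoeff]
    exact mul_ne_zero (sub_ne_zero.2 hne.symm) (Finsupp.mem_support_iff.1 hm)
  have hlt : g.coeff.support.card < f.coeff.support.card := by
    refine Finset.card_lt_card (Finset.ssubset_iff_subset_ne.2 ⟨hsub, fun e => ?_⟩)
    rw [← e, Finsupp.mem_support_iff, hcoeff, sub_self, zero_mul] at hm'
    exact hm' rfl
  obtain ⟨u, hu, h1, h2, h3⟩ := ih _ hlt hgW hmg rfl
  exact ⟨u, hu, h1, h2.trans hsub, h3⟩

/-- Conjugation by a monomial is a diagonal operator; this is how quantum ideals acquire diagonal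
symmetries beyond the torus action. -/
theorem mono_mul_mono_mul_mono_neg (h : Λᵀ = -Λ) (a : Fin n → ℤ) (f : QTorus v Λ) :
    mono v Λ a * f = diag (fun m => vpow v (2 * form Λ a m)) f * mono v Λ a := by
  induction f using QTorus.induction with
  | add f g hf hg => rw [map_add, mul_add, add_mul, hf, hg]
  | smul c f hf => rw [map_smul, mul_smul_comm, hf, smul_mul_assoc]
  | mono m => rw [diag_mono, smul_mul_assoc, (isFrame_mono h).comm]

/-- Diagonal operators given by additive characters are derivations. -/
theorem diag_mul_of_add {χ : (Fin n → ℤ) → K} (hχ : ∀ a b, χ (a + b) = χ a + χ b)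
    (f g : QTorus v Λ) : diag χ (f * g) = diag χ f * g + f * diag χ g := by
  induction f using QTorus.induction with
  | add f f' hf hf' => rw [add_mul, map_add, hf, hf', map_add, add_mul, add_mul]; abel
  | smul c f hf => rw [smul_mul_assoc, map_smul, hf, map_smul, smul_mul_assoc, smul_mul_assoc, smul_add]
  | mono m =>
  induction g using QTorus.induction with
  | add f f' hf hf' => rw [mul_add, map_add, hf, hf', map_add, mul_add, mul_add]; abel
  | smul c f hf => rw [mul_smul_comm, map_smul, hf, map_smul, mul_smul_comm, mul_smul_comm, smul_add]
  | mono m' =>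
  rw [mono_mul, map_smul, diag_mono, diag_mono, diag_mono, smul_mul_assoc, mul_smul_comm, mono_mul,
    hχ, ← add_smul, smul_comm]

/-- The automorphism `X^m ↦ α ^ (w·m) X^m`. -/
def scale (α : Kˣ) (w : Fin n → ℤ) : QTorus v Λ →ₐ[K] QTorus v Λ :=
  lift (fun m => vpow α (w ⬝ᵥ m) • mono v Λ m) (by simp [mono_zero]) (by
    intro a b
    rw [smul_mul_smul_comm, mono_mul, dotProduct_add, vpow_add, smul_comm])

@[simp] theorem scale_mono (α : Kˣ) (w m : Fin n → ℤ) :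
    scale α w (mono v Λ m) = vpow α (w ⬝ᵥ m) • mono v Λ m := lift_mono _ _ _ _

theorem scale_scale_neg (α : Kˣ) (w : Fin n → ℤ) (f : QTorus v Λ) : scale α w (scale α (-w) f) = f := by
  induction f using QTorus.induction with
  | add f g hf hg => rw [map_add, map_add, hf, hg]
  | smul c f hf => rw [map_smul, map_smul, hf]
  | mono m => simp [smul_smul, ← vpow_add]

section Extend

variable {j : ℕ}

/-- Extension of exponents by zero. -/
def extendZero (_ : j ≤ n) : (Fin j → ℤ) →+ (Fin n → ℤ) where
  toFun m i := if h : (i : ℕ) < j then m ⟨i, h⟩ else 0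
  map_zero' := by
    ext i
    simp
  map_add' a b := by
    ext i
    by_cases h : (i : ℕ) < j <;> simp [h]

variable (hj : j ≤ n)

theorem extendZero_castLE (m : Fin j → ℤ) (i : Fin j) :
    extendZero hj m (Fin.castLE hj i) = m i := by
  simp [extendZero]

theorem extendZero_of_le (m : Fin j → ℤ) {i : Fin n} (hi : j ≤ (i : ℕ)) : extendZero hj m i = 0 := by
  simp [extendZero, hi]

theorem extendZero_injective : Function.Injective (extendZero hj) := by
  intro a b e
  ext i
  rw [← extendZero_castLE hj a, e, extendZero_castLE]

theorem dotProduct_extendZero (m : Fin j → ℤ) (w : Fin n → ℤ) :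
    w ⬝ᵥ extendZero hj m = (w ∘ Fin.castLE hj) ⬝ᵥ m := by
  rw [dotProduct, dotProduct]
  symm
  refine Finset.sum_of_injOn (Fin.castLE hj) (Fin.castLE_injective hj).injOn (by simp) ?_ ?_
  · intro i _ hi
    rw [extendZero_of_le, mul_zero]
    by_contra h
    exact hi ⟨⟨i, not_le.1 h⟩, by simp, rfl⟩
  · intro i _
    rw [extendZero_castLE]
    rfl

theorem form_principal (a b : Fin j → ℤ) :
    form (principal Λ j hj) a b = form Λ (extendZero hj a) (extendZero hj b) := by
  rw [form, form, dotProduct_comm (extendZero hj a), dotProduct_extendZero, dotProduct_comm]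
  congr 1
  ext i
  rw [Function.comp_apply, Matrix.mulVec, Matrix.mulVec, dotProduct_extendZero]
  rfl

/-- The embedding of the quantum torus in the first `j` variables. -/
def embed (v : Kˣ) (Λ : Matrix (Fin n) (Fin n) ℤ) (hj : j ≤ n) :
    QTorus v (principal Λ j hj) →ₐ[K] QTorus v Λ :=
  lift (fun m => mono v Λ (extendZero hj m)) (by rw [map_zero, mono_zero]) (by
    intro a b
    rw [mono_mul, form_principal, map_add])

@[simp] theorem embed_mono (m : Fin j → ℤ) :
    embed v Λ hj (mono v _ m) = mono v Λ (extendZero hj m) := lift_mono _ _ _ _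

theorem embed_injective : Function.Injective (embed v Λ hj) :=
  lift_injective _ _ _ (linearIndependent_mono.comp _ (extendZero_injective hj))

theorem mem_range_embed {f : QTorus v Λ}
    (hf : f ∈ sp K (mono v Λ) {m | ∀ i : Fin n, j ≤ (i : ℕ) → m i = 0}) :
    f ∈ (embed v Λ hj).range := by
  refine (sp_le (N := Subalgebra.toSubmodule (embed v Λ hj).range)).2 ?_ hf
  intro m hm
  refine ⟨mono v _ (m ∘ Fin.castLE hj), ?_⟩
  change embed v Λ hj _ = _
  rw [embed_mono]
  congr 1
  ext i
  by_cases h : (i : ℕ) < j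
  · simp [extendZero, h]
  · rw [extendZero_of_le _ _ (not_lt.1 h), hm i (not_lt.1 h)]

end Extend

end QTorus

/-! ### Residues modulo a chain of completely prime ideals -/

section Residue

variable {K : Type*} [Field K] {n : ℕ} {v : Kˣ} {Λ : Matrix (Fin n) (Fin n) ℤ}

theorem QTorus.coeff_mono_mul (u m : Fin n → ℤ) (f : QTorus v Λ) :
    (QTorus.mono v Λ u * f).coeff (u + m) = vpow v (form Λ u m) * f.coeff m := by
  induction f using QTorus.induction with
  | add f g hf hg => rw [mul_add, coeff_add, Finsupp.add_apply, hf, hg, coeff_add,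
      Finsupp.add_apply, mul_add]
  | smul c f hf => rw [mul_smul_comm, coeff_smul, Finsupp.smul_apply, hf, coeff_smul,
      Finsupp.smul_apply, smul_eq_mul, smul_eq_mul, mul_left_comm]
  | mono a =>
    rw [QTorus.mono_mul, coeff_smul, Finsupp.smul_apply, smul_eq_mul, QTorus.mono, QTorus.mono,
      Finsupp.single_apply, Finsupp.single_apply]
    by_cases h : a = m
    · simp [h]
    · simp [h]

theorem QTorus.mem_support_mono_mul {u m : Fin n → ℤ} {f : QTorus v Λ} :
    m ∈ (QTorus.mono v Λ u * f).coeff.support ↔ m - u ∈ f.coeff.support := by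
  have h : m = u + (m - u) := by abel
  rw [Finsupp.mem_support_iff, Finsupp.mem_support_iff]
  conv_lhs => rw [h, QTorus.coeff_mono_mul]
  simp [vpow_ne_zero]

/-- The exponents of Laurent monomials in the first `j` variables. -/
def exponents (n j : ℕ) : Set (Fin n → ℤ) := {m | ∀ i : Fin n, j ≤ (i : ℕ) → m i = 0}

/-- The exponents of monomials in the first `j` variables. -/
def nonnegExponents (n j : ℕ) : Set (Fin n → ℤ) := {m | m ∈ exponents n j ∧ 0 ≤ m}

theorem nonnegExponents_subset {j k : ℕ} (h : j ≤ k) : nonnegExponents n j ⊆ nonnegExponents n k :=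
  fun _ hm => ⟨fun i hi => hm.1 i (h.trans hi), hm.2⟩

theorem mem_of_nonneg {j : ℕ} (S : AddSubmonoid (Fin n → ℤ)) (h : ∀ i : Fin n, (i : ℕ) < j → unitVec i ∈ S)
    {m : Fin n → ℤ} (hm : m ∈ nonnegExponents n j) : m ∈ S := by
  have : m = ∑ i, (m i).toNat • unitVec i := by
    ext i
    rw [Finset.sum_apply, Finset.sum_eq_single i]
    · have := hm.2 i
      simpa [unitVec] using this
    · intro j _ hj
      simp [unitVec, hj.symm]
    · simp
  rw [this]
  refine sum_mem fun i _ => ?_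
  by_cases hi : (i : ℕ) < j
  · exact S.nsmul_mem (h i hi) _
  · rw [hm.1 i (not_lt.1 hi)]
    simp

/-- An algebra of Laurent polynomials that contains the variables. -/
structure IsLaurentAlgebra {A : Type*} [Ring A] [Algebra K A] (ι : A →ₐ[K] QTorus v Λ)
    (x : Fin n → A) : Prop where
  injective : Function.Injective ι
  map_var : ∀ i, ι (x i) = QTorus.mono v Λ (unitVec i)

variable {A : Type*} [Ring A] [Algebra K A] {ι : A →ₐ[K] QTorus v Λ} {x : Fin n → A}

theorem IsLaurentAlgebra.exists_mono (h : IsLaurentAlgebra ι x) {m : Fin n → ℤ} (hm : 0 ≤ m) :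
    ∃ a, ι a = QTorus.mono v Λ m := by
  let S : AddSubmonoid (Fin n → ℤ) :=
    { carrier := {m | ∃ a, ι a = QTorus.mono v Λ m}
      zero_mem' := ⟨1, by rw [map_one, QTorus.mono_zero]⟩
      add_mem' := by
        rintro a b ⟨f, hf⟩ ⟨g, hg⟩
        refine ⟨(vpow v (form Λ a b))⁻¹ • (f * g), ?_⟩
        rw [map_smul, map_mul, hf, hg, QTorus.mono_mul, smul_smul,
          inv_mul_cancel₀ (vpow_ne_zero _ _), one_smul] }
  exact mem_of_nonneg S (fun i _ => ⟨x i, h.map_var i⟩) ⟨fun i hi => absurd i.2 (not_lt.2 hi), hm⟩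

theorem IsLaurentAlgebra.exists_of_mem (h : IsLaurentAlgebra ι x) {j : ℕ} {f : QTorus v Λ}
    (hf : f ∈ sp K (QTorus.mono v Λ) (nonnegExponents n j)) : ∃ a, ι a = f := by
  have hle : sp K (QTorus.mono v Λ) (nonnegExponents n j) ≤ LinearMap.range ι.toLinearMap := by
    rw [sp_le]
    intro m hm
    exact h.exists_mono hm.2
  exact hle hf

/-- The residue map modulo `J`: a homomorphism to the Laurent polynomials in the first `j`
variables with kernel `J`, which is the identity on polynomials in these variables. -/
structure IsResidue (ι : A →ₐ[K] QTorus v Λ) (j : ℕ) (J : TwoSidedIdeal A)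
    (ψ : A →ₐ[K] QTorus v Λ) : Prop where
  range : ∀ a, ψ a ∈ sp K (QTorus.mono v Λ) (exponents n j)
  ker : ∀ a, ψ a = 0 ↔ a ∈ J
  eq : ∀ a, ι a ∈ sp K (QTorus.mono v Λ) (nonnegExponents n j) → ψ a = ι a

theorem IsLaurentAlgebra.isResidue_bot (h : IsLaurentAlgebra ι x) : IsResidue ι n ⊥ ι where
  range a := QTorus.mem_sp_mono.2 fun m _ i hi => absurd i.2 (not_lt.2 hi)
  ker a := by
    rw [map_eq_zero_iff _ h.injective]
    exact (TwoSidedIdeal.mem_bot A).symm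
  eq _ _ := rfl

/-- No nonzero polynomial in the first `j` variables lies in `J`. -/
def PolyFree (ι : A →ₐ[K] QTorus v Λ) (j : ℕ) (J : TwoSidedIdeal A) : Prop :=
  ∀ a ∈ J, ι a ∈ sp K (QTorus.mono v Λ) (nonnegExponents n j) → a = 0

/-- Multiplication by a monomial in the first `j` variables clears the denominators of a Laurent
polynomial in these variables. -/
theorem exists_clearing (j : ℕ) (s : Finset (Fin n → ℤ)) :
    ∃ u ∈ nonnegExponents n j, ∀ m ∈ s, ∀ i : Fin n, (i : ℕ) < j → 0 ≤ u i + m i := by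
  refine ⟨fun i => if (i : ℕ) < j then ∑ m ∈ s, |m i| else 0, ⟨fun i hi => if_neg (not_lt.2 hi), ?_⟩, ?_⟩
  · intro i
    dsimp only [Pi.zero_apply]
    split_ifs
    · exact Finset.sum_nonneg fun _ _ => abs_nonneg _
    · exact le_rfl
  · intro m hm i hi
    dsimp only
    rw [if_pos hi]
    have h1 : |m i| ≤ ∑ m ∈ s, |m i| :=
      Finset.single_le_sum (f := fun m : Fin n → ℤ => |m i|) (fun _ _ => abs_nonneg _) hm
    have := neg_abs_le (m i)
    omega

/-- The part of a Laurent polynomial that does not involve the variable `x_i`. -/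
def dropVar (i : Fin n) : QTorus v Λ →ₗ[K] QTorus v Λ :=
  QTorus.diag fun m => if m i = 0 then 1 else 0

theorem coeff_dropVar (i : Fin n) (f : QTorus v Λ) (m : Fin n → ℤ) :
    (dropVar i f).coeff m = if m i = 0 then f.coeff m else 0 := by
  rw [dropVar, QTorus.coeff_diag, ite_mul, one_mul, zero_mul]

theorem dropVar_mono (i : Fin n) (m : Fin n → ℤ) :
    dropVar i (QTorus.mono v Λ m) = if m i = 0 then QTorus.mono v Λ m else 0 := by
  rw [dropVar, QTorus.diag_mono, ite_smul, one_smul, zero_smul]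

/-- Without poles along `x_i`, an exponent `0` of `x_i` in a product comes only from exponents `0`
in both factors. For general Laurent polynomials this fails. -/
theorem dropVar_mul (i : Fin n) {f g : QTorus v Λ} (hf : f ∈ sp K (QTorus.mono v Λ) {m | 0 ≤ m i})
    (hg : g ∈ sp K (QTorus.mono v Λ) {m | 0 ≤ m i}) :
    dropVar i (f * g) = dropVar i f * dropVar i g := by
  refine Submodule.span_induction (p := fun f _ => dropVar i (f * g) = dropVar i f * dropVar i g)
    ?_ (by simp) (fun a b _ _ ha hb => by rw [add_mul, map_add, ha, hb, map_add, add_mul])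
    (fun c a _ ha => by rw [smul_mul_assoc, map_smul, ha, map_smul, smul_mul_assoc]) hf
  rintro _ ⟨a, ha, rfl⟩
  refine Submodule.span_induction (p := fun g _ => dropVar i (_ * g) = _ * dropVar i g)
    ?_ (by simp) (fun a b _ _ ha hb => by rw [mul_add, map_add, ha, hb, map_add, mul_add])
    (fun c a _ ha => by rw [mul_smul_comm, map_smul, ha, map_smul, mul_smul_comm]) hg
  rintro _ ⟨b, hb, rfl⟩
  rw [QTorus.mono_mul, map_smul, dropVar_mono, dropVar_mono, dropVar_mono, Pi.add_apply]
  rw [Set.mem_ofPred_eq] at ha hb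
  by_cases h1 : a i = 0 <;> by_cases h2 : b i = 0
  · rw [if_pos h1, if_pos h2, if_pos (by omega), QTorus.mono_mul]
  · rw [if_neg h2, if_neg (by omega), mul_zero, smul_zero]
  · rw [if_neg h1, if_neg (by omega), zero_mul, smul_zero]
  · rw [if_neg h1, if_neg (by omega), zero_mul, smul_zero]

theorem QTorus.mono_ne_zero (m : Fin n → ℤ) : QTorus.mono v Λ m ≠ 0 :=
  QTorus.linearIndependent_mono.ne_zero m

variable {j : ℕ} {J J' : TwoSidedIdeal A} {ψ : A →ₐ[K] QTorus v Λ}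

theorem IsResidue.map_of_mem (hψ : IsResidue ι j J ψ) (h : IsLaurentAlgebra ι x) {f : QTorus v Λ}
    (hf : f ∈ sp K (QTorus.mono v Λ) (nonnegExponents n j)) : ∃ a, ι a = f ∧ ψ a = f := by
  obtain ⟨a, rfl⟩ := h.exists_of_mem hf
  exact ⟨a, rfl, hψ.eq a hf⟩

theorem unitVec_mem_nonnegExponents {i : Fin n} {k : ℕ} (hi : (i : ℕ) < k) :
    unitVec i ∈ nonnegExponents n k := by
  refine ⟨fun l hl => ?_, ?_⟩
  · have : l ≠ i := by
      rintro rfl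
      omega
    simp [unitVec, this]
  · exact Pi.single_nonneg.2 zero_le_one

/-- If `x_j` occurs in `ψ a` only with nonnegative exponents, then a multiple `s a` by a monomial is
congruent to `c + x_j b` with polynomials `b` and `c`, where `c` does not involve `x_j`. -/
theorem IsResidue.exists_clear (hψ : IsResidue ι (j + 1) J' ψ) (h : IsLaurentAlgebra ι x) (hj : j < n)
    {a : A} (ha : ψ a ∈ sp K (QTorus.mono v Λ) {m | 0 ≤ m ⟨j, hj⟩}) :
    ∃ u ∈ nonnegExponents n j, ∃ s c b : A, ι s = QTorus.mono v Λ u ∧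
      ι c = QTorus.mono v Λ u * dropVar ⟨j, hj⟩ (ψ a) ∧
      ι c ∈ sp K (QTorus.mono v Λ) (nonnegExponents n j) ∧ s * a - c - x ⟨j, hj⟩ * b ∈ J' := by
  set i : Fin n := ⟨j, hj⟩
  obtain ⟨u, hu, hclear⟩ := exists_clearing j (ψ a).coeff.support
  set M := QTorus.mono v Λ
  have hui : u i = 0 := hu.1 i le_rfl
  have ha' : ∀ m ∈ (ψ a).coeff.support, 0 ≤ m i := fun m hm => QTorus.mem_sp_mono.1 ha hm
  have hr : ∀ m ∈ (ψ a).coeff.support, ∀ l : Fin n, j + 1 ≤ (l : ℕ) → m l = 0 :=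
    fun m hm => QTorus.mem_sp_mono.1 (hψ.range a) hm
  have hpos : ∀ m ∈ (ψ a).coeff.support, 0 ≤ u + m := by
    intro m hm l
    rcases lt_trichotomy (l : ℕ) j with hl | hl | hl
    · exact hclear m hm l hl
    · have : l = i := Fin.ext hl
      rw [this, Pi.add_apply, hui, Pi.zero_apply, zero_add]
      exact ha' m hm
    · rw [Pi.add_apply, hu.1 l hl.le, hr m hm l hl]
      rfl
  have hcM : M u * dropVar i (ψ a) ∈ sp K M (nonnegExponents n j) := by
    rw [QTorus.mem_sp_mono]
    intro m hm
    have hm' := QTorus.mem_support_mono_mul.1 hm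
    rw [Finsupp.mem_support_iff, coeff_dropVar] at hm'
    have h0 : (m - u) i = 0 := by
      by_contra h0
      exact hm' (if_neg h0)
    rw [if_pos h0, ← Finsupp.mem_support_iff] at hm'
    have e : m = u + (m - u) := by abel
    refine ⟨fun l hl => ?_, ?_⟩
    · rcases hl.eq_or_lt with hl | hl
      · have : l = i := Fin.ext hl.symm
        rw [e, Pi.add_apply, this, hui, h0, add_zero]
      · rw [e, Pi.add_apply, hu.1 l hl.le, hr _ hm' l hl, add_zero]
    · rw [e]
      exact hpos _ hm'
  -- Every term of the remaining part contains `x_j` to a positive power, so one factor can be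
  -- divided out.
  have hbM : M (-unitVec i) * (M u * (ψ a - dropVar i (ψ a))) ∈
      sp K M (nonnegExponents n (j + 1)) := by
    rw [QTorus.mem_sp_mono]
    intro m hm
    have hm' := QTorus.mem_support_mono_mul.1 (QTorus.mem_support_mono_mul.1 hm)
    have e : m = u + (m - -unitVec i - u) - unitVec i := by abel
    set m' := m - -unitVec i - u
    have hc : (ψ a - dropVar i (ψ a)).coeff m' = (ψ a).coeff m' - (dropVar i (ψ a)).coeff m' := rfl
    rw [Finsupp.mem_support_iff, hc, coeff_dropVar] at hm'
    have h0 : m' i ≠ 0 := by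
      intro h0
      rw [if_pos h0, sub_self] at hm'
      exact hm' rfl
    rw [if_neg h0, sub_zero, ← Finsupp.mem_support_iff] at hm'
    refine ⟨fun l hl => ?_, fun l => ?_⟩
    · have : l ≠ i := by
        rintro rfl
        exact absurd hl (by simp [i])
      rw [e, Pi.sub_apply, Pi.add_apply, hu.1 l (by omega), hr _ hm' l hl]
      simp [unitVec, this]
    · rw [e, Pi.sub_apply, Pi.zero_apply]
      by_cases hl : l = i
      · rw [hl]
        have := ha' _ hm'
        simp only [Pi.add_apply, hui, unitVec, Pi.single_eq_same]
        omega
      · have := hpos _ hm' l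
        rw [Pi.zero_apply] at this
        simpa [unitVec, hl] using this
  obtain ⟨s, hs, hs'⟩ := hψ.map_of_mem h (mem_sp (nonnegExponents_subset (Nat.le_succ j) hu))
  obtain ⟨c, hc, hc'⟩ := hψ.map_of_mem h (sp_mono (nonnegExponents_subset (Nat.le_succ j)) hcM)
  obtain ⟨b, hb, hb'⟩ := hψ.map_of_mem h hbM
  have hx : ψ (x i) = M (unitVec i) := by
    rw [hψ.eq, h.map_var]
    rw [h.map_var]
    exact mem_sp (unitVec_mem_nonnegExponents (Nat.lt_succ_self j))
  -- The scalar undoes the power of `v` in `M (e_i) * M (-e_i)`, which is not simplified because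
  -- skew-symmetry of `Λ` is not assumed here.
  refine ⟨u, hu, s, c, -(-(vpow v (form Λ (unitVec i) (-unitVec i)))⁻¹ • b), hs, hc, hc ▸ hcM, ?_⟩
  rw [← hψ.ker, map_sub, map_sub, map_mul, map_mul, hx, hs', hc', neg_smul, neg_neg, map_smul, hb',
    mul_smul_comm, ← mul_assoc, QTorus.mono_mul, add_neg_cancel, QTorus.mono_zero, smul_mul_assoc,
    one_mul, smul_smul, inv_mul_cancel₀ (vpow_ne_zero _ _), one_smul, mul_sub, sub_self]

/-- `J` is a completely prime ideal, without the condition `J ≠ ⊤`. -/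
def IsCompletelyPrime (J : TwoSidedIdeal A) : Prop := ∀ a b, a * b ∈ J → a ∈ J ∨ b ∈ J

theorem PolyFree.notMem (hJ : PolyFree ι j J) {u : Fin n → ℤ} (hu : u ∈ nonnegExponents n j) {s : A}
    (hs : ι s = QTorus.mono v Λ u) : s ∉ J := by
  intro hsJ
  have := hJ s hsJ (hs ▸ mem_sp hu)
  rw [this, map_zero] at hs
  exact QTorus.mono_ne_zero u hs.symm

section Step

variable (hψ : IsResidue ι (j + 1) J' ψ) (h : IsLaurentAlgebra ι x) (hj : j < n) (hle : J' ≤ J)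
  (hx : x ⟨j, hj⟩ ∈ J) (hJ : PolyFree ι j J)

include hψ h hle hx hJ

/-- Clearing denominators puts the polynomial `c` into `J`, as `J` contains `a`, `x_j` and `J'`;
then `c = 0` because `J` is free of polynomials. -/
theorem IsResidue.dropVar_eq_zero {a : A} (haJ : a ∈ J)
    (ha : ψ a ∈ sp K (QTorus.mono v Λ) {m | 0 ≤ m ⟨j, hj⟩}) : dropVar ⟨j, hj⟩ (ψ a) = 0 := by
  obtain ⟨u, hu, s, c, b, hs, hc, hc', hm⟩ := hψ.exists_clear h hj ha
  have hcJ : c ∈ J := by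
    have e : c = s * a - x ⟨j, hj⟩ * b - (s * a - c - x ⟨j, hj⟩ * b) := by abel
    rw [e]
    exact J.sub_mem (J.sub_mem (J.mul_mem_left _ _ haJ) (J.mul_mem_right _ _ hx)) (hle hm)
  rw [hJ c hcJ hc', map_zero] at hc
  exact (mul_eq_zero.1 hc.symm).resolve_left (QTorus.mono_ne_zero u)

/-- Induction on the pole order along `x_j`. The product `x_j * a` has smaller pole order, hence no
pole; it lies in `J`, so its part free of `x_j` vanishes and division by `x_j` creates no pole. -/
theorem IsResidue.mem_sp_nonneg (a : A) : ψ a ∈ sp K (QTorus.mono v Λ) {m | 0 ≤ m ⟨j, hj⟩} := by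
  set i : Fin n := ⟨j, hj⟩
  have hψx : ψ (x i) = QTorus.mono v Λ (unitVec i) := by
    rw [hψ.eq, h.map_var]
    rw [h.map_var]
    exact mem_sp (unitVec_mem_nonnegExponents (Nat.lt_succ_self j))
  have key : ∀ N : ℕ, ∀ a, ψ a ∈ sp K (QTorus.mono v Λ) {m | -(N : ℤ) ≤ m i} →
      ψ a ∈ sp K (QTorus.mono v Λ) {m | 0 ≤ m i} := by
    intro N
    induction N with
    | zero => exact fun a ha => by simpa using ha
    | succ N ih =>
    intro a ha
    have h1 : ψ (x i * a) ∈ sp K (QTorus.mono v Λ) {m | 0 ≤ m i} := by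
      refine ih _ (QTorus.mem_sp_mono.2 fun m hm => ?_)
      rw [map_mul, hψx] at hm
      have := QTorus.mem_sp_mono.1 ha (QTorus.mem_support_mono_mul.1 hm)
      simp only [Set.mem_ofPred_eq, Pi.sub_apply, unitVec, Pi.single_eq_same] at this ⊢
      push_cast at this
      omega
    have h2 := hψ.dropVar_eq_zero h hj hle hx hJ (J.mul_mem_right _ _ hx) h1
    refine QTorus.mem_sp_mono.2 fun m hm => ?_
    have h3 : unitVec i + m ∈ (ψ (x i * a)).coeff.support := by
      rw [map_mul, hψx, QTorus.mem_support_mono_mul, add_sub_cancel_left]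
      exact hm
    have h4 := QTorus.mem_sp_mono.1 h1 h3
    have h5 : ¬ (unitVec i + m) i = 0 := by
      intro h5
      have := congrArg (fun f => f.coeff (unitVec i + m)) h2
      rw [show (⟨j, hj⟩ : Fin n) = i from rfl, coeff_dropVar, if_pos h5] at this
      exact Finsupp.mem_support_iff.1 h3 this
    simp only [Set.mem_ofPred_eq, Pi.add_apply, unitVec, Pi.single_eq_same] at h4 h5 ⊢
    omega
  obtain ⟨N, hN⟩ : ∃ N : ℕ, ∀ m ∈ (ψ a).coeff.support, -(N : ℤ) ≤ m i := by
    refine ⟨∑ m ∈ (ψ a).coeff.support, (m i).natAbs, fun m hm => ?_⟩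
    have := Finset.single_le_sum (f := fun m : Fin n → ℤ => (m i).natAbs)
      (fun _ _ => Nat.zero_le _) hm
    omega
  exact key N a (QTorus.mem_sp_mono.2 hN)

/-- In the absence of poles, setting `x_j = 0` is a homomorphism on the image of `ψ`. If it kills
`a`, then `s * a ∈ J` for a monomial `s ∉ J`, so `a ∈ J` by complete primeness. -/
theorem IsResidue.exists_step (hcp : IsCompletelyPrime J) :
    ∃ ψ' : A →ₐ[K] QTorus v Λ, IsResidue ι j J ψ' := by
  have hnn := hψ.mem_sp_nonneg h hj hle hx hJ
  set i : Fin n := ⟨j, hj⟩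
  refine ⟨AlgHom.ofLinearMap ((dropVar i).comp ψ.toLinearMap) ?_ ?_, ?_, ?_, ?_⟩
  · change dropVar i (ψ 1) = 1
    rw [map_one, ← QTorus.mono_zero, dropVar_mono, if_pos (Pi.zero_apply i)]
  · intro a b
    change dropVar i (ψ (a * b)) = dropVar i (ψ a) * dropVar i (ψ b)
    rw [map_mul, dropVar_mul i (hnn a) (hnn b)]
  · intro a
    change dropVar i (ψ a) ∈ _
    refine QTorus.mem_sp_mono.2 fun m hm l hl => ?_
    have hm' := Finsupp.mem_support_iff.1 hm
    rw [coeff_dropVar] at hm'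
    rcases hl.eq_or_lt with hl | hl
    · have : l = i := Fin.ext hl.symm
      rw [this]
      by_contra h0
      exact hm' (if_neg h0)
    · exact QTorus.mem_sp_mono.1 (hψ.range a) (QTorus.support_diag_subset _ _ hm) l hl
  · intro a
    change dropVar i (ψ a) = 0 ↔ _
    refine ⟨fun h0 => ?_, fun ha => hψ.dropVar_eq_zero h hj hle hx hJ ha (hnn a)⟩
    obtain ⟨u, hu, s, c, b, hs, hc, hc', hm⟩ := hψ.exists_clear h hj (hnn a)
    rw [h0, mul_zero, map_eq_zero_iff _ h.injective] at hc
    rw [hc, sub_zero] at hm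
    refine (hcp s a ?_).resolve_left (hJ.notMem hu hs)
    have e : s * a = s * a - x i * b + x i * b := by abel
    rw [e]
    exact J.add_mem (hle hm) (J.mul_mem_right _ _ hx)
  · intro a ha
    change dropVar i (ψ a) = ι a
    rw [hψ.eq a (sp_mono (nonnegExponents_subset (Nat.le_succ j)) ha)]
    ext1
    ext m
    rw [coeff_dropVar]
    split_ifs with h0
    · rfl
    · by_contra h1
      exact h0 ((QTorus.mem_sp_mono.1 ha (Finsupp.mem_support_iff.2 (Ne.symm h1))).1 i le_rfl)

end Step

/-- A chain of completely prime ideals has residue maps. -/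
theorem IsLaurentAlgebra.exists_isResidue (h : IsLaurentAlgebra ι x) (I : ℕ → TwoSidedIdeal A)
    {j₀ : ℕ} (hj₀ : j₀ ≤ n) (hcp : ∀ j, j₀ ≤ j → j < n → IsCompletelyPrime (I j))
    (hpf : ∀ j, j₀ ≤ j → j < n → PolyFree ι j (I j))
    (hx : ∀ j, j₀ ≤ j → ∀ hj : j < n, x ⟨j, hj⟩ ∈ I j)
    (hle : ∀ j, j₀ ≤ j → j + 1 < n → I (j + 1) ≤ I j) :
    ∀ j, j₀ ≤ j → j < n → ∃ ψ, IsResidue ι j (I j) ψ := by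
  intro j h1 h2
  induction hd : n - j generalizing j with
  | zero => omega
  | succ d ih =>
  -- The chain starts from the zero ideal, whose residue map is the Laurent expansion in all `n`
  -- variables.
  by_cases hlast : j + 1 = n
  · subst hlast
    exact h.isResidue_bot.exists_step h h2 bot_le (hx j h1 h2) (hpf j h1 h2) (hcp j h1 h2)
  · obtain ⟨ψ, hψ⟩ := ih (j + 1) (by omega) (by omega) (by omega)
    exact hψ.exists_step h h2 (hle j h1 (by omega)) (hx j h1 h2) (hpf j h1 h2) (hcp j h1 h2)

end Residue

/-! ### Ideals without polynomials in the first variables -/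

section PolyFree

variable {K : Type*} [Field K] {n : ℕ} {v : Kˣ} {Λ : Matrix (Fin n) (Fin n) ℤ}
  {A : Type*} [Ring A] [Algebra K A] {ι : A →ₐ[K] QTorus v Λ} {x : Fin n → A} {j : ℕ}

theorem twoSidedIdeal_smul_mem (P : TwoSidedIdeal A) (c : K) {a : A} (h : a ∈ P) : c • a ∈ P := by
  rw [Algebra.smul_def]
  exact P.mul_mem_left _ _ h

/-- A two-sided ideal as a subspace. -/
def idealSubmodule (K : Type*) [Field K] [Algebra K A] (P : TwoSidedIdeal A) : Submodule K A where
  carrier := {a | a ∈ P}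
  zero_mem' := P.zero_mem
  add_mem' := P.add_mem
  smul_mem' c _ h := twoSidedIdeal_smul_mem P c h

/-- The complement of a completely prime ideal is multiplicative, so the variables generate only
monomials outside it. -/
theorem IsLaurentAlgebra.mono_notMem (h : IsLaurentAlgebra ι x) {P : TwoSidedIdeal A}
    (hP : IsCompletelyPrime P) (h1 : (1 : A) ∉ P) (hx : ∀ i : Fin n, (i : ℕ) < j → x i ∉ P)
    {m : Fin n → ℤ} (hm : m ∈ nonnegExponents n j) {a : A} (ha : ι a = QTorus.mono v Λ m) : a ∉ P := by
  let S : AddSubmonoid (Fin n → ℤ) :=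
    { carrier := {m | ∃ a, a ∉ P ∧ ι a = QTorus.mono v Λ m}
      zero_mem' := ⟨1, h1, by rw [map_one, QTorus.mono_zero]⟩
      add_mem' := by
        rintro a b ⟨f, hf, hf'⟩ ⟨g, hg, hg'⟩
        refine ⟨(vpow v (form Λ a b))⁻¹ • (f * g), fun hmem => ?_, ?_⟩
        · have := twoSidedIdeal_smul_mem P (vpow v (form Λ a b)) hmem
          rw [smul_smul, mul_inv_cancel₀ (vpow_ne_zero _ _), one_smul] at this
          exact (hP _ _ this).elim hf hg
        · rw [map_smul, map_mul, hf', hg', QTorus.mono_mul, smul_smul,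
            inv_mul_cancel₀ (vpow_ne_zero _ _), one_smul] }
  obtain ⟨b, hb, hb'⟩ := mem_of_nonneg S (fun i hi => ⟨x i, hx i hi, h.map_var i⟩) hm
  rwa [h.injective (ha.trans hb'.symm)]

/-- A subspace `W ≤ P` contains no polynomials in the first `j` variables if `P` contains none of
these variables, and if the exponents are separated by diagonal operators that preserve `W` or `P`. -/
theorem IsLaurentAlgebra.eq_zero_of_separated (h : IsLaurentAlgebra ι x) {W : Submodule K A}
    {P : TwoSidedIdeal A} (hWP : W ≤ idealSubmodule K P)
    (hP : IsCompletelyPrime P) (h1 : (1 : A) ∉ P) (hx : ∀ i : Fin n, (i : ℕ) < j → x i ∉ P)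
    {F₁ F₂ : Set ((Fin n → ℤ) → K)}
    (hF₁ : ∀ χ ∈ F₁, ∀ a ∈ W, ∃ b ∈ W, ι b = QTorus.diag χ (ι a))
    (hF₂ : ∀ χ ∈ F₂, ∀ a ∈ P, ι a ∈ sp K (QTorus.mono v Λ) (nonnegExponents n j) →
      ∃ b ∈ P, ι b = QTorus.diag χ (ι a))
    (hsep : ∀ m ∈ exponents n j, ∀ m' ∈ exponents n j, (∀ χ ∈ F₁, χ m' = χ m) →
      (∀ χ ∈ F₂, χ m' = χ m) → m' = m)
    {a : A} (haW : a ∈ W) (ha : ι a ∈ sp K (QTorus.mono v Λ) (nonnegExponents n j)) : a = 0 := by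
  by_contra ha0
  have hs : (ι a).coeff.support.Nonempty := by
    rw [Finsupp.support_nonempty_iff]
    intro e
    exact ha0 (h.injective ((QTorus.coeff_injective e).trans (map_zero ι).symm))
  obtain ⟨m, hm⟩ := hs
  -- The order matters: operators in `F₁` preserve `W`, so they come first; those in `F₂` preserve
  -- only `P`, to which the component of the first splitting is then passed. By `hsep` a single
  -- exponent remains.
  obtain ⟨g, ⟨hg, hgp⟩, hmg, -, hg1⟩ := QTorus.exists_homogeneous
    (W.map ι.toLinearMap ⊓ sp K (QTorus.mono v Λ) (nonnegExponents n j)) (G := F₁)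
    (by
      rintro χ hχ _ ⟨⟨b, hb, rfl⟩, hb'⟩
      exact ⟨hF₁ χ hχ b hb, QTorus.diag_mem_sp _ hb'⟩) ⟨⟨a, haW, rfl⟩, ha⟩ hm
  obtain ⟨f, ⟨⟨c, hcP, rfl⟩, hcp⟩, hmc, hcg, hc⟩ := QTorus.exists_homogeneous
    ((idealSubmodule K P).map ι.toLinearMap ⊓ sp K (QTorus.mono v Λ) (nonnegExponents n j)) (G := F₂)
    (by
      rintro χ hχ _ ⟨⟨b, hb, rfl⟩, hb'⟩
      exact ⟨hF₂ χ hχ b hb hb', QTorus.diag_mem_sp _ hb'⟩)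
    ⟨Submodule.map_mono hWP hg, hgp⟩ hmg
  have hmn := QTorus.mem_sp_mono.1 hcp hmc
  simp only [AlgHom.toLinearMap_apply] at hmc hcg hc hcp
  have hsupp : ∀ m' ∈ (ι c).coeff.support, m' = m := fun m' hm' =>
    hsep m hmn.1 m' (QTorus.mem_sp_mono.1 hcp hm').1 (hg1 m' (hcg hm')) (hc m' hm')
  have hne := Finsupp.mem_support_iff.1 hmc
  have he : ι (((ι c).coeff m)⁻¹ • c) = QTorus.mono v Λ m := by
    rw [map_smul]
    ext1
    ext m'
    rw [QTorus.coeff_smul, Finsupp.smul_apply, QTorus.mono, Finsupp.single_apply, smul_eq_mul]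
    split_ifs with e
    · rw [← e, inv_mul_cancel₀ hne]
    · have : (ι c).coeff m' = 0 := by
        by_contra h0
        exact e (hsupp m' (Finsupp.mem_support_iff.2 h0)).symm
      rw [this, mul_zero]
  exact h.mono_notMem hP h1 hx hmn he (twoSidedIdeal_smul_mem P _ hcP)

end PolyFree

/-! ### Separation of exponents -/

section Separation

variable {n : ℕ} {ex : Finset (Fin n)} {B : Matrix ex (Fin n) ℤ} {Λ : Matrix (Fin n) (Fin n) ℤ}

theorem extendZero_of_mem_exponents {j : ℕ} (hj : j ≤ n) {m : Fin n → ℤ} (hm : m ∈ exponents n j) :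
    QTorus.extendZero hj (m ∘ Fin.castLE hj) = m := by
  ext i
  by_cases h : (i : ℕ) < j
  · simp [QTorus.extendZero, h]
  · rw [QTorus.extendZero_of_le _ _ (not_lt.1 h), hm i (not_lt.1 h)]

theorem extendZero_single {j : ℕ} (hj : j ≤ n) (i : Fin j) :
    QTorus.extendZero hj (Pi.single i 1) = unitVec (Fin.castLE hj i) := by
  ext l
  by_cases h : (l : ℕ) < j
  · by_cases e : (⟨l, h⟩ : Fin j) = i
    · subst e
      simpa [QTorus.extendZero, unitVec] using h
    · have : l ≠ Fin.castLE hj i := by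
        rintro rfl
        exact e rfl
      simp [QTorus.extendZero, unitVec, this, h, e]
  · have : l ≠ Fin.castLE hj i := by
      rintro rfl
      exact h i.2
    simp [QTorus.extendZero, unitVec, this, h]

/-- The pairing with `m` is a functional on `ℤ^j` that vanishes on `T_{[1,j]} + Im Λ_{[1,j]}`, a
subgroup of full rank. Its range then has rank `0`, so in particular `m ⬝ᵥ m = 0`. -/
theorem IsSuperToric.eq_zero (hs : IsSuperToric B Λ) (hΛ : Λᵀ = -Λ) {j : ℕ} (hj : j ≤ n)
    {m : Fin n → ℤ} (hm : m ∈ exponents n j) (h1 : ∀ w, B *ᵥ w = 0 → w ⬝ᵥ m = 0)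
    (h2 : ∀ i : Fin n, (i : ℕ) < j → form Λ (unitVec i) m = 0) : m = 0 := by
  -- The rank condition is imposed only for `k ≥ 1`; for `j = 0` there are no exponents.
  rcases Nat.eq_zero_or_pos j with rfl | hj0
  · ext i
    exact hm i (Nat.zero_le _)
  set m' : Fin j → ℤ := m ∘ Fin.castLE hj
  have hm' : QTorus.extendZero hj m' = m := extendZero_of_mem_exponents hj hm
  let f : (Fin j → ℤ) →ₗ[ℤ] ℤ := dotProductBilin ℤ ℤ m'
  have hf : ∀ y, f y = m' ⬝ᵥ y := fun y => rfl
  have hker : toricLattice B j hj ⊔ LinearMap.range (principal Λ j hj).mulVecLin ≤ LinearMap.ker f := by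
    rw [sup_le_iff]
    constructor
    · rintro _ ⟨w, hw, rfl⟩
      rw [LinearMap.mem_ker, hf, dotProduct_comm]
      have := h1 w hw
      rw [← hm', QTorus.dotProduct_extendZero] at this
      exact this
    · rintro _ ⟨y, rfl⟩
      rw [LinearMap.mem_ker, hf]
      change form (principal Λ j hj) m' y = 0
      rw [QTorus.form_principal, hm', form_swap hΛ, neg_eq_zero]
      rw [form, dotProduct]
      refine Finset.sum_eq_zero fun i _ => ?_
      by_cases hi : (i : ℕ) < j
      · have := h2 i hi
        rw [form, unitVec, single_one_dotProduct] at this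
        rw [this, mul_zero]
      · rw [QTorus.extendZero_of_le _ _ (not_lt.1 hi), zero_mul]
  have hr := Submodule.finrank_mono hker
  rw [hs j hj hj0] at hr
  have hrn := f.rank_range_add_rank_ker
  rw [← Module.finrank_eq_rank, ← Module.finrank_eq_rank, ← Module.finrank_eq_rank, ← Nat.cast_add,
    Nat.cast_inj] at hrn
  rw [Module.finrank_fin_fun] at hrn
  have h0 : LinearMap.range f = ⊥ := Submodule.finrank_eq_zero.1 (by omega)
  have : m' ⬝ᵥ m' = 0 := by
    rw [← hf, LinearMap.range_eq_bot.1 h0, LinearMap.zero_apply]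
  rw [← hm', dotProduct_self_eq_zero.1 this, map_zero]

end Separation

/-! ### Toric automorphisms and cluster algebras -/

section Algebra

variable {K : Type*} [Field K] {F : Type*} [DivisionRing F] [Algebra K F] {n : ℕ}
  {ex : Finset (Fin n)} {v : Kˣ} {d : ex → ℤ}

/-- The algebra generated by all cluster variables of the seeds that are mutation equivalent to
`s`. -/
def QSeed.algebra (v : Kˣ) (s : QSeed F ex) : Subalgebra K F :=
  Algebra.adjoin K {y | ∃ t, Relation.ReflTransGen (fun s t => ∃ k, t = s.mutate v k) s t ∧
    ∃ i, y = t.X i}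

theorem map_toricFrame {Λ : Matrix (Fin n) (Fin n) ℤ} {X : Fin n → F} {φ : F →ₐ[K] F} {α : Kˣ}
    {w : Fin n → ℤ} (h : ∀ i, φ (X i) = vpow α (w i) • X i) (c : Fin n → ℤ) :
    φ (toricFrame v Λ X c) = vpow α (w ⬝ᵥ c) • toricFrame v Λ X c := by
  have hpow : ∀ i, φ (X i ^ c i) = vpow α (w i * c i) • X i ^ c i := by
    intro i
    rw [map_zpow₀, h, Algebra.smul_def, Algebra.smul_def,
      (Algebra.commute_algebraMap_left _ _).mul_zpow, ← map_zpow₀]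
    congr 2
    simp [vpow, zpow_mul]
  rw [toricFrame, map_smul, smul_comm]
  congr 1
  rw [map_list_prod, List.map_ofFn]
  have : ∀ (m : ℕ) (f g : Fin m → F) (e : Fin m → ℤ), (∀ i, f i = vpow α (e i) • g i) →
      (List.ofFn f).prod = vpow α (∑ i, e i) • (List.ofFn g).prod := by
    intro m
    induction m with
    | zero => intro f g e _; simp
    | succ m ih =>
      intro f g e he
      rw [List.ofFn_succ, List.prod_cons, ih _ (fun i => g i.succ) (fun i => e i.succ)
        (fun i => he _), he, List.ofFn_succ, List.prod_cons, Fin.sum_univ_succ, vpow_add,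
        smul_mul_smul_comm]
  exact this n _ _ _ hpow

/-- Both exchange monomials have the same weight because `w` is orthogonal to the row `B k`; the new
weight vector is `w` times the base change matrix, and it is orthogonal to the mutated rows by
`flip_mutate_row`. -/
theorem QSeed.IsGood.exists_weight_of_reachable {s t : QSeed F ex} (h : s.IsGood v d)
    (hst : Relation.ReflTransGen (fun s t => ∃ k, t = s.mutate v k) s t)
    {φ : F →ₐ[K] F} {α : Kˣ} {w : Fin n → ℤ} (hw : s.B *ᵥ w = 0)
    (hφ : ∀ i, φ (s.X i) = vpow α (w i) • s.X i) :
    ∃ w' : Fin n → ℤ, t.B *ᵥ w' = 0 ∧ ∀ i, φ (t.X i) = vpow α (w' i) • t.X i := by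
  have key : t.IsGood v d ∧
      ∃ w' : Fin n → ℤ, t.B *ᵥ w' = 0 ∧ ∀ i, φ (t.X i) = vpow α (w' i) • t.X i := by
    induction hst with
    | refl => exact ⟨h, w, hw, hφ⟩
    | @tail t u _ hu ih =>
    obtain ⟨k, rfl⟩ := hu
    obtain ⟨ht, w, hw, hφ⟩ := ih
    refine ⟨ht.mutate k, w ᵥ* mutationE t.B k, ?_, ?_⟩
    · have hrow : ∀ i, w ⬝ᵥ t.B i = 0 := fun i => by
        rw [dotProduct_comm]
        exact congrFun hw i
      ext i
      change mutateMatrix t.B k i ⬝ᵥ _ = 0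
      rw [dotProduct_comm, ← Matrix.dotProduct_mulVec, mutationE_mulVec]
      by_cases hi : i = k
      · rw [hi, flip_mutate_row_self (ht.compat.diag k), dotProduct_neg, hrow, neg_zero]
      · rw [flip_mutate_row (ht.compat.diag k) hi, dotProduct_add, dotProduct_smul, hrow, hrow,
          smul_zero, add_zero]
    · have hw' : ∀ i, (w ᵥ* mutationE t.B k) i = w ⬝ᵥ flip t.B k (unitVec i) := by
        intro i
        rw [← mutationE_mulVec, Matrix.dotProduct_mulVec, unitVec, dotProduct_single_one]
      intro i
      rw [hw']
      by_cases hi : i = k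
      · subst hi
        rw [QSeed.mutate_X_self, mutVar, map_add, map_toricFrame hφ, map_toricFrame hφ,
          ht.compat.exp_pos, ht.compat.exp_neg, dotProduct_add]
        have : w ⬝ᵥ t.B k = 0 := by
          rw [dotProduct_comm]
          exact congrFun hw k
        rw [this, zero_add, smul_add]
      · rw [QSeed.mutate_X_of_ne k hi, flip_of_eq_zero (by simp [unitVec, Ne.symm hi]), hφ, unitVec,
          dotProduct_single_one]
  exact key.2

theorem QSeed.IsGood.map_mem_algebra {s : QSeed F ex} (h : s.IsGood v d) {φ : F →ₐ[K] F} {α : Kˣ}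
    {w : Fin n → ℤ} (hw : s.B *ᵥ w = 0) (hφ : ∀ i, φ (s.X i) = vpow α (w i) • s.X i) {a : F}
    (ha : a ∈ s.algebra v) : φ a ∈ s.algebra v := by
  have hle : s.algebra v ≤ (s.algebra v).comap φ := by
    refine Algebra.adjoin_le ?_
    rintro _ ⟨t, ht, i, rfl⟩
    obtain ⟨w', -, h'⟩ := h.exists_weight_of_reachable ht hw hφ
    change φ (t.X i) ∈ s.algebra v
    rw [h']
    refine Subalgebra.smul_mem _ ?_ _
    exact Algebra.subset_adjoin ⟨t, ht, i, rfl⟩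
  exact hle ha

theorem QSeed.X_mem_algebra (s : QSeed F ex) (i : Fin n) : s.X i ∈ s.algebra v :=
  Algebra.subset_adjoin ⟨s, .refl, i, rfl⟩

/-! ### Laurent expansions of elements of the cluster algebra. -/

section Laurent

variable {s : QSeed F ex} (h : s.IsGood v d)

/-- The embedding of the quantum torus of a seed. -/
def QSeed.IsGood.torusHom : QTorus v s.Λ →ₐ[K] F :=
  QTorus.lift (toricFrame v s.Λ s.X) h.frame.map_zero h.frame.mul

@[simp] theorem QSeed.IsGood.torusHom_mono (m : Fin n → ℤ) :
    h.torusHom (QTorus.mono v s.Λ m) = toricFrame v s.Λ s.X m := QTorus.lift_mono _ _ _ _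

theorem QSeed.IsGood.torusHom_injective : Function.Injective h.torusHom :=
  QTorus.lift_injective _ _ _ h.frame.indep

/-- The Laurent phenomenon. -/
theorem QSeed.IsGood.algebra_le_range : s.algebra v ≤ h.torusHom.range := by
  refine Algebra.adjoin_le ?_
  rintro _ ⟨t, ht, i, rfl⟩
  have hle : s.laurent v ≤ Subalgebra.toSubmodule h.torusHom.range := by
    rw [QSeed.laurent, sp_le]
    exact fun m _ => ⟨_, h.torusHom_mono m⟩
  exact hle (h.mem_laurent_of_reachable ht i)

/-- The Laurent expansion of the elements of the cluster algebra. -/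
def QSeed.IsGood.expansion : s.algebra v →ₐ[K] QTorus v s.Λ :=
  (AlgEquiv.ofInjective h.torusHom h.torusHom_injective).symm.toAlgHom.comp
    (Subalgebra.inclusion h.algebra_le_range)

@[simp] theorem QSeed.IsGood.torusHom_expansion (a : s.algebra v) : h.torusHom (h.expansion a) = a :=
  congrArg Subtype.val ((AlgEquiv.ofInjective h.torusHom h.torusHom_injective).apply_symm_apply
    (Subalgebra.inclusion h.algebra_le_range a))

theorem QSeed.IsGood.isLaurentAlgebra :
    IsLaurentAlgebra h.expansion fun i => (⟨s.X i, s.X_mem_algebra i⟩ : s.algebra v) where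
  injective a b e := by
    ext
    rw [← h.torusHom_expansion a, e, h.torusHom_expansion]
  map_var i := by
    apply h.torusHom_injective
    rw [h.torusHom_expansion, h.torusHom_mono, h.unit]

theorem QSeed.IsGood.map_torusHom {φ : F →ₐ[K] F} {α : Kˣ} {w : Fin n → ℤ}
    (hφ : ∀ i, φ (s.X i) = vpow α (w i) • s.X i) (f : QTorus v s.Λ) :
    φ (h.torusHom f) = h.torusHom (QTorus.diag (fun m => vpow α (w ⬝ᵥ m)) f) := by
  induction f using QTorus.induction with
  | add f g hf hg => simp only [map_add, hf, hg]
  | smul c f hf => simp only [map_smul, hf]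
  | mono m => rw [QTorus.diag_mono, map_smul, h.torusHom_mono, map_toricFrame hφ]

end Laurent

end Algebra

/-! ### Homomorphisms of the skew field of fractions. -/

section QuantumField

variable {K : Type*} [Field K] {n : ℕ} {ex : Finset (Fin n)} {v : Kˣ}
  {B : Matrix ex (Fin n) ℤ} {Λ : Matrix (Fin n) (Fin n) ℤ}

/-- The embedding of the quantum torus into its skew field of fractions. -/
def QTorus.toField (v : Kˣ) (Λ : Matrix (Fin n) (Fin n) ℤ) : QTorus v Λ →ₐ[K] QField v Λ where
  __ := (OreLocalization.numeratorRingHom : QTorus v Λ →+* QField v Λ)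
  commutes' _ := rfl

theorem QTorus.toField_injective : Function.Injective (QTorus.toField v Λ) :=
  OreLocalization.numeratorHom_inj fun _ h => h.1

/-- The extension of an injective endomorphism of the quantum torus to its skew field of
fractions. -/
def QTorus.fieldHom (f : QTorus v Λ →ₐ[K] QTorus v Λ) (hf : Function.Injective f) :
    QField v Λ →ₐ[K] QField v Λ :=
  { OreLocalization.universalHom ((QTorus.toField v Λ).comp f : QTorus v Λ →+* QField v Λ)
      { toFun := fun s => Units.mk0 (QTorus.toField v Λ (f s)) (by
          rw [Ne, map_eq_zero_iff _ QTorus.toField_injective, map_eq_zero_iff _ hf]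
          exact nonZeroDivisors.coe_ne_zero s)
        map_one' := by ext; simp
        map_mul' := fun a b => by ext; simp } (fun _ => rfl) with
    commutes' := fun c => by
      refine (OreLocalization.universalHom_commutes _ _ _).trans ?_
      change QTorus.toField v Λ (f (algebraMap K _ c)) = _
      rw [AlgHom.commutes, AlgHom.commutes] }

theorem QTorus.fieldHom_toField (f : QTorus v Λ →ₐ[K] QTorus v Λ) (hf : Function.Injective f)
    (a : QTorus v Λ) : QTorus.fieldHom f hf (QTorus.toField v Λ a) = QTorus.toField v Λ (f a) :=
  OreLocalization.universalHom_commutes _ _ _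

theorem QField.algHom_ext {φ ψ : QField v Λ →ₐ[K] QField v Λ}
    (h : ∀ a, φ (QTorus.toField v Λ a) = ψ (QTorus.toField v Λ a)) : φ = ψ := by
  ext x
  induction x using OreLocalization.ind with | _ r s
  have hs : QTorus.toField v Λ s * (OreLocalization.oreDiv r s) = QTorus.toField v Λ r := by
    change OreLocalization.oreDiv (s : QTorus v Λ) 1 * _ = OreLocalization.oreDiv r 1
    rw [OreLocalization.mul_cancel]
  have hne : φ (QTorus.toField v Λ s) ≠ 0 := by
    rw [Ne, map_eq_zero_iff φ (RingHom.injective (φ : QField v Λ →+* QField v Λ)), map_eq_zero_iff _ QTorus.toField_injective]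
    exact nonZeroDivisors.coe_ne_zero s
  apply mul_left_cancel₀ hne
  conv_rhs => rw [h]
  rw [← map_mul, ← map_mul, hs, h]

/-- The extension of an automorphism of the quantum torus. -/
def QTorus.fieldEquiv (f g : QTorus v Λ →ₐ[K] QTorus v Λ) (hfg : ∀ a, f (g a) = a)
    (hgf : ∀ a, g (f a) = a) : QField v Λ ≃ₐ[K] QField v Λ :=
  AlgEquiv.ofAlgHom (QTorus.fieldHom f (Function.LeftInverse.injective hgf))
    (QTorus.fieldHom g (Function.LeftInverse.injective hfg))
    (QField.algHom_ext fun a => by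
      rw [AlgHom.comp_apply, QTorus.fieldHom_toField, QTorus.fieldHom_toField, hfg, AlgHom.id_apply])
    (QField.algHom_ext fun a => by
      rw [AlgHom.comp_apply, QTorus.fieldHom_toField, QTorus.fieldHom_toField, hgf, AlgHom.id_apply])

theorem QTorus.fieldEquiv_toField (f g : QTorus v Λ →ₐ[K] QTorus v Λ) (hfg : ∀ a, f (g a) = a)
    (hgf : ∀ a, g (f a) = a) (a : QTorus v Λ) :
    QTorus.fieldEquiv f g hfg hgf (QTorus.toField v Λ a) = QTorus.toField v Λ (f a) :=
  QTorus.fieldHom_toField f (Function.LeftInverse.injective hgf) a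

theorem initQVar_eq (i : Fin n) : initQVar v Λ i = QTorus.toField v Λ (QTorus.mono v Λ (unitVec i)) := rfl

theorem isFrame_toField (h : Λᵀ = -Λ) :
    IsFrame v Λ fun m => QTorus.toField v Λ (QTorus.mono v Λ m) where
  skew := h
  map_zero := by rw [QTorus.mono_zero, map_one]
  mul a b := by rw [← map_mul, QTorus.mono_mul, map_smul]
  indep := QTorus.linearIndependent_mono.map' (QTorus.toField v Λ).toLinearMap
    (LinearMap.ker_eq_bot.2 QTorus.toField_injective)

theorem QSeed.init_isGood {d : ex → ℤ} (h : IsCompat B Λ d) : (QSeed.init v B Λ).IsGood v d :=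
  .of_frame (isFrame_toField h.skew) (fun _ => rfl) h

theorem exists_quantum_toricAutomorphism (w : Fin n → ℤ) (α : Kˣ) :
    ∃ φ : QField v Λ ≃ₐ[K] QField v Λ, ∀ i, φ (initQVar v Λ i) = vpow α (w i) • initQVar v Λ i := by
  refine ⟨QTorus.fieldEquiv (QTorus.scale α w) (QTorus.scale α (-w)) (QTorus.scale_scale_neg α w)
    (fun a => by simpa using QTorus.scale_scale_neg α (-w) a), fun i => ?_⟩
  rw [initQVar_eq, QTorus.fieldEquiv_toField, QTorus.scale_mono, map_smul, unitVec, dotProduct_single_one]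

end QuantumField

/-! ### Stable ideals and strata -/

section Stable

variable {K : Type*} [Field K] [CharZero K] {n : ℕ} {ex : Finset (Fin n)} {v : Kˣ}
  {B : Matrix ex (Fin n) ℤ} {Λ : Matrix (Fin n) (Fin n) ℤ}
  {A : Type*} [Ring A] [Algebra K A] {ι : A →ₐ[K] QTorus v Λ} {x : Fin n → A} {j : ℕ}

omit [CharZero K] in
theorem vpow_injective {α : Kˣ} (h : ∀ j : ℕ, 0 < j → α ^ j ≠ 1) : Function.Injective (vpow α) := by
  have h1 : ¬ IsOfFinOrder α := by
    rw [isOfFinOrder_iff_pow_eq_one]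
    push Not
    exact h
  intro a b e
  exact injective_zpow_iff_not_isOfFinOrder.2 h1 (Units.ext e)

/-- The unit `2`. -/
def unitTwo (K : Type*) [Field K] [CharZero K] : Kˣ := Units.mk0 2 two_ne_zero

theorem unitTwo_pow_ne_one (j : ℕ) (hj : 0 < j) : unitTwo K ^ j ≠ 1 := by
  intro e
  have h1 : (2 : K) ^ j = 1 := congrArg Units.val e
  have h2 : 2 ^ j = 1 := by exact_mod_cast h1
  exact absurd h2 (Nat.one_lt_two_pow hj.ne').ne'

/-- Stability under the toric actions, in terms of Laurent expansions. -/
def IsScaleStable (ι : A →ₐ[K] QTorus v Λ) (B : Matrix ex (Fin n) ℤ) (W : Submodule K A) : Prop :=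
  ∀ w : Fin n → ℤ, B *ᵥ w = 0 → ∀ a ∈ W, ∃ b ∈ W,
    ι b = QTorus.diag (fun m => vpow (unitTwo K) (w ⬝ᵥ m)) (ι a)

theorem IsScaleStable.sup {W W' : Submodule K A} (h : IsScaleStable ι B W)
    (h' : IsScaleStable ι B W') : IsScaleStable ι B (W ⊔ W') := by
  intro w hw a ha
  obtain ⟨b, hb, c, hc, rfl⟩ := Submodule.mem_sup.1 ha
  obtain ⟨b', hb', e⟩ := h w hw b hb
  obtain ⟨c', hc', e'⟩ := h' w hw c hc
  exact ⟨b' + c', Submodule.add_mem_sup hb' hc', by rw [map_add, e, e', map_add, map_add]⟩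

/-- The polynomials in `P` in the first `j` variables are preserved by diagonal operators that
determine the values `Λ(e_i, m)` for `i < j`. -/
def IsFormStable (ι : A →ₐ[K] QTorus v Λ) (j : ℕ) (P : TwoSidedIdeal A) : Prop :=
  ∃ F : Set ((Fin n → ℤ) → K), (∀ m m' : Fin n → ℤ, (∀ χ ∈ F, χ m' = χ m) →
      ∀ i : Fin n, (i : ℕ) < j → form Λ (unitVec i) m' = form Λ (unitVec i) m) ∧
    ∀ χ ∈ F, ∀ a ∈ P, ι a ∈ sp K (QTorus.mono v Λ) (nonnegExponents n j) →
      ∃ b ∈ P, ι b = QTorus.diag χ (ι a)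

/-- The torus weights determine `w ⬝ᵥ m` for `w ∈ ker B`, and form stability determines `Λ(e_i, m)`
for `i < j`; by the super-toric condition these values separate exponents. The single scalar `2`
suffices for the torus, as it has infinite order in characteristic `0`. -/
theorem IsLaurentAlgebra.eq_zero_of_stable (h : IsLaurentAlgebra ι x) (hs : IsSuperToric B Λ)
    (hΛ : Λᵀ = -Λ) (hj : j ≤ n) {W : Submodule K A} (hW : IsScaleStable ι B W)
    {P : TwoSidedIdeal A} (hWP : W ≤ idealSubmodule K P) (hP : IsCompletelyPrime P)
    (h1 : (1 : A) ∉ P) (hx : ∀ i : Fin n, (i : ℕ) < j → x i ∉ P) (hF : IsFormStable ι j P)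
    {a : A} (haW : a ∈ W) (ha : ι a ∈ sp K (QTorus.mono v Λ) (nonnegExponents n j)) : a = 0 := by
  obtain ⟨F, hF, hF'⟩ := hF
  refine h.eq_zero_of_separated hWP hP h1 hx
    (F₁ := {χ | ∃ w, B *ᵥ w = 0 ∧ χ = fun m => vpow (unitTwo K) (w ⬝ᵥ m)}) (F₂ := F) ?_ hF' ?_ haW ha
  · rintro _ ⟨w, hw, rfl⟩ a ha
    exact hW w hw a ha
  · intro m hm m' hm' e1 e2
    rw [← sub_eq_zero]
    refine hs.eq_zero hΛ hj (fun i hi => ?_) (fun w hw => ?_) (fun i hi => ?_)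
    · rw [Pi.sub_apply, hm i hi, hm' i hi, sub_zero]
    · have := vpow_injective unitTwo_pow_ne_one (e1 _ ⟨w, hw, rfl⟩)
      rw [dotProduct_sub, this, sub_self]
    · rw [form_sub_right, hF m m' e2 i hi, sub_self]

theorem IsLaurentAlgebra.polyFree (h : IsLaurentAlgebra ι x) (hs : IsSuperToric B Λ)
    (hΛ : Λᵀ = -Λ) (hj : j ≤ n) {J : TwoSidedIdeal A} (hJ : IsScaleStable ι B (idealSubmodule K J))
    (hP : IsCompletelyPrime J) (h1 : (1 : A) ∉ J) (hx : ∀ i : Fin n, (i : ℕ) < j → x i ∉ J)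
    (hF : IsFormStable ι j J) : PolyFree ι j J := fun _ ha ha' =>
  h.eq_zero_of_stable hs hΛ hj hJ le_rfl hP h1 hx hF ha ha'

omit [CharZero K] in
theorem QTorus.coeff_mul_mono (u m : Fin n → ℤ) (f : QTorus v Λ) :
    (f * QTorus.mono v Λ u).coeff (m + u) = vpow v (form Λ m u) * f.coeff m := by
  induction f using QTorus.induction with
  | add f g hf hg => rw [add_mul, coeff_add, Finsupp.add_apply, hf, hg, coeff_add,
      Finsupp.add_apply, mul_add]
  | smul c f hf => rw [smul_mul_assoc, coeff_smul, Finsupp.smul_apply, hf, coeff_smul,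
      Finsupp.smul_apply, smul_eq_mul, smul_eq_mul, mul_left_comm]
  | mono a =>
    rw [QTorus.mono_mul, coeff_smul, Finsupp.smul_apply, smul_eq_mul, QTorus.mono, QTorus.mono,
      Finsupp.single_apply, Finsupp.single_apply]
    by_cases h : a = m
    · simp [h]
    · simp [h]

omit [CharZero K] in
theorem QTorus.mem_support_mul_mono {u m : Fin n → ℤ} {f : QTorus v Λ} :
    m ∈ (f * QTorus.mono v Λ u).coeff.support ↔ m - u ∈ f.coeff.support := by
  have h : m = (m - u) + u := by abel
  rw [Finsupp.mem_support_iff, Finsupp.mem_support_iff]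
  conv_lhs => rw [h, QTorus.coeff_mul_mono]
  simp [vpow_ne_zero]

omit [CharZero K] in
theorem exists_mul_mem_nonneg {f : QTorus v Λ} (hf : f ∈ sp K (QTorus.mono v Λ) (exponents n j)) :
    ∃ u ∈ nonnegExponents n j,
      QTorus.mono v Λ u * f ∈ sp K (QTorus.mono v Λ) (nonnegExponents n j) ∧
      f * QTorus.mono v Λ u ∈ sp K (QTorus.mono v Λ) (nonnegExponents n j) := by
  obtain ⟨u, hu, hclear⟩ := exists_clearing j f.coeff.support
  have key : ∀ m, m - u ∈ f.coeff.support → m ∈ nonnegExponents n j := by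
    intro m hm'
    have hr := QTorus.mem_sp_mono.1 hf hm'
    have h0 : ∀ l : Fin n, j ≤ (l : ℕ) → m l = 0 := fun l hl => by
      have := hr l hl
      rw [Pi.sub_apply, hu.1 l hl, sub_zero] at this
      exact this
    refine ⟨h0, fun l => ?_⟩
    by_cases hl : (l : ℕ) < j
    · have := hclear _ hm' l hl
      rwa [Pi.sub_apply, add_sub_cancel] at this
    · exact (h0 l (not_lt.1 hl)).ge
  exact ⟨u, hu, QTorus.mem_sp_mono.2 fun m hm => key m (QTorus.mem_support_mono_mul.1 hm),
    QTorus.mem_sp_mono.2 fun m hm => key m (QTorus.mem_support_mul_mono.1 hm)⟩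

omit [CharZero K] in
/-- Clearing denominators in residues. -/
theorem IsResidue.exists_clear' {J : TwoSidedIdeal A} {ψ : A →ₐ[K] QTorus v Λ}
    (hψ : IsResidue ι j J ψ) (h : IsLaurentAlgebra ι x) (a : A) :
    ∃ u ∈ nonnegExponents n j, ∃ s c : A, ι s = QTorus.mono v Λ u ∧ ψ s = QTorus.mono v Λ u ∧
      ι c = QTorus.mono v Λ u * ψ a ∧
      ι c ∈ sp K (QTorus.mono v Λ) (nonnegExponents n j) ∧ s * a - c ∈ J := by
  obtain ⟨u, hu, hc, -⟩ := exists_mul_mem_nonneg (hψ.range a)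
  obtain ⟨s, hs, hs'⟩ := hψ.map_of_mem h (mem_sp hu)
  obtain ⟨c, hc1, hc'⟩ := hψ.map_of_mem h hc
  refine ⟨u, hu, s, c, hs, hs', hc1, hc1 ▸ hc, ?_⟩
  rw [← hψ.ker, map_sub, map_mul, hs', hc', sub_self]

/-- `J` contains every stable subspace of `P`, if `J ≤ P` and `P` contains none of the first `j`
variables. -/
theorem IsResidue.mem_of_stable {J : TwoSidedIdeal A} {ψ : A →ₐ[K] QTorus v Λ}
    (hψ : IsResidue ι j J ψ) (h : IsLaurentAlgebra ι x) (hs : IsSuperToric B Λ)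
    (hΛ : Λᵀ = -Λ) (hj : j ≤ n) (hJ : IsScaleStable ι B (idealSubmodule K J))
    (hJp : IsCompletelyPrime J) (hJf : PolyFree ι j J)
    {P : TwoSidedIdeal A} (hJP : J ≤ P) (hP : IsCompletelyPrime P)
    (h1 : (1 : A) ∉ P) (hx : ∀ i : Fin n, (i : ℕ) < j → x i ∉ P) (hF : IsFormStable ι j P)
    {W : Submodule K A} (hW : IsScaleStable ι B W) (hWi : ∀ (b : A), ∀ a ∈ W, b * a ∈ W)
    (hWP : W ≤ idealSubmodule K P) {a : A} (ha : a ∈ W) : a ∈ J := by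
  obtain ⟨u, hu, s, c, hs1, -, -, hc, hm⟩ := hψ.exists_clear' h a
  -- The polynomial `c` lies in `W ⊔ J`, which is stable and contained in `P`.
  have hc0 : c = 0 := by
    refine h.eq_zero_of_stable hs hΛ hj (hW.sup hJ) (sup_le hWP fun b hb => hJP hb) hP h1 hx hF
      ?_ hc
    rw [show c = s * a + -(s * a - c) by abel]
    exact Submodule.add_mem_sup (hWi _ _ ha) (J.neg_mem hm)
  rw [hc0, sub_zero] at hm
  exact (hJp _ _ hm).resolve_left (hJf.notMem hu hs1)

end Stable

/-! ### Prime spectra of noncommutative localizations -/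

section Localization

variable {R T : Type*} [Ring R] [Ring T]

/-- `T` is obtained from a quotient of `R` by inverting the images of the elements of `S`, which form
a left and right Ore set in the quotient. -/
structure IsOreQuotient (ψ : R →+* T) (S : Submonoid R) : Prop where
  isUnit : ∀ s ∈ S, IsUnit (ψ s)
  left : ∀ t, ∃ s ∈ S, ∃ a, ψ s * t = ψ a
  right : ∀ t, ∃ s ∈ S, ∃ a, t * ψ s = ψ a

variable {ψ : R →+* T} {S : Submonoid R}

theorem IsCompletelyPrime.isPrimeIdeal {P : TwoSidedIdeal R} (hP : IsCompletelyPrime P)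
    (h1 : P ≠ ⊤) : IsPrimeIdeal P where
  ne_top := h1
  mem_or_mem a b h := hP a b (by simpa using h 1)

theorem ne_top_iff_one_notMem {P : TwoSidedIdeal R} : P ≠ ⊤ ↔ (1 : R) ∉ P := by
  rw [not_iff_not]
  refine ⟨fun e => e ▸ trivial, fun h => ?_⟩
  rw [eq_top_iff]
  intro a _
  simpa using P.mul_mem_left a 1 h

theorem mem_of_isUnit_mul {Q : TwoSidedIdeal T} {u t : T} (hu : IsUnit u) (h : u * t ∈ Q) : t ∈ Q := by
  obtain ⟨u, rfl⟩ := hu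
  simpa [← mul_assoc] using Q.mul_mem_left (↑u⁻¹ : T) _ h

theorem mem_of_mul_isUnit {Q : TwoSidedIdeal T} {u t : T} (hu : IsUnit u) (h : t * u ∈ Q) : t ∈ Q := by
  obtain ⟨u, rfl⟩ := hu
  simpa [mul_assoc] using Q.mul_mem_right _ (↑u⁻¹ : T) h

namespace IsOreQuotient

variable (h : IsOreQuotient ψ S)

include h

/-- `Q` is only assumed prime, so `ψ a * t * ψ b ∈ Q` is needed for all `t`, including inverses of
elements of `ψ S`. The ascending chain condition on left ideals supplies these inverses. -/
theorem isPrimeIdeal_comap [IsNoetherianRing R] {Q : TwoSidedIdeal T} (hQ : IsPrimeIdeal Q) :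
    IsPrimeIdeal (Q.comap ψ) where
  ne_top e := by
    refine ne_top_iff_one_notMem.1 hQ.ne_top ?_
    have : (1 : R) ∈ Q.comap ψ := e ▸ trivial
    rwa [TwoSidedIdeal.mem_comap, map_one] at this
  mem_or_mem a b hab := by
    -- `N g` means `g * ψ R * ψ b ⊆ Q`. It is inherited by `g * ψ r`, and `hinv` extends this to
    -- right multiplication by inverses of `ψ s`.
    let N : T → Prop := fun g => ∀ r, g * ψ r * ψ b ∈ Q
    have hN : ∀ r g, N g → N (g * ψ r) := fun r g hg r' => by
      simpa only [mul_assoc, map_mul] using hg (r * r')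
    have hinv : ∀ s ∈ S, ∀ g, N (g * ψ s) → N g := by
      intro s hs g hg
      obtain ⟨u, hu⟩ := h.isUnit s hs
      let L : ℕ →o Ideal R :=
        { toFun := fun k =>
            { carrier := {c | N (ψ c * ψ s ^ k)}
              zero_mem' := fun r => by simp
              add_mem' := fun {c c'} hc hc' r => by
                have := Q.add_mem (hc r) (hc' r)
                rwa [← add_mul, ← add_mul, ← add_mul, ← map_add] at this
              smul_mem' := fun r' c hc r => by
                have := Q.mul_mem_left (ψ r') _ (hc r)
                simpa [mul_assoc] using this }
          monotone' := monotone_nat_of_le_succ fun k c hc => by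
            have := hN s _ hc
            change N _
            rwa [pow_succ, ← mul_assoc] }
      obtain ⟨k, hk⟩ := monotone_stabilizes_iff_noetherian.2 ‹IsNoetherianRing R› L
      -- With `ψ c = ψ s' * g * (ψ s) ^ (-k)`, the assumption on `g * ψ s` says `c ∈ L (k + 1)`.
      -- Stabilization gives `c ∈ L k`, which is the claim for `ψ s' * g`.
      obtain ⟨s', hs', c, hc⟩ := h.left (g * (↑u⁻¹ : T) ^ k)
      have h1 : ψ c * ψ s ^ k = ψ s' * g := by
        rw [← hc, ← hu, ← mul_assoc, mul_assoc _ _ ((u : T) ^ k), ← Units.val_pow_eq_pow_val,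
          ← Units.val_pow_eq_pow_val, inv_pow, Units.inv_mul, mul_one]
      have h2 : c ∈ L (k + 1) := by
        change N (ψ c * ψ s ^ (k + 1))
        rw [pow_succ, ← mul_assoc, h1]
        intro r
        simpa [mul_assoc] using Q.mul_mem_left (ψ s') _ (hg r)
      rw [← hk (k + 1) (Nat.le_succ k)] at h2
      change N (ψ c * ψ s ^ k) at h2
      rw [h1] at h2
      intro r
      refine mem_of_isUnit_mul (h.isUnit s' hs') ?_
      simpa [mul_assoc] using h2 r
    have ha : N (ψ a) := fun r => by simpa [TwoSidedIdeal.mem_comap] using hab r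
    rw [TwoSidedIdeal.mem_comap, TwoSidedIdeal.mem_comap]
    refine hQ.mem_or_mem _ _ fun t => ?_
    obtain ⟨s, hs, r, hr⟩ := h.left t
    obtain ⟨u, hu⟩ := h.isUnit s hs
    have ht : t = (↑u⁻¹ : T) * ψ r := by
      rw [← hr, ← hu, ← mul_assoc, Units.inv_mul, one_mul]
    have h3 : N (ψ a * (↑u⁻¹ : T)) := by
      refine hinv s hs _ ?_
      rwa [mul_assoc, ← hu, Units.inv_mul, mul_one]
    have := h3 r
    rwa [mul_assoc (ψ a), ← ht] at this

variable {P : TwoSidedIdeal R} (hP : IsCompletelyPrime P) (hker : ∀ a, ψ a = 0 → a ∈ P)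
  (hS : ∀ s ∈ S, s ∉ P)

include hP hker hS

/-- Membership of the numerator in `P` does not depend on the fraction: the Ore condition gives `s₂
* s' ≡ r * s` modulo the kernel, hence `r * a ≡ s₂ * p ∈ P`. Moreover `r ∉ P`, as otherwise `s₂ * s'
∈ S` would lie in `P`. -/
theorem mem_of_eq {s s' a p : R} {t : T} (hs : s ∈ S) (hs' : s' ∈ S) (hp : p ∈ P)
    (e : ψ s * t = ψ a) (e' : ψ s' * t = ψ p) : a ∈ P := by
  obtain ⟨u, hu⟩ := h.isUnit s hs
  obtain ⟨s₂, hs₂, r, hr⟩ := h.left (ψ s' * (↑u⁻¹ : T))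
  have h1 : ψ (s₂ * s') = ψ (r * s) := by
    rw [map_mul, map_mul, ← hr, ← hu, mul_assoc, mul_assoc, Units.inv_mul, mul_one]
  have h2 : ψ (r * a) = ψ (s₂ * p) := by
    rw [map_mul, ← e, ← mul_assoc, ← map_mul, ← h1, map_mul, map_mul, mul_assoc, e']
  have h3 : r * a ∈ P := by
    rw [← sub_add_cancel (r * a) (s₂ * p)]
    exact P.add_mem (hker _ (by rw [map_sub, h2, sub_self])) (P.mul_mem_left _ _ hp)
  refine (hP _ _ h3).resolve_left fun hr' => hS _ (S.mul_mem hs₂ hs') ?_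
  rw [← sub_add_cancel (s₂ * s') (r * s)]
  exact P.add_mem (hker _ (by rw [map_sub, h1, sub_self])) (P.mul_mem_right _ _ hr')

/-- The extension of a completely prime ideal. -/
def extension : TwoSidedIdeal T :=
  TwoSidedIdeal.mk' {t | ∃ s ∈ S, ∃ p ∈ P, ψ s * t = ψ p}
    ⟨1, S.one_mem, 0, P.zero_mem, by simp⟩
    (by
      rintro t₁ t₂ ⟨s₁, hs₁, p₁, hp₁, e₁⟩ ⟨s₂', hs₂', p₂', hp₂', e₂'⟩
      obtain ⟨s, hs, b, e⟩ := h.left (ψ s₁ * t₂)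
      rw [← mul_assoc, ← map_mul] at e
      refine ⟨s * s₁, S.mul_mem hs hs₁, s * p₁ + b, P.add_mem (P.mul_mem_left _ _ hp₁)
        (h.mem_of_eq hP hker hS (S.mul_mem hs hs₁) hs₂' hp₂' e e₂'), ?_⟩
      rw [mul_add, e, map_add, map_mul, map_mul, mul_assoc, e₁])
    (by
      rintro t ⟨s, hs, p, hp, e⟩
      exact ⟨s, hs, -p, P.neg_mem hp, by rw [mul_neg, e, map_neg]⟩)
    (by
      rintro g t ⟨s, hs, p, hp, e⟩
      obtain ⟨u, hu⟩ := h.isUnit s hs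
      obtain ⟨s', hs', r, hr⟩ := h.left (g * (↑u⁻¹ : T))
      refine ⟨s', hs', r * p, P.mul_mem_left _ _ hp, ?_⟩
      rw [map_mul, ← hr, ← e, ← hu, mul_assoc, mul_assoc, ← mul_assoc (↑u⁻¹ : T),
        Units.inv_mul, one_mul])
    (by
      rintro t g ⟨s, hs, p, hp, e⟩
      obtain ⟨s₂, hs₂, b, hb⟩ := h.right g
      obtain ⟨s', hs', a, ha⟩ := h.left (t * g)
      refine ⟨s', hs', a, ?_, ha⟩
      -- `a * s₂` and `p * b` are numerators of the same element `t * ψ b`, so `a * s₂ ∈ P`, and `s₂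
      -- ∉ P`.
      refine (hP a s₂ (h.mem_of_eq hP hker hS (t := t * ψ b) (p := p * b) hs' hs
        (P.mul_mem_right _ _ hp) ?_ ?_)).resolve_right (hS _ hs₂)
      · rw [map_mul, ← ha, ← hb, mul_assoc, mul_assoc]
      · rw [map_mul, ← e, mul_assoc])

theorem mem_extension {t : T} :
    t ∈ h.extension hP hker hS ↔ ∃ s ∈ S, ∃ p ∈ P, ψ s * t = ψ p := TwoSidedIdeal.mem_mk' _ _ _ _ _ _ _

theorem mem_of_mem_extension {s a : R} {t : T} (ht : t ∈ h.extension hP hker hS) (hs : s ∈ S)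
    (e : ψ s * t = ψ a) : a ∈ P := by
  obtain ⟨s', hs', p, hp, e'⟩ := (h.mem_extension hP hker hS).1 ht
  exact h.mem_of_eq hP hker hS hs hs' hp e e'

theorem comap_extension : (h.extension hP hker hS).comap ψ = P := by
  ext a
  rw [TwoSidedIdeal.mem_comap]
  refine ⟨fun ha => h.mem_of_mem_extension hP hker hS ha S.one_mem (by simp), fun ha => ?_⟩
  exact (h.mem_extension hP hker hS).2 ⟨1, S.one_mem, a, ha, by simp⟩

/-- Taking a left denominator for the first factor and a right denominator for the second, no
denominator has to pass a numerator, and complete primeness of `P` applies to `a₁ * a₂`. -/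
theorem isPrimeIdeal_extension (h1 : P ≠ ⊤) : IsPrimeIdeal (h.extension hP hker hS) := by
  refine IsCompletelyPrime.isPrimeIdeal ?_ ?_
  · intro t₁ t₂ ht
    obtain ⟨s₁, hs₁, a₁, e₁⟩ := h.left t₁
    obtain ⟨s₂, hs₂, a₂, e₂⟩ := h.right t₂
    have ha : a₁ * a₂ ∈ P := by
      rw [← h.comap_extension hP hker hS, TwoSidedIdeal.mem_comap, map_mul, ← e₁, ← e₂]
      have := (h.extension hP hker hS).mul_mem_left (ψ s₁) _
        ((h.extension hP hker hS).mul_mem_right _ (ψ s₂) ht)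
      simpa [mul_assoc] using this
    rcases hP _ _ ha with ha | ha
    · exact .inl ((h.mem_extension hP hker hS).2 ⟨s₁, hs₁, a₁, ha, e₁⟩)
    · refine .inr (mem_of_mul_isUnit (h.isUnit s₂ hs₂) ?_)
      rw [e₂]
      exact (h.mem_extension hP hker hS).2 ⟨1, S.one_mem, a₂, ha, by simp⟩
  · rw [ne_top_iff_one_notMem] at h1 ⊢
    exact fun h2 => h1 (h.mem_of_mem_extension hP hker hS h2 S.one_mem (by simp))

omit hP hker hS

theorem le_of_comap_le {Q Q' : TwoSidedIdeal T} (hle : Q.comap ψ ≤ Q'.comap ψ) : Q ≤ Q' := by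
  intro t ht
  obtain ⟨s, hs, a, e⟩ := h.left t
  refine mem_of_isUnit_mul (h.isUnit s hs) ?_
  rw [e, ← TwoSidedIdeal.mem_comap]
  refine hle ?_
  rw [TwoSidedIdeal.mem_comap, ← e]
  exact Q.mul_mem_left _ _ ht

omit h in
theorem mem_comap_of_eq_zero (Q : TwoSidedIdeal T) {a : R} (ha : ψ a = 0) : a ∈ Q.comap ψ := by
  rw [TwoSidedIdeal.mem_comap, ha]
  exact Q.zero_mem

theorem notMem_comap {Q : TwoSidedIdeal T} (hQ : Q ≠ ⊤) {s : R} (hs : s ∈ S) : s ∉ Q.comap ψ := by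
  intro hsQ
  rw [TwoSidedIdeal.mem_comap] at hsQ
  refine ne_top_iff_one_notMem.1 hQ (mem_of_isUnit_mul (h.isUnit s hs) ?_)
  rwa [mul_one]

/-- The prime ideals of `T` correspond to the prime ideals of `R` that contain the kernel and are
disjoint from `S`. -/
def homeomorph [IsNoetherianRing R] (hR : PrimesAreCompletelyPrime R) {Z : Set (NCSpec R)}
    (hZ : ∀ P : NCSpec R, P ∈ Z ↔ (∀ a, ψ a = 0 → a ∈ P.1) ∧ ∀ s ∈ S, s ∉ P.1) : Z ≃ₜ NCSpec T where
  toFun P := ⟨h.extension (hR _ P.1.2) ((hZ _).1 P.2).1 ((hZ _).1 P.2).2,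
    h.isPrimeIdeal_extension _ _ _ P.1.2.ne_top⟩
  invFun Q := ⟨⟨Q.1.comap ψ, h.isPrimeIdeal_comap Q.2⟩, (hZ _).2
    ⟨fun _ => mem_comap_of_eq_zero Q.1, fun _ => h.notMem_comap Q.2.ne_top⟩⟩
  left_inv P := Subtype.ext (Subtype.ext
    (h.comap_extension (hR _ P.1.2) ((hZ _).1 P.2).1 ((hZ _).1 P.2).2))
  right_inv Q := by
    have e := h.comap_extension (hR _ (h.isPrimeIdeal_comap Q.2))
      (fun _ => mem_comap_of_eq_zero Q.1) (fun _ => h.notMem_comap Q.2.ne_top)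
    exact Subtype.ext (le_antisymm (h.le_of_comap_le e.le) (h.le_of_comap_le e.ge))
  continuous_toFun := by
    refine continuous_generateFrom_iff.2 ?_
    rintro _ ⟨I, rfl⟩
    -- An ideal of `T` is determined by its contraction, so containing `I` means containing `I.comap
    -- ψ`.
    refine ⟨{P | ¬ I.comap ψ ≤ P.1}, TopologicalSpace.isOpen_generateFrom_of_mem ⟨_, rfl⟩, ?_⟩
    ext P
    have e := h.comap_extension (hR _ P.1.2) ((hZ _).1 P.2).1 ((hZ _).1 P.2).2
    exact not_congr ⟨fun hI => h.le_of_comap_le (hI.trans e.ge),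
      fun hI => (TwoSidedIdeal.comap_le_comap ψ hI).trans e.le⟩
  continuous_invFun := by
    refine Continuous.subtype_mk (continuous_generateFrom_iff.2 ?_) _
    rintro _ ⟨I, rfl⟩
    refine TopologicalSpace.isOpen_generateFrom_of_mem ⟨TwoSidedIdeal.span (ψ '' I), ?_⟩
    ext Q
    refine not_congr ?_
    rw [TwoSidedIdeal.span_le, Set.image_subset_iff]
    refine forall₂_congr fun a _ => ?_
    exact TwoSidedIdeal.mem_comap ψ

end IsOreQuotient

end Localization

/-! ### Residues as localizations -/

section Restrict

variable {K : Type*} [Field K] {n : ℕ} {v : Kˣ} {Λ : Matrix (Fin n) (Fin n) ℤ}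
  {A : Type*} [Ring A] [Algebra K A] {ι : A →ₐ[K] QTorus v Λ} {x : Fin n → A} {j : ℕ}
  {J : TwoSidedIdeal A} {ψ : A →ₐ[K] QTorus v Λ}

/-- The monomials in the first `j` variables, up to scalars. -/
def monomials (ι : A →ₐ[K] QTorus v Λ) (j : ℕ) : Submonoid A where
  carrier := {s | ∃ u ∈ nonnegExponents n j, ∃ c : K, c ≠ 0 ∧ ι s = c • QTorus.mono v Λ u}
  one_mem' := ⟨0, ⟨fun _ _ => rfl, le_rfl⟩, 1, one_ne_zero, by
    rw [map_one, QTorus.mono_zero, one_smul]⟩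
  mul_mem' := by
    rintro s t ⟨u, hu, c, hc, hs⟩ ⟨u', hu', c', hc', ht⟩
    refine ⟨u + u', ⟨fun i hi => ?_, add_nonneg hu.2 hu'.2⟩, c * c' * vpow v (form Λ u u'),
      mul_ne_zero (mul_ne_zero hc hc') (vpow_ne_zero _ _), ?_⟩
    · rw [Pi.add_apply, hu.1 i hi, hu'.1 i hi, add_zero]
    · rw [map_mul, hs, ht, smul_mul_smul_comm, QTorus.mono_mul, smul_smul]

theorem mem_monomials {s : A} {u : Fin n → ℤ} (hu : u ∈ nonnegExponents n j)
    (hs : ι s = QTorus.mono v Λ u) : s ∈ monomials ι j :=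
  ⟨u, hu, 1, one_ne_zero, by rw [hs, one_smul]⟩

theorem IsLaurentAlgebra.notMem_of_mem_monomials (h : IsLaurentAlgebra ι x) {P : TwoSidedIdeal A}
    (hP : IsCompletelyPrime P) (h1 : (1 : A) ∉ P) :
    (∀ s ∈ monomials ι j, s ∉ P) ↔ ∀ i : Fin n, (i : ℕ) < j → x i ∉ P := by
  refine ⟨fun hS i hi => hS _ (mem_monomials (unitVec_mem_nonnegExponents hi) (h.map_var i)), ?_⟩
  rintro hx s ⟨u, hu, c, hc, hs⟩ hsP
  refine h.mono_notMem hP h1 hx hu (a := c⁻¹ • s) ?_ (twoSidedIdeal_smul_mem P _ hsP)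
  rw [map_smul, hs, smul_smul, inv_mul_cancel₀ hc, one_smul]

variable (hψ : IsResidue ι j J ψ) (hj : j ≤ n)

/-- A residue map, as a map to the quantum torus in the first `j` variables. -/
def IsResidue.restrict : A →ₐ[K] QTorus v (principal Λ j hj) :=
  (AlgEquiv.ofInjective (QTorus.embed v Λ hj) (QTorus.embed_injective hj)).symm.toAlgHom.comp
    (ψ.codRestrict (QTorus.embed v Λ hj).range fun a => QTorus.mem_range_embed hj (hψ.range a))

@[simp] theorem IsResidue.embed_restrict (a : A) :
    QTorus.embed v Λ hj (hψ.restrict hj a) = ψ a :=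
  congrArg Subtype.val ((AlgEquiv.ofInjective (QTorus.embed v Λ hj)
    (QTorus.embed_injective hj)).apply_symm_apply
    (ψ.codRestrict (QTorus.embed v Λ hj).range (fun a => QTorus.mem_range_embed hj (hψ.range a)) a))

theorem IsResidue.restrict_eq_zero {a : A} : hψ.restrict hj a = 0 ↔ a ∈ J := by
  rw [← hψ.ker, ← hψ.embed_restrict hj, map_eq_zero_iff _ (QTorus.embed_injective hj)]

theorem QTorus.embed_mem (t : QTorus v (principal Λ j hj)) :
    QTorus.embed v Λ hj t ∈ sp K (QTorus.mono v Λ) (exponents n j) := by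
  induction t using QTorus.induction with
  | add f g hf hg => rw [map_add]; exact add_mem hf hg
  | smul c f hf => rw [map_smul]; exact Submodule.smul_mem _ _ hf
  | mono m =>
    rw [QTorus.embed_mono]
    exact mem_sp fun i hi => QTorus.extendZero_of_le hj m hi

theorem QTorus.isUnit_mono (m : Fin n → ℤ) {c : K} (hc : c ≠ 0) (hΛ : Λᵀ = -Λ) :
    IsUnit (c • QTorus.mono v Λ m) := by
  have key : ∀ m : Fin n → ℤ, QTorus.mono v Λ m * QTorus.mono v Λ (-m) = 1 := fun m => by
    rw [QTorus.mono_mul, form_neg_right, form_self hΛ, neg_zero, vpow_zero, one_smul,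
      add_neg_cancel, QTorus.mono_zero]
  refine ⟨⟨c • QTorus.mono v Λ m, c⁻¹ • QTorus.mono v Λ (-m), ?_, ?_⟩, rfl⟩
  · rw [smul_mul_smul_comm, key, mul_inv_cancel₀ hc, one_smul]
  · have := key (-m)
    rw [neg_neg] at this
    rw [smul_mul_smul_comm, this, inv_mul_cancel₀ hc, one_smul]

theorem principal_skew (hΛ : Λᵀ = -Λ) : (principal Λ j hj)ᵀ = -principal Λ j hj := by
  ext a b
  exact congrFun (congrFun hΛ (Fin.castLE hj a)) (Fin.castLE hj b)

/-- `ψ` is the identity on polynomials in the first `j` variables, and a monomial multiplied on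
either side turns any Laurent polynomial in them into such a polynomial. -/
theorem IsResidue.isOreQuotient (h : IsLaurentAlgebra ι x) (hΛ : Λᵀ = -Λ) :
    IsOreQuotient (hψ.restrict hj : A →+* QTorus v (principal Λ j hj)) (monomials ι j) where
  isUnit := by
    rintro s ⟨u, hu, c, hc, hs⟩
    have : hψ.restrict hj s = c • QTorus.mono v _ (u ∘ Fin.castLE hj) := by
      apply QTorus.embed_injective hj
      rw [hψ.embed_restrict, map_smul, QTorus.embed_mono, extendZero_of_mem_exponents hj hu.1, ← hs]
      refine hψ.eq s ?_
      rw [hs]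
      exact Submodule.smul_mem _ _ (mem_sp hu)
    change IsUnit (hψ.restrict hj s)
    rw [this]
    exact QTorus.isUnit_mono _ hc (principal_skew hj hΛ)
  left t := by
    obtain ⟨u, hu, h1, -⟩ := exists_mul_mem_nonneg (QTorus.embed_mem hj t)
    obtain ⟨s, hs, hs'⟩ := hψ.map_of_mem h (mem_sp hu)
    obtain ⟨a, -, ha⟩ := hψ.map_of_mem h h1
    refine ⟨s, mem_monomials hu hs, a, QTorus.embed_injective hj ?_⟩
    change QTorus.embed v Λ hj (hψ.restrict hj s * t) = QTorus.embed v Λ hj (hψ.restrict hj a)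
    rw [map_mul, hψ.embed_restrict, hψ.embed_restrict, ha, hs']
  right t := by
    obtain ⟨u, hu, -, h1⟩ := exists_mul_mem_nonneg (QTorus.embed_mem hj t)
    obtain ⟨s, hs, hs'⟩ := hψ.map_of_mem h (mem_sp hu)
    obtain ⟨a, -, ha⟩ := hψ.map_of_mem h h1
    refine ⟨s, mem_monomials hu hs, a, QTorus.embed_injective hj ?_⟩
    change QTorus.embed v Λ hj (t * hψ.restrict hj s) = QTorus.embed v Λ hj (hψ.restrict hj a)
    rw [map_mul, hψ.embed_restrict, hψ.embed_restrict, ha, hs']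

end Restrict

/-! ### Toric ideals of cluster algebras -/

section Toric

variable {K : Type*} [Field K] {F : Type*} [DivisionRing F] [Algebra K F] {n : ℕ}
  {ex : Finset (Fin n)} {v : Kˣ} {d : ex → ℤ} {s : QSeed F ex} (h : s.IsGood v d)

include h

theorem QSeed.IsGood.isScaleStable [CharZero K] {W : Submodule K (s.algebra v)}
    (hW : IsTorusStable K s.B s.X (Subtype.val '' (W : Set (s.algebra v))))
    (hφ : ∀ w : Fin n → ℤ, ∃ φ : F ≃ₐ[K] F, ∀ i, φ (s.X i) = vpow (unitTwo K) (w i) • s.X i) :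
    IsScaleStable h.expansion s.B W := by
  intro w hw a ha
  obtain ⟨φ, hφ⟩ := hφ w
  obtain ⟨b, hb, e⟩ := hW φ ⟨w, hw, unitTwo K, hφ⟩ a ⟨a, ha, rfl⟩
  refine ⟨b, hb, h.torusHom_injective ?_⟩
  rw [h.torusHom_expansion, e, ← h.map_torusHom (φ := φ.toAlgHom) hφ, h.torusHom_expansion]
  rfl

/-- The action of a toric automorphism on the cluster algebra. -/
theorem QSeed.IsGood.exists_restrict {φ : F ≃ₐ[K] F} (hφ : φ ∈ toricAutomorphisms (K := K) s.B s.X) :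
    ∃ ψ : s.algebra v →ₐ[K] s.algebra v, (∀ a, (ψ a : F) = φ a) ∧
      ∀ i, ∃ c : K, ψ ⟨s.X i, s.X_mem_algebra i⟩ = c • ⟨s.X i, s.X_mem_algebra i⟩ := by
  obtain ⟨w, hw, α, hα⟩ := hφ
  refine ⟨(φ.toAlgHom.comp (s.algebra v).val).codRestrict (s.algebra v)
    fun a => h.map_mem_algebra (φ := φ.toAlgHom) hw hα a.2, fun _ => rfl, fun i => ⟨_, Subtype.ext (hα i)⟩⟩

end Toric

/-! ### Strata of quantum cluster algebras -/

section Quantum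

variable {K : Type*} [Field K] {n : ℕ} {ex : Finset (Fin n)} {v : Kˣ}
  {B : Matrix ex (Fin n) ℤ} {Λ : Matrix (Fin n) (Fin n) ℤ} {j : ℕ}

/-- For a polynomial `a ∈ P` one has `x i * a = b * x i`, where `b` arises from `a` by the factors
`v ^ (2 * Λ(e_i, m))`; complete primeness cancels `x i`. As `v` is not a root of unity, these
factors determine `Λ(e_i, m)`. -/
theorem IsLaurentAlgebra.isFormStable_of_notMem {A : Type*} [Ring A] [Algebra K A]
    {ι : A →ₐ[K] QTorus v Λ} {x : Fin n → A} (h : IsLaurentAlgebra ι x) (hΛ : Λᵀ = -Λ)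
    (hv : ∀ j : ℕ, 0 < j → v ^ j ≠ 1) {P : TwoSidedIdeal A} (hP : IsCompletelyPrime P)
    (hx : ∀ i : Fin n, (i : ℕ) < j → x i ∉ P) : IsFormStable ι j P := by
  refine ⟨{χ | ∃ i : Fin n, (i : ℕ) < j ∧ χ = fun m => vpow v (2 * form Λ (unitVec i) m)}, ?_, ?_⟩
  · intro m m' e i hi
    have := vpow_injective hv (e _ ⟨i, hi, rfl⟩)
    omega
  · rintro _ ⟨i, hi, rfl⟩ a ha hap
    obtain ⟨b, hb⟩ := h.exists_of_mem (QTorus.diag_mem_sp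
      (fun m => vpow v (2 * form Λ (unitVec i) m)) hap)
    refine ⟨b, (hP b (x i) ?_).resolve_right (hx i hi), hb⟩
    have : x i * a = b * x i := by
      apply h.injective
      rw [map_mul, map_mul, hb, h.map_var, QTorus.mono_mul_mono_mul_mono_neg hΛ]
    exact this ▸ P.mul_mem_left _ _ ha

/-- The Laurent expansion of the elements of the quantum cluster algebra. -/
def quantumExpansion {d : ex → ℤ} (hc : IsCompat B Λ d) : quantumClusterAlgebra v B Λ →ₐ[K] QTorus v Λ :=
  (QSeed.init_isGood (v := v) hc).expansion

theorem isLaurentAlgebra_quantumExpansion {d : ex → ℤ} (hc : IsCompat B Λ d) :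
    IsLaurentAlgebra (quantumExpansion (v := v) hc) (quantumClusterVar v B Λ) :=
  (QSeed.init_isGood (v := v) hc).isLaurentAlgebra

theorem quantum_isScaleStable [CharZero K] {d : ex → ℤ} (hc : IsCompat B Λ d)
    {I : TwoSidedIdeal (quantumClusterAlgebra v B Λ)} (hI : IsQuantumToricIdeal I) :
    IsScaleStable (quantumExpansion (v := v) hc) B (idealSubmodule K I) :=
  (QSeed.init_isGood (v := v) hc).isScaleStable (W := idealSubmodule K I) hI
    fun w => exists_quantum_toricAutomorphism w _

theorem isQuantumToricIdeal_span {d : ex → ℤ} (hc : IsCompat B Λ d) (i : Fin n) :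
    IsQuantumToricIdeal (TwoSidedIdeal.span {quantumClusterVar v B Λ i}) := by
  rintro φ hφ _ ⟨a, ha, rfl⟩
  obtain ⟨ψ, hψ, hψ'⟩ : ∃ ψ : quantumClusterAlgebra v B Λ →ₐ[K] quantumClusterAlgebra v B Λ,
      (∀ a, (ψ a : QField v Λ) = φ a) ∧
      ∀ i, ∃ c : K, ψ (quantumClusterVar v B Λ i) = c • quantumClusterVar v B Λ i :=
    (QSeed.init_isGood (v := v) hc).exists_restrict hφ
  have hle : TwoSidedIdeal.span {quantumClusterVar v B Λ i} ≤
      (TwoSidedIdeal.span {quantumClusterVar v B Λ i}).comap ψ := by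
    rw [TwoSidedIdeal.span_le, Set.singleton_subset_iff, SetLike.mem_coe, TwoSidedIdeal.mem_comap]
    obtain ⟨c, hc⟩ := hψ' i
    refine Eq.symm hc ▸ twoSidedIdeal_smul_mem _ _ ?_
    exact TwoSidedIdeal.subset_span rfl
  exact ⟨ψ a, (TwoSidedIdeal.mem_comap _).1 (hle ha), hψ a⟩

variable [CharZero K] {d : ex → ℤ} (hc : IsCompat B Λ d) (hs : IsSuperToric B Λ)
  (hv : ∀ j : ℕ, 0 < j → v ^ j ≠ 1)
  (hR : PrimesAreCompletelyPrime (quantumClusterAlgebra v B Λ))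

include hc hs hv hR

theorem quantum_polyFree (hj : j ≤ n) {J : TwoSidedIdeal (quantumClusterAlgebra v B Λ)}
    (hJ : IsPrimeIdeal J) (hJt : IsQuantumToricIdeal J)
    (hx : ∀ i : Fin n, (i : ℕ) < j → quantumClusterVar v B Λ i ∉ J) :
    PolyFree (quantumExpansion hc) j J :=
  (isLaurentAlgebra_quantumExpansion hc).polyFree hs hc.skew hj (quantum_isScaleStable hc hJt)
    (hR J hJ) (ne_top_iff_one_notMem.1 hJ.ne_top) hx
    ((isLaurentAlgebra_quantumExpansion hc).isFormStable_of_notMem hc.skew hv (hR J hJ) hx)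

/-- If `x_i ∈ P`, then the toric ideal generated by `x_i` lies in `P`, hence in the largest one `J`,
which is excluded. Conversely `IsResidue.mem_of_stable` shows that every toric ideal in `P` lies in
`J`. -/
theorem mem_quantumStratum_iff (hj : j ≤ n) {J : TwoSidedIdeal (quantumClusterAlgebra v B Λ)}
    {ψ : quantumClusterAlgebra v B Λ →ₐ[K] QTorus v Λ} (hψ : IsResidue (quantumExpansion hc) j J ψ)
    (hJ : IsPrimeIdeal J) (hJt : IsQuantumToricIdeal J)
    (hx : ∀ i : Fin n, (i : ℕ) < j → quantumClusterVar v B Λ i ∉ J)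
    (P : NCSpec (quantumClusterAlgebra v B Λ)) : P ∈ quantumStratum J ↔
      J ≤ P.1 ∧ ∀ i : Fin n, (i : ℕ) < j → quantumClusterVar v B Λ i ∉ P.1 := by
  have h := isLaurentAlgebra_quantumExpansion (v := v) hc
  constructor
  · rintro ⟨⟨-, hJP⟩, hmax⟩
    refine ⟨hJP, fun i hi hiP => hx i hi ?_⟩
    refine hmax ⟨isQuantumToricIdeal_span hc i, ?_⟩ (TwoSidedIdeal.subset_span rfl)
    rwa [TwoSidedIdeal.span_le, Set.singleton_subset_iff]
  · rintro ⟨hJP, hxP⟩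
    refine ⟨⟨hJt, hJP⟩, fun I ⟨hI, hIP⟩ a ha => ?_⟩
    exact hψ.mem_of_stable h hs hc.skew hj (quantum_isScaleStable hc hJt) (hR J hJ)
      (quantum_polyFree hc hs hv hR hj hJ hJt hx) hJP (hR _ P.2)
      (ne_top_iff_one_notMem.1 P.2.ne_top) hxP
      (h.isFormStable_of_notMem hc.skew hv (hR _ P.2) hxP) (quantum_isScaleStable hc hI)
      (fun b a ha => I.mul_mem_left b a ha) (fun b hb => hIP hb) ha

theorem nonempty_quantumStratum_homeomorph [IsNoetherianRing (quantumClusterAlgebra v B Λ)] {r : ℕ}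
    {I : ℕ → TwoSidedIdeal (quantumClusterAlgebra v B Λ)} (hI : IsQuantumCOS r I) {k : ℕ}
    (hkr : n < k + r) (hk : k ≤ n) : Nonempty (quantumStratum (I k) ≃ₜ
      NCSpec (QTorus v (principal Λ (k - 1) ((Nat.sub_le k 1).trans hk)))) := by
  have h := isLaurentAlgebra_quantumExpansion (v := v) hc
  have hr := hI.depth_le
  -- Variables are indexed from `0`, so `I (j + 1)` contains exactly those of index at least `j`,
  -- and its residue map has values in the first `j` variables.
  obtain ⟨j, rfl⟩ : ∃ j, k = j + 1 := ⟨k - 1, by omega⟩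
  have hx : ∀ j, n - r ≤ j → j < n → ∀ i : Fin n, (i : ℕ) < j →
      quantumClusterVar v B Λ i ∉ I (j + 1) := fun j h1 h2 i hi => by
    rw [hI.mem_iff (j + 1) (by omega) h2]
    omega
  obtain ⟨ψ, hψ⟩ := h.exists_isResidue (fun j => I (j + 1)) (j₀ := n - r) (Nat.sub_le _ _)
    (fun j h1 h2 => hR _ (hI.isPrime (j + 1) (by omega) h2))
    (fun j h1 h2 => quantum_polyFree hc hs hv hR h2.le (hI.isPrime (j + 1) (by omega) h2)
      (hI.isToric (j + 1) (by omega) h2) (hx j h1 h2))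
    (fun j h1 h2 => (hI.mem_iff (j + 1) (by omega) h2 _).2 le_rfl)
    (fun j h1 h2 => hI.le (j + 1) (by omega) h2) j (by omega) hk
  have hJ := hI.isPrime _ hkr hk
  have hxj := hx j (by omega) hk
  refine ⟨(hψ.isOreQuotient (Nat.le_of_succ_le hk) h hc.skew).homeomorph hR fun P => ?_⟩
  rw [mem_quantumStratum_iff hc hs hv hR (Nat.le_of_succ_le hk) hψ hJ (hI.isToric _ hkr hk) hxj P,
    h.notMem_of_mem_monomials (hR _ P.2) (ne_top_iff_one_notMem.1 P.2.ne_top)]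
  refine and_congr_left fun _ => forall_congr' fun a => ?_
  change _ ↔ (hψ.restrict _ a = 0 → _)
  rw [hψ.restrict_eq_zero]

end Quantum

/-! ### Cluster algebras as quantum cluster algebras at `v = 1` -/

section Classical

variable {K : Type*} [Field K] {n : ℕ} {ex : Finset (Fin n)}
  {B : Matrix ex (Fin n) ℤ} {Λ : Matrix (Fin n) (Fin n) ℤ} {d : ex → ℤ}

@[simp] theorem vpow_one (e : ℤ) : vpow (1 : Kˣ) e = 1 := by simp [vpow]

theorem toricFrame_one {F : Type*} [Field F] [Algebra K F] (X : Fin n → F) (c : Fin n → ℤ) :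
    toricFrame (1 : Kˣ) Λ X c = ∏ i, X i ^ c i := by
  rw [toricFrame, one_zpow, Units.val_one, one_smul, List.prod_ofFn]

/-- A classical seed as a quantum seed. -/
def Seed.toQSeed (s : Seed K ex) (Λ : Matrix (Fin n) (Fin n) ℤ) : QSeed (RationalFunctions K n) ex :=
  ⟨s.x, s.B, Λ⟩

/-- At `v = 1` toric frames are ordinary Laurent monomials, so the quantum exchange relation becomes
the commutative one divided by `x_k`. -/
theorem Seed.toQSeed_mutate {s : Seed K ex} (h : (s.toQSeed Λ).IsGood (1 : Kˣ) d) (k : ex) :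
    (s.toQSeed Λ).mutate (1 : Kˣ) k = (s.mutate k).toQSeed (mutateForm s.B Λ k) := by
  have hx : ∀ i, s.x i ≠ 0 := fun i => by
    rw [← show _ = s.x i from h.unit i]
    exact h.frame.ne_zero _
  have key : ∀ c : Fin n → ℤ, toricFrame (1 : Kˣ) Λ s.x
      (fun i => (if i = (k : Fin n) then -1 else 0) + max (c i) 0) =
        (∏ j, s.x j ^ (c j).toNat) / s.x k := by
    intro c
    rw [toricFrame_one]
    simp only [zpow_add₀ (hx _)]
    rw [Finset.prod_mul_distrib, mul_comm, div_eq_mul_inv]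
    congr 1
    · refine Finset.prod_congr rfl fun i _ => ?_
      rw [← Int.toNat_eq_max, zpow_natCast]
    · rw [Finset.prod_eq_single (k : Fin n)]
      · simp
      · intro i _ hi
        simp [hi]
      · simp
  change QSeed.mk (Function.update s.x _ (toricFrame (1 : Kˣ) Λ s.x _ + toricFrame (1 : Kˣ) Λ s.x _))
    _ _ = QSeed.mk _ _ _
  congr 1
  change _ = Function.update _ _ _
  rw [show Seed.B s = s.B from rfl, add_div]
  congr 2
  · exact key _
  · exact key fun i => -s.B k i

theorem clusterAlgebra_eq (h : ((Seed.init K B).toQSeed Λ).IsGood (1 : Kˣ) d) :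
    clusterAlgebra K B = ((Seed.init K B).toQSeed Λ).algebra (1 : Kˣ) := by
  rw [clusterAlgebra, QSeed.algebra]
  congr 1
  ext y
  constructor
  · rintro ⟨s, hs, i, rfl⟩
    -- Commutative seeds do not record the form, so it is carried along the mutations as an
    -- existential.
    suffices H : ∃ Λ', Relation.ReflTransGen (fun s t => ∃ k, t = s.mutate (1 : Kˣ) k)
        ((Seed.init K B).toQSeed Λ) (s.toQSeed Λ') ∧ (s.toQSeed Λ').IsGood (1 : Kˣ) d by
      obtain ⟨Λ', hΛ', -⟩ := H
      exact ⟨_, hΛ', i, rfl⟩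
    induction hs with
    | refl => exact ⟨Λ, .refl, h⟩
    | tail _ hu ih =>
      obtain ⟨k, rfl⟩ := hu
      obtain ⟨Λ', h1, h2⟩ := ih
      exact ⟨_, h1.tail ⟨k, (Seed.toQSeed_mutate h2 k).symm⟩, Seed.toQSeed_mutate h2 k ▸ h2.mutate k⟩
  · rintro ⟨t, ht, i, rfl⟩
    suffices H : ∃ s, t = s.toQSeed t.Λ ∧
        Relation.ReflTransGen (fun s t : Seed K ex => ∃ k, t = s.mutate k) (Seed.init K B) s ∧
        t.IsGood (1 : Kˣ) d by
      obtain ⟨s, hs, hs', -⟩ := H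
      exact ⟨s, hs', i, by rw [hs]; rfl⟩
    induction ht with
    | refl => exact ⟨_, rfl, .refl, h⟩
    | @tail t u _ hu ih =>
      obtain ⟨k, rfl⟩ := hu
      obtain ⟨s, h1, h2, h3⟩ := ih
      refine ⟨s.mutate k, ?_, h2.tail ⟨k, rfl⟩, h3.mutate k⟩
      generalize t.Λ = Λ' at h1
      subst h1
      rw [Seed.toQSeed_mutate h3 k]
      rfl

theorem initVar_ne_zero (i : Fin n) : initVar K i ≠ 0 := by
  rw [initVar, Ne, map_eq_zero_iff _ (IsFractionRing.injective (MvPolynomial (Fin n) K) _)]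
  exact MvPolynomial.X_ne_zero i

/-- The Laurent monomials in the initial cluster. -/
def laurentMonomial (K : Type*) [Field K] (m : Fin n → ℤ) : RationalFunctions K n :=
  ∏ i, initVar K i ^ m i

theorem laurentMonomial_add (a b : Fin n → ℤ) :
    laurentMonomial K (a + b) = laurentMonomial K a * laurentMonomial K b := by
  rw [laurentMonomial, laurentMonomial, laurentMonomial, ← Finset.prod_mul_distrib]
  exact Finset.prod_congr rfl fun i _ => zpow_add₀ (initVar_ne_zero i) _ _

theorem laurentMonomial_zero : laurentMonomial K (0 : Fin n → ℤ) = 1 := by simp [laurentMonomial]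

theorem laurentMonomial_unitVec (i : Fin n) : laurentMonomial K (unitVec i) = initVar K i := by
  rw [laurentMonomial, Finset.prod_eq_single i]
  · simp [unitVec]
  · intro j _ hj
    simp [unitVec, hj]
  · simp

theorem laurentMonomial_of_nonneg (m : Fin n →₀ ℕ) : laurentMonomial K (fun i => (m i : ℤ)) =
    algebraMap (MvPolynomial (Fin n) K) _ (MvPolynomial.monomial m 1) := by
  rw [MvPolynomial.monomial_eq, map_one, one_mul, Finsupp.prod_fintype _ _ (by simp), map_prod]
  simp [laurentMonomial, initVar]

/-- Multiplication by one monomial moves a relation into the polynomial ring, where distinct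
monomials are independent. -/
theorem linearIndependent_laurentMonomial :
    LinearIndependent K (laurentMonomial K : (Fin n → ℤ) → RationalFunctions K n) := by
  rw [linearIndependent_iff]
  intro l hl
  obtain ⟨u, -, hu⟩ := exists_clearing n l.support
  let τ : (Fin n → ℤ) → (Fin n →₀ ℕ) := fun m => Finsupp.equivFunOnFinite.symm fun i => (u i + m i).toNat
  have hτ : ∀ m ∈ l.support, laurentMonomial K (u + m) =
      algebraMap (MvPolynomial (Fin n) K) _ (MvPolynomial.monomial (τ m) 1) := by
    intro m hm
    rw [← laurentMonomial_of_nonneg]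
    congr 1
    ext i
    exact (Int.toNat_of_nonneg (hu m hm i i.2)).symm
  have h1 : algebraMap (MvPolynomial (Fin n) K) (RationalFunctions K n)
      (∑ m ∈ l.support, MvPolynomial.monomial (τ m) (l m)) = 0 := by
    have := congrArg (laurentMonomial K u * ·) hl
    simp only [Finsupp.linearCombination_apply, Finsupp.sum, Finset.mul_sum, mul_zero,
      mul_smul_comm, ← laurentMonomial_add] at this
    rw [← this, map_sum]
    refine Finset.sum_congr rfl fun m hm => ?_
    rw [hτ m hm, ← mul_one (l m), ← smul_eq_mul, ← MvPolynomial.smul_monomial, smul_eq_mul, mul_one]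
    exact map_smul (IsScalarTower.toAlgHom K (MvPolynomial (Fin n) K) (RationalFunctions K n)) _ _
  rw [map_eq_zero_iff _ (IsFractionRing.injective _ _)] at h1
  ext m
  by_contra hm
  have hm' : m ∈ l.support := Finsupp.mem_support_iff.2 hm
  have h2 := congrArg (MvPolynomial.coeff (τ m)) h1
  rw [MvPolynomial.coeff_sum, Finset.sum_eq_single_of_mem m hm'] at h2
  · simp at h2
    exact hm h2
  · intro m' hm'' hne
    rw [MvPolynomial.coeff_monomial, if_neg]
    intro e
    apply hne
    ext i
    have := DFunLike.congr_fun e i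
    have h3 := hu m hm' i i.2
    have h4 := hu m' hm'' i i.2
    change (u i + m' i).toNat = (u i + m i).toNat at this
    omega

theorem Seed.init_isGood (h : IsCompat B Λ d) : ((Seed.init K B).toQSeed Λ).IsGood (1 : Kˣ) d :=
  .of_frame (M := laurentMonomial K)
    { skew := h.skew
      map_zero := laurentMonomial_zero
      mul := fun a b => by rw [vpow_one, one_smul, laurentMonomial_add]
      indep := linearIndependent_laurentMonomial } laurentMonomial_unitVec h

theorem exists_toricAutomorphism (w : Fin n → ℤ) (α : Kˣ) :
    ∃ φ : RationalFunctions K n ≃ₐ[K] RationalFunctions K n,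
      ∀ i, φ (initVar K i) = vpow α (w i) • initVar K i := by
  let f : (Fin n → ℤ) → MvPolynomial (Fin n) K →ₐ[K] MvPolynomial (Fin n) K := fun w =>
    MvPolynomial.aeval fun i => vpow α (w i) • MvPolynomial.X i
  have hf : ∀ w, (f w).comp (f (-w)) = AlgHom.id K _ := fun w => by
    ext i : 1
    simp [f, smul_smul, ← vpow_add]
  let e : MvPolynomial (Fin n) K ≃ₐ[K] MvPolynomial (Fin n) K :=
    AlgEquiv.ofAlgHom (f w) (f (-w)) (hf w) (by simpa using hf (-w))
  refine ⟨IsFractionRing.fieldEquivOfAlgEquiv K _ _ e, fun i => ?_⟩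
  rw [initVar, IsFractionRing.fieldEquivOfAlgEquiv_algebraMap]
  change algebraMap _ _ (f w (MvPolynomial.X i)) = _
  rw [MvPolynomial.aeval_X]
  exact map_smul (IsScalarTower.toAlgHom K (MvPolynomial (Fin n) K) (RationalFunctions K n)) _ _

end Classical

/-! ### The log-canonical bracket -/

section Bracket

variable {K : Type*} [Field K] {n : ℕ} {ex : Finset (Fin n)} {B : Matrix ex (Fin n) ℤ}
  {Λ : Matrix (Fin n) (Fin n) ℤ} {d : ex → ℤ}

theorem RationalFunctions.exists_div (f : RationalFunctions K n) :
    ∃ a b : MvPolynomial (Fin n) K, b ≠ 0 ∧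
      f = algebraMap _ (RationalFunctions K n) a / algebraMap _ (RationalFunctions K n) b := by
  obtain ⟨a, b, hb, e⟩ := IsFractionRing.div_surjective (A := MvPolynomial (Fin n) K) f
  exact ⟨a, b, nonZeroDivisors.ne_zero hb, e.symm⟩

theorem algebraMap_ne_zero {b : MvPolynomial (Fin n) K} (hb : b ≠ 0) :
    algebraMap _ (RationalFunctions K n) b ≠ 0 := by
  rwa [Ne, map_eq_zero_iff _ (IsFractionRing.injective (MvPolynomial (Fin n) K) _)]

theorem partialDeriv_add (i : Fin n) (f g : RationalFunctions K n) :
    partialDeriv K i (f + g) = partialDeriv K i f + partialDeriv K i g := by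
  obtain ⟨a, b, hb, rfl⟩ := RationalFunctions.exists_div f
  obtain ⟨c, e, he, rfl⟩ := RationalFunctions.exists_div g
  have hb' := algebraMap_ne_zero hb
  have he' := algebraMap_ne_zero he
  rw [div_add_div _ _ hb' he', ← map_mul, ← map_mul, ← map_add, ← map_mul,
    partialDeriv_div _ _ _ _ (mul_ne_zero hb he), partialDeriv_div _ _ _ _ hb,
    partialDeriv_div _ _ _ _ he]
  simp only [Derivation.leibniz, map_add, map_sub, map_mul, map_pow, smul_eq_mul]
  field_simp
  ring

theorem partialDeriv_mul (i : Fin n) (f g : RationalFunctions K n) :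
    partialDeriv K i (f * g) = f * partialDeriv K i g + g * partialDeriv K i f := by
  obtain ⟨a, b, hb, rfl⟩ := RationalFunctions.exists_div f
  obtain ⟨c, e, he, rfl⟩ := RationalFunctions.exists_div g
  have hb' := algebraMap_ne_zero hb
  have he' := algebraMap_ne_zero he
  rw [div_mul_div_comm, ← map_mul, ← map_mul,
    partialDeriv_div _ _ _ _ (mul_ne_zero hb he), partialDeriv_div _ _ _ _ hb,
    partialDeriv_div _ _ _ _ he]
  simp only [Derivation.leibniz, map_add, map_sub, map_mul, map_pow, smul_eq_mul]
  field_simp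
  ring

theorem partialDeriv_algebraMap (i : Fin n) (a : MvPolynomial (Fin n) K) :
    partialDeriv K i (algebraMap _ _ a) = algebraMap _ _ (MvPolynomial.pderiv i a) := by
  have := partialDeriv_div K i a 1 one_ne_zero
  simpa using this

/-- The Euler derivations `x_i ∂ / ∂ x_i`. -/
def eulerDerivation (i : Fin n) : Derivation K (RationalFunctions K n) (RationalFunctions K n) :=
  initVar K i • Derivation.mk'
    { toFun := partialDeriv K i
      map_add' := partialDeriv_add i
      map_smul' := fun c f => by
        rw [RingHom.id_apply, Algebra.smul_def, partialDeriv_mul,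
          IsScalarTower.algebraMap_apply K (MvPolynomial (Fin n) K), partialDeriv_algebraMap,
          MvPolynomial.algebraMap_eq, MvPolynomial.pderiv_C, map_zero, mul_zero, add_zero,
          Algebra.smul_def, IsScalarTower.algebraMap_apply K (MvPolynomial (Fin n) K),
          MvPolynomial.algebraMap_eq] }
    (partialDeriv_mul i)

theorem eulerDerivation_apply (i : Fin n) (f : RationalFunctions K n) :
    eulerDerivation i f = initVar K i * partialDeriv K i f := rfl

theorem eulerDerivation_initVar (i j : Fin n) :
    eulerDerivation i (initVar K j) = (unitVec j i : RationalFunctions K n) * initVar K j := by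
  rw [eulerDerivation_apply]
  conv_lhs => rw [initVar, initVar, partialDeriv_algebraMap, MvPolynomial.pderiv_X]
  by_cases h : i = j
  · subst h
    simp [unitVec, initVar]
  · simp [unitVec, h]

/-- The exponents with this property are closed under addition by the Leibniz rule, and under
negation by differentiating `x^a * x^(-a) = 1`. They contain the unit vectors, and every exponent is
a difference of nonnegative ones. -/
theorem eulerDerivation_laurentMonomial (i : Fin n) (m : Fin n → ℤ) :
    eulerDerivation i (laurentMonomial K m) = (m i : RationalFunctions K n) * laurentMonomial K m := by
  have hadd : ∀ a b : Fin n → ℤ,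
      eulerDerivation i (laurentMonomial K a) = (a i : RationalFunctions K n) * laurentMonomial K a →
      eulerDerivation i (laurentMonomial K b) = (b i : RationalFunctions K n) * laurentMonomial K b →
      eulerDerivation i (laurentMonomial K (a + b)) =
        ((a + b) i : RationalFunctions K n) * laurentMonomial K (a + b) := by
    intro a b ha hb
    rw [laurentMonomial_add, Derivation.leibniz, ha, hb, Pi.add_apply, smul_eq_mul, smul_eq_mul]
    push_cast
    ring
  let G : AddSubmonoid (Fin n → ℤ) :=
    { carrier := {m | eulerDerivation i (laurentMonomial K m) =
        (m i : RationalFunctions K n) * laurentMonomial K m}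
      zero_mem' := by
        change eulerDerivation i (laurentMonomial K (0 : Fin n → ℤ)) = _
        rw [laurentMonomial_zero, Derivation.map_one_eq_zero, Pi.zero_apply, Int.cast_zero, zero_mul]
      add_mem' := fun {a b} => hadd a b }
  have hneg : ∀ a ∈ G, -a ∈ G := by
    intro a ha
    change eulerDerivation i (laurentMonomial K a) = _ at ha
    change eulerDerivation i (laurentMonomial K (-a)) = _
    have h1 : laurentMonomial K a * laurentMonomial K (-a) = 1 := by
      rw [← laurentMonomial_add, add_neg_cancel, laurentMonomial_zero]
    have h2 := congrArg (eulerDerivation i) h1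
    rw [Derivation.map_one_eq_zero, Derivation.leibniz, ha, smul_eq_mul, smul_eq_mul] at h2
    have h3 : laurentMonomial K a ≠ 0 := left_ne_zero_of_mul_eq_one h1
    apply mul_left_cancel₀ h3
    rw [Pi.neg_apply]
    push_cast
    linear_combination h2
  have hpos : ∀ m : Fin n → ℤ, 0 ≤ m → m ∈ G := fun m hm =>
    mem_of_nonneg (j := n) G (fun j _ => by
      change eulerDerivation i (laurentMonomial K (unitVec j)) = _
      rw [laurentMonomial_unitVec, eulerDerivation_initVar])
      ⟨fun i hi => absurd i.2 (not_lt.2 hi), hm⟩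
  have : m = m⁺ + -m⁻ := by
    rw [← sub_eq_add_neg, posPart_sub_negPart]
  rw [this]
  exact G.add_mem (hpos _ (posPart_nonneg m)) (hneg _ (hpos _ (negPart_nonneg m)))

/-- The derivation `{·, g}`. -/
def hamiltonian (Λ : Matrix (Fin n) (Fin n) ℤ) (g : RationalFunctions K n) :
    Derivation K (RationalFunctions K n) (RationalFunctions K n) :=
  ∑ i, ∑ j, ((Λ i j : RationalFunctions K n) * eulerDerivation j g) • eulerDerivation i

/-- Gives linearity and the Leibniz rule in the first argument, which the quotient rule formula does
not display. -/
theorem logBracket_eq_hamiltonian (f g : RationalFunctions K n) :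
    logBracket K Λ f g = hamiltonian Λ g f := by
  have hsum : ∀ D : Fin n → Derivation K (RationalFunctions K n) (RationalFunctions K n),
      (∑ i, D i) f = ∑ i, D i f := fun D =>
    (congrFun (map_sum Derivation.coeFnAddMonoidHom D Finset.univ) f).trans (Finset.sum_apply _ _ _)
  rw [hamiltonian, hsum, logBracket]
  refine Finset.sum_congr rfl fun i _ => ?_
  rw [hsum]
  refine Finset.sum_congr rfl fun j _ => ?_
  rw [Derivation.smul_apply, smul_eq_mul, eulerDerivation_apply, eulerDerivation_apply]
  ring

theorem logBracket_swap (hΛ : Λᵀ = -Λ) (f g : RationalFunctions K n) :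
    logBracket K Λ g f = -logBracket K Λ f g := by
  rw [logBracket, logBracket, Finset.sum_comm, ← Finset.sum_neg_distrib]
  refine Finset.sum_congr rfl fun i _ => ?_
  rw [← Finset.sum_neg_distrib]
  refine Finset.sum_congr rfl fun j _ => ?_
  have : Λ j i = -Λ i j := congrFun (congrFun hΛ i) j
  rw [this]
  push_cast
  ring

theorem logBracket_laurentMonomial (a b : Fin n → ℤ) :
    logBracket K Λ (laurentMonomial K a) (laurentMonomial K b) =
      (form Λ a b : K) • (laurentMonomial K a * laurentMonomial K b) := by
  have h : ((form Λ a b : ℤ) : RationalFunctions K n) = ∑ i, ∑ j,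
      (Λ i j : RationalFunctions K n) * a i * b j := by
    rw [form, dotProduct]
    push_cast
    refine Finset.sum_congr rfl fun i _ => ?_
    rw [Matrix.mulVec, dotProduct, Int.cast_sum, Finset.mul_sum]
    refine Finset.sum_congr rfl fun j _ => ?_
    push_cast
    ring
  rw [Algebra.smul_def, map_intCast, h, logBracket, Finset.sum_mul]
  refine Finset.sum_congr rfl fun i _ => ?_
  rw [Finset.sum_mul]
  refine Finset.sum_congr rfl fun j _ => ?_
  rw [← eulerDerivation_apply, ← eulerDerivation_apply, eulerDerivation_laurentMonomial,
    eulerDerivation_laurentMonomial]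
  ring

/-- The inclusion of the Laurent polynomials into the rational functions. -/
def laurentHom (K : Type*) [Field K] (Λ : Matrix (Fin n) (Fin n) ℤ) :
    QTorus (1 : Kˣ) Λ →ₐ[K] RationalFunctions K n :=
  QTorus.lift (laurentMonomial K) laurentMonomial_zero
    fun a b => by rw [vpow_one, one_smul, laurentMonomial_add]

@[simp] theorem laurentHom_mono (m : Fin n → ℤ) :
    laurentHom K Λ (QTorus.mono _ _ m) = laurentMonomial K m := QTorus.lift_mono _ _ _ _

theorem laurentHom_injective : Function.Injective (laurentHom K Λ) :=
  QTorus.lift_injective _ _ _ linearIndependent_laurentMonomial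

/-- The bracket with a monomial, in terms of Laurent expansions. -/
theorem logBracket_laurentHom (f : QTorus (1 : Kˣ) Λ) (m : Fin n → ℤ) :
    logBracket K Λ (laurentHom K Λ f) (laurentMonomial K m) =
      laurentHom K Λ (QTorus.diag (fun a => (form Λ a m : K)) f * QTorus.mono _ _ m) := by
  rw [logBracket_eq_hamiltonian]
  induction f using QTorus.induction with
  | add f g hf hg => rw [map_add, map_add, hf, hg, map_add, add_mul, map_add]
  | smul c f hf => rw [map_smul, Derivation.map_smul, hf, map_smul, smul_mul_assoc, map_smul]
  | mono a =>
    rw [← logBracket_eq_hamiltonian, QTorus.diag_mono, smul_mul_assoc, map_smul, map_mul,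
      laurentHom_mono, laurentHom_mono, logBracket_laurentMonomial]

end Bracket

/-! ### Prime spectra of commutative localizations -/

section CommLocalization

variable {R T : Type*} [CommRing R] [CommRing T] {ψ : R →+* T} {S : Submonoid R}

/-- Over the range of `ψ` the kernel is already divided out, so equal images mean equal elements and
only fractions remain to be checked. -/
theorem IsOreQuotient.isLocalization_range (h : IsOreQuotient ψ S) :
    IsLocalization (S.map ψ.rangeRestrict) T where
  map_units := by
    rintro ⟨_, s, hs, rfl⟩
    exact h.isUnit s hs
  surj t := by
    obtain ⟨s, hs, a, e⟩ := h.left t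
    exact ⟨(ψ.rangeRestrict a, ⟨ψ.rangeRestrict s, s, hs, rfl⟩), (mul_comm _ _).trans e⟩
  exists_of_eq e := ⟨1, by rw [Subtype.ext e]⟩

/-- `ψ` factors as a surjection onto its range followed by a localization, and both induce
embeddings of spectra. -/
theorem IsOreQuotient.isEmbedding_comap (h : IsOreQuotient ψ S) :
    Topology.IsEmbedding (PrimeSpectrum.comap ψ) := by
  have := h.isLocalization_range
  exact (PrimeSpectrum.isClosedEmbedding_comap_of_surjective _ ψ.rangeRestrict
    ψ.rangeRestrict_surjective).isEmbedding.comp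
      (PrimeSpectrum.localization_comap_isEmbedding T (S.map ψ.rangeRestrict))

theorem IsOreQuotient.mem_range_comap (h : IsOreQuotient ψ S) {P : PrimeSpectrum R}
    (hker : ∀ a, ψ a = 0 → a ∈ P.asIdeal) (hS : ∀ s ∈ S, s ∉ P.asIdeal) :
    ∃ Q, PrimeSpectrum.comap ψ Q = P := by
  have := h.isLocalization_range
  obtain ⟨P', rfl⟩ : P ∈ Set.range (PrimeSpectrum.comap ψ.rangeRestrict) := by
    rw [range_comap_of_surjective _ _ ψ.rangeRestrict_surjective]
    intro a ha
    exact hker a (congrArg Subtype.val ha)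
  obtain ⟨Q, rfl⟩ : P' ∈ Set.range (PrimeSpectrum.comap (algebraMap ψ.range T)) := by
    rw [PrimeSpectrum.localization_comap_range T (S.map ψ.rangeRestrict)]
    rw [Set.mem_ofPred_eq, Set.disjoint_left]
    rintro _ ⟨s, hs, rfl⟩ hsP
    exact hS s hs hsP
  exact ⟨Q, rfl⟩

end CommLocalization

/-! ### Poisson tori -/

section Torus

variable {K : Type*} [Field K] {j : ℕ} {Λ : Matrix (Fin j) (Fin j) ℤ}

/-- The quantum torus at `v = 1` is the algebra of Laurent polynomials. -/
def QTorus.toLaurent (Λ : Matrix (Fin j) (Fin j) ℤ) :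
    QTorus (1 : Kˣ) Λ →ₐ[K] AddMonoidAlgebra K (Fin j → ℤ) :=
  QTorus.lift (fun m => AddMonoidAlgebra.single m 1) rfl fun a b => by
    rw [AddMonoidAlgebra.single_mul_single, mul_one, vpow_one, one_smul]

@[simp] theorem QTorus.toLaurent_mono (m : Fin j → ℤ) :
    QTorus.toLaurent (K := K) Λ (QTorus.mono _ _ m) = AddMonoidAlgebra.single m 1 :=
  QTorus.lift_mono _ _ _ _

theorem QTorus.coeff_toLaurent (f : QTorus (1 : Kˣ) Λ) : (QTorus.toLaurent Λ f).coeff = f.coeff := by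
  induction f using QTorus.induction with
  | add f g hf hg => rw [map_add, AddMonoidAlgebra.coeff_add, hf, hg, coeff_add]
  | smul c f hf => rw [map_smul, AddMonoidAlgebra.coeff_smul, hf, coeff_smul]
  | mono m => rw [QTorus.toLaurent_mono, AddMonoidAlgebra.coeff_single, QTorus.mono]

theorem QTorus.toLaurent_injective : Function.Injective (QTorus.toLaurent (K := K) Λ) := fun f g e =>
  QTorus.coeff_injective (by rw [← QTorus.coeff_toLaurent, e, QTorus.coeff_toLaurent])

theorem QTorus.toLaurent_surjective : Function.Surjective (QTorus.toLaurent (K := K) Λ) := fun g =>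
  ⟨⟨g.coeff⟩, AddMonoidAlgebra.coeff_injective (QTorus.coeff_toLaurent _)⟩

theorem torusBracket_add_left (f f' g : AddMonoidAlgebra K (Fin j → ℤ)) :
    torusBracket Λ (f + f') g = torusBracket Λ f g + torusBracket Λ f' g := by
  rw [torusBracket, AddMonoidAlgebra.coeff_add, Finsupp.sum_add_index']
  · rfl
  · intro a
    simp
  · intro a b c
    simp only [mul_add, add_mul, AddMonoidAlgebra.single_add, Finsupp.sum_add]

theorem torusBracket_add_right (f g g' : AddMonoidAlgebra K (Fin j → ℤ)) :
    torusBracket Λ f (g + g') = torusBracket Λ f g + torusBracket Λ f g' := by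
  rw [torusBracket, torusBracket, torusBracket, ← Finsupp.sum_add]
  refine Finsupp.sum_congr fun m _ => ?_
  rw [AddMonoidAlgebra.coeff_add, Finsupp.sum_add_index']
  · intro a
    simp
  · intro a b c
    simp only [mul_add, AddMonoidAlgebra.single_add]

theorem torusBracket_single (a b : Fin j → ℤ) (r s : K) :
    torusBracket Λ (AddMonoidAlgebra.single a r) (AddMonoidAlgebra.single b s) =
      AddMonoidAlgebra.single (a + b) ((form Λ a b : K) * r * s) := by
  rw [torusBracket, AddMonoidAlgebra.coeff_single, AddMonoidAlgebra.coeff_single,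
    Finsupp.sum_single_index, Finsupp.sum_single_index]
  · rfl
  · simp
  · simp

theorem torusBracket_toLaurent (f : QTorus (1 : Kˣ) Λ) (m : Fin j → ℤ) (s : K) :
    torusBracket Λ (QTorus.toLaurent Λ f) (AddMonoidAlgebra.single m s) =
      s • QTorus.toLaurent Λ (QTorus.diag (fun a => (form Λ a m : K)) f * QTorus.mono _ _ m) := by
  have key : ∀ g : AddMonoidAlgebra K (Fin j → ℤ), ∀ f : QTorus (1 : Kˣ) Λ, QTorus.toLaurent Λ f = g →
      torusBracket Λ g (AddMonoidAlgebra.single m s) =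
      s • QTorus.toLaurent Λ (QTorus.diag (fun a => (form Λ a m : K)) f * QTorus.mono _ _ m) := by
    intro g
    induction g using AddMonoidAlgebra.induction_linear with
    | zero =>
      intro f hf
      rw [map_eq_zero_iff _ QTorus.toLaurent_injective] at hf
      rw [hf, map_zero, zero_mul, map_zero, smul_zero]
      simp [torusBracket]
    | add g g' hg hg' =>
      intro f hf
      obtain ⟨h, rfl⟩ := QTorus.toLaurent_surjective (Λ := Λ) g
      obtain ⟨h', rfl⟩ := QTorus.toLaurent_surjective (Λ := Λ) g'
      rw [← map_add, QTorus.toLaurent_injective.eq_iff] at hf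
      rw [torusBracket_add_left, hg h rfl, hg' h' rfl, hf, map_add, add_mul, map_add, smul_add]
    | single a r =>
      intro f hf
      have : f = r • QTorus.mono _ _ a := by
        apply QTorus.toLaurent_injective
        rw [hf, map_smul, QTorus.toLaurent_mono]
        simp
      rw [this, torusBracket_single, map_smul, QTorus.diag_mono, smul_mul_assoc, smul_mul_assoc,
        map_smul, map_smul, map_mul, QTorus.toLaurent_mono, QTorus.toLaurent_mono,
        AddMonoidAlgebra.single_mul_single]
      simp only [AddMonoidAlgebra.smul_single, smul_eq_mul, mul_one]
      congr 1
      ring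
  exact key _ f rfl

theorem form_eq_sum (a m : Fin j → ℤ) : form Λ a m = ∑ i, m i * form Λ a (unitVec i) := by
  rw [form, Matrix.dotProduct_mulVec, dotProduct]
  refine Finset.sum_congr rfl fun i _ => ?_
  rw [form, Matrix.dotProduct_mulVec, unitVec, dotProduct_single_one, mul_comm]

/-- Prime ideals of the Poisson torus are Poisson if and only if they are stable under the
derivations `x_i⁻¹ {·, x_i}`. -/
theorem mem_torusPoissonSpec_iff (hΛ : Λᵀ = -Λ) (Q : PrimeSpectrum (AddMonoidAlgebra K (Fin j → ℤ))) :
    Q ∈ torusPoissonSpec K Λ ↔ ∀ (i : Fin j) (f : QTorus (1 : Kˣ) Λ),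
      QTorus.toLaurent Λ f ∈ Q.asIdeal →
      QTorus.toLaurent Λ (QTorus.diag (fun a => (form Λ a (unitVec i) : K)) f) ∈ Q.asIdeal := by
  constructor
  · intro hQ i f hf
    have h := hQ _ hf (AddMonoidAlgebra.single (unitVec i) 1)
    -- The bracket with `x_i` is the diagonal derivation times the unit `x_i`, and a prime ideal
    -- contains no unit.
    rw [torusBracket_toLaurent, one_smul, map_mul] at h
    refine (Q.2.mem_or_mem h).resolve_right fun h' => ?_
    refine Q.2.ne_top (Ideal.eq_top_of_isUnit_mem _ h' ?_)
    have := QTorus.isUnit_mono (v := (1 : Kˣ)) (unitVec i) one_ne_zero hΛ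
    rw [one_smul] at this
    exact this.map (QTorus.toLaurent Λ)
  · intro h g hg g'
    obtain ⟨f, rfl⟩ := QTorus.toLaurent_surjective (Λ := Λ) g
    induction g' using AddMonoidAlgebra.induction_linear with
    | zero => simp [torusBracket]
    | add a b ha hb =>
      rw [torusBracket_add_right]
      exact Ideal.add_mem _ ha hb
    | single m s =>
      rw [torusBracket_toLaurent, map_mul]
      refine Submodule.smul_of_tower_mem _ s (Ideal.mul_mem_right _ _ ?_)
      -- `Λ(a, m)` is additive in `m`, so the operator for `m` is an integral combination of those
      -- for unit vectors.
      have : QTorus.diag (fun a => (form Λ a m : K)) f =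
          ∑ i, (m i : K) • QTorus.diag (fun a => (form Λ a (unitVec i) : K)) f := by
        ext1
        ext a
        have hsum : ∀ g : Fin j → QTorus (1 : Kˣ) Λ, (∑ i, g i).coeff a = ∑ i, (g i).coeff a := fun g =>
          (DFunLike.congr_fun (map_sum QTorus.coeffHom g Finset.univ) a).trans
            (Finsupp.finsetSum_apply _ _ _)
        rw [hsum, QTorus.coeff_diag, form_eq_sum, Int.cast_sum, Finset.sum_mul]
        refine Finset.sum_congr rfl fun i _ => ?_
        rw [QTorus.coeff_smul, Finsupp.smul_apply, QTorus.coeff_diag, smul_eq_mul, Int.cast_mul,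
          mul_assoc]
      rw [this, map_sum]
      refine Ideal.sum_mem _ fun i _ => ?_
      rw [map_smul]
      exact Submodule.smul_of_tower_mem _ _ (h i f hg)

end Torus

/-! ### Strata of Poisson algebras of Laurent polynomials -/

section Poisson

variable {K : Type*} [Field K] {n : ℕ} {ex : Finset (Fin n)} {B : Matrix ex (Fin n) ℤ}
  {Λ : Matrix (Fin n) (Fin n) ℤ} {j : ℕ} {A : Type*} [CommRing A] [Algebra K A]
  {ι : A →ₐ[K] QTorus (1 : Kˣ) Λ} {x : Fin n → A} {br : A → A → A}

/-- The log-canonical bracket on an algebra of Laurent polynomials. -/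
structure IsLogBracket (ι : A →ₐ[K] QTorus (1 : Kˣ) Λ) (br : A → A → A) : Prop where
  swap : ∀ a b, br b a = -br a b
  add_left : ∀ a b c, br (a + b) c = br a c + br b c
  smul_left : ∀ (r : K) a b, br (r • a) b = r • br a b
  mul_left : ∀ a b c, br (a * b) c = a * br b c + b * br a c
  map_mono : ∀ (a p : A) (m : Fin n → ℤ), ι p = QTorus.mono _ _ m →
    ι (br a p) = QTorus.diag (fun a => (form Λ a m : K)) (ι a) * QTorus.mono _ _ m

/-- Poisson ideals for the bracket `br`. -/
def IsBracketStable (br : A → A → A) (P : Ideal A) : Prop := ∀ a ∈ P, ∀ b, br a b ∈ P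

namespace IsLogBracket

variable (hb : IsLogBracket ι br)
include hb

theorem add_right (a b c : A) : br a (b + c) = br a b + br a c := by
  rw [hb.swap, hb.add_left, hb.swap a b, hb.swap a c]
  abel

theorem smul_right (r : K) (a b : A) : br a (r • b) = r • br a b := by
  rw [hb.swap, hb.smul_left, hb.swap a b, smul_neg, neg_neg]

theorem mul_right (a b c : A) : br a (b * c) = b * br a c + c * br a b := by
  rw [hb.swap, hb.mul_left, hb.swap a b, hb.swap a c]
  ring

theorem sub_right (a b c : A) : br a (b - c) = br a b - br a c := by
  have := hb.add_right a (b - c) c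
  rw [sub_add_cancel] at this
  rw [this, add_sub_cancel_right]

theorem sub_left (a b c : A) : br (a - b) c = br a c - br b c := by
  rw [hb.swap, hb.sub_right, hb.swap c a, hb.swap c b]
  ring

end IsLogBracket

theorem isCompletelyPrime_toTwoSided {P : Ideal A} (hP : P.IsPrime) :
    IsCompletelyPrime P.toTwoSided := fun a b h => by
  rw [Ideal.mem_toTwoSided] at h
  rw [Ideal.mem_toTwoSided, Ideal.mem_toTwoSided]
  exact hP.mem_or_mem h

theorem one_notMem_toTwoSided {P : Ideal A} (hP : P.IsPrime) : (1 : A) ∉ P.toTwoSided := fun h =>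
  hP.ne_top ((Ideal.eq_top_iff_one P).2 (Ideal.mem_toTwoSided.1 h))

/-- The bracket of a polynomial `a` with `x i` equals `b * x i`, where `b` arises from `a` by the
factors `Λ(m, e_i)`; primality cancels `x i`. In characteristic `0` these integers are determined by
their images in `K`. -/
theorem IsLogBracket.isFormStable [CharZero K] (hb : IsLogBracket ι br) (h : IsLaurentAlgebra ι x)
    (hΛ : Λᵀ = -Λ) {P : Ideal A} (hP : P.IsPrime) (hPo : IsBracketStable br P)
    (hx : ∀ i : Fin n, (i : ℕ) < j → x i ∉ P) : IsFormStable ι j P.toTwoSided := by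
  refine ⟨{χ | ∃ i : Fin n, (i : ℕ) < j ∧ χ = fun m => (form Λ m (unitVec i) : K)}, ?_, ?_⟩
  · intro m m' e i hi
    have := e _ ⟨i, hi, rfl⟩
    rw [Int.cast_inj] at this
    rw [form_swap hΛ, this, ← form_swap hΛ]
  · rintro _ ⟨i, hi, rfl⟩ a ha hap
    obtain ⟨b, hb'⟩ := h.exists_of_mem (QTorus.diag_mem_sp (fun m => (form Λ m (unitVec i) : K)) hap)
    refine ⟨b, Ideal.mem_toTwoSided.2 ((hP.mem_or_mem ?_).resolve_right (hx i hi)), hb'⟩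
    have : br a (x i) = b * x i := by
      apply h.injective
      rw [hb.map_mono a _ _ (h.map_var i), map_mul, hb', h.map_var]
    exact this ▸ hPo a (Ideal.mem_toTwoSided.1 ha) _

theorem QTorus.mul_comm_of_one (f g : QTorus (1 : Kˣ) Λ) : f * g = g * f := by
  induction f using QTorus.induction with
  | add f f' hf hf' => rw [add_mul, mul_add, hf, hf']
  | smul c f hf => rw [smul_mul_assoc, mul_smul_comm, hf]
  | mono a =>
  induction g using QTorus.induction with
  | add f f' hf hf' => rw [add_mul, mul_add, hf, hf']
  | smul c f hf => rw [smul_mul_assoc, mul_smul_comm, hf]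
  | mono b => rw [QTorus.mono_mul, QTorus.mono_mul, vpow_one, vpow_one, add_comm]

/-- For polynomials the identity can be read off from Laurent expansions. In general `s * a ≡ c`
modulo the Poisson ideal `J` with a monomial `s` and a polynomial `c`, and the Leibniz rule on both
sides leaves `ψ s` times the desired difference. -/
theorem IsResidue.map_bracket {J : Ideal A} {ψ : A →ₐ[K] QTorus (1 : Kˣ) Λ}
    (hψ : IsResidue ι j J.toTwoSided ψ) (h : IsLaurentAlgebra ι x) (hb : IsLogBracket ι br)
    (hJ : IsBracketStable br J) {i : Fin n} (hi : (i : ℕ) < j) (a : A) :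
    ψ (br a (x i)) = QTorus.diag (fun a => (form Λ a (unitVec i) : K)) (ψ a) *
      QTorus.mono _ _ (unitVec i) := by
  set D : QTorus (1 : Kˣ) Λ →ₗ[K] QTorus (1 : Kˣ) Λ :=
    QTorus.diag fun a => (form Λ a (unitVec i) : K) with hD
  have hDmul : ∀ f g, D (f * g) = D f * g + f * D g :=
    QTorus.diag_mul_of_add fun a b => by rw [form_add_left, Int.cast_add]
  have hpoly : ∀ p, ι p ∈ sp K (QTorus.mono (1 : Kˣ) Λ) (nonnegExponents n j) →
      ψ (br p (x i)) = D (ψ p) * QTorus.mono _ _ (unitVec i) := by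
    intro p hp
    have h1 := hb.map_mono p _ _ (h.map_var i)
    rw [hψ.eq p hp, hψ.eq (br p (x i)), h1]
    rw [h1]
    refine QTorus.mem_sp_mono.2 fun m hm => ?_
    have hm' := QTorus.mem_sp_mono.1 (QTorus.diag_mem_sp _ hp) (QTorus.mem_support_mul_mono.1 hm)
    have hu := unitVec_mem_nonnegExponents hi
    rw [← sub_add_cancel m (unitVec i)]
    exact ⟨fun l hl => by rw [Pi.add_apply, hm'.1 l hl, hu.1 l hl, add_zero], add_nonneg hm'.2 hu.2⟩
  obtain ⟨u, hu, s, c, hs, hs', hc, hc', hm⟩ := hψ.exists_clear' h a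
  have hsp : ι s ∈ sp K (QTorus.mono (1 : Kˣ) Λ) (nonnegExponents n j) := hs ▸ mem_sp hu
  have h0 : br (s * a - c) (x i) ∈ J := hJ _ (Ideal.mem_toTwoSided.1 hm) _
  rw [← Ideal.mem_toTwoSided, ← hψ.ker, hb.sub_left, hb.mul_left, map_sub, map_add, map_mul, map_mul,
    hpoly s hsp, hpoly c hc', hψ.eq c hc', hc, ← hs', hDmul] at h0
  have h1 : ψ s * (ψ (br a (x i)) - D (ψ a) * QTorus.mono _ _ (unitVec i)) = 0 := by
    rw [← h0, QTorus.mul_comm_of_one (ψ a)]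
    simp only [mul_sub, add_mul, mul_assoc]
    rw [QTorus.mul_comm_of_one (ψ a)]
    abel
  exact sub_eq_zero.1 ((mul_eq_zero.1 h1).resolve_left (hs' ▸ QTorus.mono_ne_zero u))

/-- The bracket is a derivation in its second argument, so the elements whose bracket maps `P` into
`P` are closed under products and linear combinations; the variables suffice. -/
theorem IsLogBracket.mem_of_poly (hb : IsLogBracket ι br) (h : IsLaurentAlgebra ι x) {P : Ideal A}
    (hP : ∀ i : Fin n, (i : ℕ) < j → ∀ a ∈ P, br a (x i) ∈ P)
    (hone : ∀ a ∈ P, br a 1 ∈ P) {p : A}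
    (hp : ι p ∈ sp K (QTorus.mono (1 : Kˣ) Λ) (nonnegExponents n j)) {a : A} (ha : a ∈ P) :
    br a p ∈ P := by
  let S : AddSubmonoid (Fin n → ℤ) :=
    { carrier := {m | ∃ p, ι p = QTorus.mono _ _ m ∧ ∀ a ∈ P, br a p ∈ P}
      zero_mem' := ⟨1, by rw [map_one, QTorus.mono_zero], hone⟩
      add_mem' := by
        rintro m m' ⟨p, hp, hp'⟩ ⟨q, hq, hq'⟩
        refine ⟨p * q, by rw [map_mul, hp, hq, QTorus.mono_mul, vpow_one, one_smul], fun a ha => ?_⟩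
        rw [hb.mul_right]
        exact P.add_mem (P.mul_mem_left _ (hq' a ha)) (P.mul_mem_left _ (hp' a ha)) }
  let W : Submodule K (QTorus (1 : Kˣ) Λ) :=
    { carrier := {f | ∃ p, ι p = f ∧ ∀ a ∈ P, br a p ∈ P}
      zero_mem' := ⟨0, map_zero _, fun a _ => by
        have := hb.smul_right 0 a 0
        rw [zero_smul, zero_smul] at this
        rw [this]
        exact P.zero_mem⟩
      add_mem' := by
        rintro _ _ ⟨p, rfl, hp⟩ ⟨q, rfl, hq⟩
        exact ⟨p + q, map_add _ _ _, fun a ha => hb.add_right a p q ▸ P.add_mem (hp a ha) (hq a ha)⟩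
      smul_mem' := by
        rintro c _ ⟨p, rfl, hp⟩
        exact ⟨c • p, map_smul _ _ _, fun a ha => hb.smul_right c a p ▸
          Submodule.smul_of_tower_mem P c (hp a ha)⟩ }
  have hle : sp K (QTorus.mono (1 : Kˣ) Λ) (nonnegExponents n j) ≤ W := by
    rw [sp_le]
    intro m hm
    exact mem_of_nonneg S (fun i hi => ⟨x i, h.map_var i, hP i hi⟩) hm
  obtain ⟨q, hq, hq'⟩ := hle hp
  rw [← h.injective hq]
  exact hq' a ha

theorem QTorus.embed_diag (hj : j ≤ n) (χ : (Fin n → ℤ) → K) {v : Kˣ}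
    (f : QTorus v (principal Λ j hj)) : QTorus.embed v Λ hj
      (QTorus.diag (fun m => χ (QTorus.extendZero hj m)) f) = QTorus.diag χ (QTorus.embed v Λ hj f) := by
  induction f using QTorus.induction with
  | add f g hf hg => simp only [map_add, hf, hg]
  | smul c f hf => simp only [map_smul, hf]
  | mono m => rw [QTorus.diag_mono, map_smul, QTorus.embed_mono, QTorus.diag_mono]

theorem IsResidue.restrict_bracket {J : Ideal A} {ψ : A →ₐ[K] QTorus (1 : Kˣ) Λ}
    (hψ : IsResidue ι j J.toTwoSided ψ) (hj : j ≤ n) (h : IsLaurentAlgebra ι x)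
    (hb : IsLogBracket ι br) (hJ : IsBracketStable br J) (i : Fin j) (a : A) :
    hψ.restrict hj (br a (x (Fin.castLE hj i))) =
      QTorus.diag (fun a => (form (principal Λ j hj) a (unitVec i) : K)) (hψ.restrict hj a) *
        QTorus.mono _ _ (unitVec i) := by
  apply QTorus.embed_injective hj
  rw [hψ.embed_restrict, hψ.map_bracket h hb hJ i.2, map_mul, QTorus.embed_mono, unitVec,
    extendZero_single, ← hψ.embed_restrict hj a, ← QTorus.embed_diag]
  simp only [QTorus.form_principal, extendZero_single]

/-- The residue map modulo `J`, as a map to the algebra of Laurent polynomials. -/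
def IsResidue.toLaurent {J : TwoSidedIdeal A} {ψ : A →ₐ[K] QTorus (1 : Kˣ) Λ}
    (hψ : IsResidue ι j J ψ) (hj : j ≤ n) : A →+* AddMonoidAlgebra K (Fin j → ℤ) :=
  ((QTorus.toLaurent (principal Λ j hj)).comp (hψ.restrict hj) : A →ₐ[K] _)

theorem IsResidue.toLaurent_apply {J : TwoSidedIdeal A} {ψ : A →ₐ[K] QTorus (1 : Kˣ) Λ}
    (hψ : IsResidue ι j J ψ) (hj : j ≤ n) (a : A) :
    hψ.toLaurent hj a = QTorus.toLaurent _ (hψ.restrict hj a) := rfl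

theorem IsResidue.isOreQuotient_toLaurent {J : TwoSidedIdeal A} {ψ : A →ₐ[K] QTorus (1 : Kˣ) Λ}
    (hψ : IsResidue ι j J ψ) (hj : j ≤ n) (h : IsLaurentAlgebra ι x) (hΛ : Λᵀ = -Λ) :
    IsOreQuotient (hψ.toLaurent hj) (monomials ι j) := by
  have H := hψ.isOreQuotient hj h hΛ
  have hleft : ∀ t, ∃ s ∈ monomials ι j, ∃ a, hψ.toLaurent hj s * t = hψ.toLaurent hj a := by
    intro t
    obtain ⟨f, rfl⟩ := QTorus.toLaurent_surjective (Λ := principal Λ j hj) t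
    obtain ⟨s, hs, a, e⟩ := H.left f
    exact ⟨s, hs, a, (map_mul (QTorus.toLaurent _) _ _).symm.trans (congrArg (QTorus.toLaurent _) e)⟩
  exact
  { isUnit := fun s hs => (H.isUnit s hs).map (QTorus.toLaurent (principal Λ j hj))
    left := hleft
    right := fun t => by
      obtain ⟨s, hs, a, e⟩ := hleft t
      exact ⟨s, hs, a, (mul_comm _ _).trans e⟩ }

/-- Contractions of Poisson prime ideals are Poisson, and conversely. -/
theorem IsResidue.comap_isBracketStable_iff {J : Ideal A} {ψ : A →ₐ[K] QTorus (1 : Kˣ) Λ}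
    (hψ : IsResidue ι j J.toTwoSided ψ) (hj : j ≤ n) (h : IsLaurentAlgebra ι x) (hΛ : Λᵀ = -Λ)
    (hb : IsLogBracket ι br) (hJ : IsBracketStable br J)
    (Q : PrimeSpectrum (AddMonoidAlgebra K (Fin j → ℤ))) :
    IsBracketStable br (PrimeSpectrum.comap (hψ.toLaurent hj) Q).asIdeal ↔
      Q ∈ torusPoissonSpec K (principal Λ j hj) := by
  have H := hψ.isOreQuotient_toLaurent hj h hΛ
  have hmem : ∀ a, a ∈ (PrimeSpectrum.comap (hψ.toLaurent hj) Q).asIdeal ↔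
      QTorus.toLaurent _ (hψ.restrict hj a) ∈ Q.asIdeal := fun a => Iff.rfl
  have hprime := (PrimeSpectrum.comap (hψ.toLaurent hj) Q).2
  have hunit : ∀ s ∈ monomials ι j, hψ.toLaurent hj s ∉ Q.asIdeal := fun s hs hsQ =>
    Q.2.ne_top (Ideal.eq_top_of_isUnit_mem _ hsQ (H.isUnit s hs))
  rw [mem_torusPoissonSpec_iff (principal_skew hj hΛ)]
  generalize hP : (PrimeSpectrum.comap (hψ.toLaurent hj) Q).asIdeal = P at hmem hprime ⊢
  have hvar : ∀ i : Fin n, (i : ℕ) < j → x i ∈ monomials ι j := fun i hi =>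
    mem_monomials (unitVec_mem_nonnegExponents hi) (h.map_var i)
  constructor
  · intro hPo i f hf
    obtain ⟨s, hs, a, e⟩ := H.left (QTorus.toLaurent _ f)
    have e' : hψ.restrict hj s * f = hψ.restrict hj a :=
      QTorus.toLaurent_injective ((map_mul (QTorus.toLaurent _) _ _).trans e)
    have ha : a ∈ P := by
      rw [hmem, ← e', map_mul]
      exact Ideal.mul_mem_left _ _ hf
    have h1 := (hmem _).1 (hPo a ha (x (Fin.castLE hj i)))
    rw [hψ.restrict_bracket hj h hb hJ, map_mul] at h1
    have h2 : QTorus.toLaurent (K := K) (principal Λ j hj) (QTorus.mono _ _ (unitVec i)) ∉ Q.asIdeal := by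
      have e2 : hψ.restrict hj (x (Fin.castLE hj i)) = QTorus.mono _ _ (unitVec i) := by
        apply QTorus.embed_injective hj
        rw [hψ.embed_restrict, QTorus.embed_mono, hψ.eq, h.map_var, unitVec, unitVec,
          extendZero_single, unitVec]
        rw [h.map_var]
        exact mem_sp (unitVec_mem_nonnegExponents i.2)
      rw [← e2]
      exact hunit _ (hvar _ i.2)
    have h3 := (Q.2.mem_or_mem h1).resolve_right h2
    -- With `s * f` equal to the residue of `a`, the derivation of `s` times `f` lies in `Q`
    -- already, so `s` times the derivation of `f` does too, and `s` is a unit.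
    rw [← e', QTorus.diag_mul_of_add fun a b => by rw [form_add_left, Int.cast_add], map_add, map_mul,
      map_mul, Ideal.add_mem_iff_right _ (Ideal.mul_mem_left _ _ hf)] at h3
    exact (Q.2.mem_or_mem h3).resolve_left (hunit s hs)
  · intro hQ a ha b
    have hJP : ∀ c ∈ J, c ∈ P := fun c hc => by
      rw [hmem, (hψ.restrict_eq_zero hj).2 (Ideal.mem_toTwoSided.2 hc), map_zero]
      exact Q.asIdeal.zero_mem
    have hPx : ∀ i : Fin n, (i : ℕ) < j → ∀ a ∈ P, br a (x i) ∈ P := by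
      intro i hi a ha
      have := hψ.restrict_bracket hj h hb hJ ⟨i, hi⟩ a
      rw [hmem]
      rw [show Fin.castLE hj ⟨i, hi⟩ = i from rfl] at this
      rw [this, map_mul]
      exact Ideal.mul_mem_right _ _ (hQ _ _ ((hmem a).1 ha))
    have hone : ∀ a ∈ P, br a 1 ∈ P := fun a _ => by
      have := hb.mul_right a 1 1
      rw [one_mul, one_mul, left_eq_add] at this
      rw [this]
      exact P.zero_mem
    obtain ⟨u, hu, s, c, hs, -, -, hc, hm⟩ := hψ.exists_clear' h b
    have h1 : br a (s * b - c) ∈ P := by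
      rw [hb.swap]
      exact P.neg_mem (hJP _ (hJ _ (Ideal.mem_toTwoSided.1 hm) _))
    have h2 := hb.mem_of_poly h hPx hone hc ha
    have h3 := hb.mem_of_poly h hPx hone (hs ▸ mem_sp hu : ι s ∈ _) ha
    -- `s * b` is a polynomial plus an element of the Poisson ideal `J ≤ P`, so its bracket with `a`
    -- is under control, and so is the bracket of `a` with `s`.
    have h4 : s * br a b ∈ P := by
      have : s * br a b = br a (s * b - c) + br a c - b * br a s := by
        rw [hb.sub_right, hb.mul_right]
        ring
      rw [this]
      exact P.sub_mem (P.add_mem h1 h2) (P.mul_mem_left _ h3)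
    refine (hprime.mem_or_mem h4).resolve_left fun hsP => ?_
    exact hunit s (mem_monomials hu hs) ((hmem s).1 hsP)

end Poisson

/-! ### Poisson strata as Poisson spectra of tori -/

section PoissonStratum

variable {K : Type*} [Field K] [CharZero K] {n : ℕ} {ex : Finset (Fin n)} {B : Matrix ex (Fin n) ℤ}
  {Λ : Matrix (Fin n) (Fin n) ℤ} {j : ℕ} {A : Type*} [CommRing A] [Algebra K A]
  {ι : A →ₐ[K] QTorus (1 : Kˣ) Λ} {x : Fin n → A} {br : A → A → A} {Tor : Ideal A → Prop}

/-- Stability of ideals under toric actions. -/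
structure IsToricPredicate (ι : A →ₐ[K] QTorus (1 : Kˣ) Λ) (B : Matrix ex (Fin n) ℤ)
    (x : Fin n → A) (Tor : Ideal A → Prop) : Prop where
  isScaleStable : ∀ I, Tor I → IsScaleStable ι B (idealSubmodule K I.toTwoSided)
  span : ∀ i, Tor (Ideal.span {x i})

/-- The Poisson prime ideals `P` such that `J` is the largest toric ideal contained in `P`. -/
def bracketStratum (br : A → A → A) (Tor : Ideal A → Prop) (J : Ideal A) : Set (PrimeSpectrum A) :=
  {P | IsBracketStable br P.asIdeal ∧ IsGreatest {I | Tor I ∧ I ≤ P.asIdeal} J}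

variable (h : IsLaurentAlgebra ι x) (hs : IsSuperToric B Λ) (hΛ : Λᵀ = -Λ)
  (hb : IsLogBracket ι br) (hT : IsToricPredicate ι B x Tor)

include h hs hΛ hb hT

theorem IsLogBracket.polyFree (hj : j ≤ n) {J : Ideal A} (hJ : J.IsPrime)
    (hJb : IsBracketStable br J) (hJt : Tor J) (hx : ∀ i : Fin n, (i : ℕ) < j → x i ∉ J) :
    PolyFree ι j J.toTwoSided :=
  h.polyFree hs hΛ hj (hT.isScaleStable J hJt) (isCompletelyPrime_toTwoSided hJ)
    (one_notMem_toTwoSided hJ) (fun i hi => by simpa using hx i hi)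
    (hb.isFormStable h hΛ hJ hJb hx)

theorem mem_bracketStratum_iff (hj : j ≤ n) {J : Ideal A} {ψ : A →ₐ[K] QTorus (1 : Kˣ) Λ}
    (hψ : IsResidue ι j J.toTwoSided ψ) (hJ : J.IsPrime) (hJb : IsBracketStable br J)
    (hJt : Tor J) (hx : ∀ i : Fin n, (i : ℕ) < j → x i ∉ J) (P : PrimeSpectrum A) :
    P ∈ bracketStratum br Tor J ↔ IsBracketStable br P.asIdeal ∧ J ≤ P.asIdeal ∧
        ∀ i : Fin n, (i : ℕ) < j → x i ∉ P.asIdeal := by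
  refine and_congr_right fun hP => ?_
  constructor
  · rintro ⟨⟨-, hJP⟩, hmax⟩
    refine ⟨hJP, fun i hi hiP => hx i hi ?_⟩
    refine hmax ⟨hT.span i, ?_⟩ (Ideal.mem_span_singleton_self _)
    rwa [Ideal.span_le, Set.singleton_subset_iff]
  · rintro ⟨hJP, hxP⟩
    refine ⟨⟨hJt, hJP⟩, fun I ⟨hI, hIP⟩ a ha => ?_⟩
    have := hψ.mem_of_stable h hs hΛ hj (hT.isScaleStable J hJt) (isCompletelyPrime_toTwoSided hJ)
      (hb.polyFree h hs hΛ hT hj hJ hJb hJt hx) (P := P.asIdeal.toTwoSided)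
      (fun b hb => Ideal.mem_toTwoSided.2 (hJP (Ideal.mem_toTwoSided.1 hb)))
      (isCompletelyPrime_toTwoSided P.2) (one_notMem_toTwoSided P.2)
      (fun i hi => by simpa using hxP i hi) (hb.isFormStable h hΛ P.2 hP hxP)
      (hT.isScaleStable I hI) (fun b a ha => TwoSidedIdeal.mul_mem_left I.toTwoSided b a ha)
      (fun b hb => Ideal.mem_toTwoSided.2 (hIP (Ideal.mem_toTwoSided.1 hb)))
      (Ideal.mem_toTwoSided.2 ha)
    exact Ideal.mem_toTwoSided.1 this

/-- Primes of the torus correspond to primes of `A` that contain `J` and no monomial, equivalently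
none of the first `j` variables; `IsResidue.comap_isBracketStable_iff` matches the Poisson
conditions. -/
theorem IsResidue.image_torusPoissonSpec (hj : j ≤ n) {J : Ideal A}
    {ψ : A →ₐ[K] QTorus (1 : Kˣ) Λ} (hψ : IsResidue ι j J.toTwoSided ψ) (hJ : J.IsPrime)
    (hJb : IsBracketStable br J) (hJt : Tor J) (hx : ∀ i : Fin n, (i : ℕ) < j → x i ∉ J) :
    PrimeSpectrum.comap (hψ.toLaurent hj) '' torusPoissonSpec K (principal Λ j hj) =
      bracketStratum br Tor J := by
  have H := hψ.isOreQuotient_toLaurent hj h hΛ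
  have hker : ∀ a, hψ.toLaurent hj a = 0 ↔ a ∈ J := fun a => by
    rw [hψ.toLaurent_apply, map_eq_zero_iff _ QTorus.toLaurent_injective, hψ.restrict_eq_zero,
      Ideal.mem_toTwoSided]
  ext P
  rw [mem_bracketStratum_iff h hs hΛ hb hT hj hψ hJ hJb hJt hx]
  constructor
  · rintro ⟨Q, hQ, rfl⟩
    refine ⟨(hψ.comap_isBracketStable_iff hj h hΛ hb hJb Q).2 hQ, fun a ha => ?_, fun i hi hiQ => ?_⟩
    · rw [PrimeSpectrum.comap_asIdeal, Ideal.mem_comap, (hker a).2 ha]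
      exact Q.asIdeal.zero_mem
    · exact Q.2.ne_top (Ideal.eq_top_of_isUnit_mem _ hiQ
        (H.isUnit _ (mem_monomials (unitVec_mem_nonnegExponents hi) (h.map_var i))))
  · rintro ⟨hP, hJP, hxP⟩
    obtain ⟨Q, rfl⟩ := H.mem_range_comap (P := P) (fun a ha => hJP ((hker a).1 ha))
      (fun s hs hsP => (h.notMem_of_mem_monomials (P := P.asIdeal.toTwoSided)
        (isCompletelyPrime_toTwoSided P.2) (one_notMem_toTwoSided P.2)).2
          (fun i hi => by simpa using hxP i hi) s hs (Ideal.mem_toTwoSided.2 hsP))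
    exact ⟨Q, (hψ.comap_isBracketStable_iff hj h hΛ hb hJb Q).1 hP, rfl⟩

theorem nonempty_bracketStratum_homeomorph {r : ℕ} (hr : r ≤ n)
    {I : ℕ → Ideal A} (hprime : ∀ k, n < k + r → k ≤ n → (I k).IsPrime)
    (hbr : ∀ k, n < k + r → k ≤ n → IsBracketStable br (I k))
    (htor : ∀ k, n < k + r → k ≤ n → Tor (I k))
    (hmem : ∀ k, n < k + r → k ≤ n → ∀ i : Fin n, x i ∈ I k ↔ k ≤ (i : ℕ) + 1)
    (hle : ∀ k, n < k + r → k + 1 ≤ n → I (k + 1) ≤ I k) {k : ℕ} (hkr : n < k + r) (hk : k ≤ n) :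
    Nonempty (bracketStratum br Tor (I k) ≃ₜ
      torusPoissonSpec K (principal Λ (k - 1) ((Nat.sub_le k 1).trans hk))) := by
  obtain ⟨j, rfl⟩ : ∃ j, k = j + 1 := ⟨k - 1, by omega⟩
  have hx : ∀ j, n - r ≤ j → j < n → ∀ i : Fin n, (i : ℕ) < j → x i ∉ I (j + 1) :=
    fun j h1 h2 i hi => by
      rw [hmem (j + 1) (by omega) h2]
      omega
  obtain ⟨ψ, hψ⟩ := h.exists_isResidue (fun j => (I (j + 1)).toTwoSided) (j₀ := n - r)
    (Nat.sub_le _ _)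
    (fun j h1 h2 => isCompletelyPrime_toTwoSided (hprime (j + 1) (by omega) h2))
    (fun j h1 h2 => hb.polyFree h hs hΛ hT h2.le (hprime (j + 1) (by omega) h2)
      (hbr (j + 1) (by omega) h2) (htor (j + 1) (by omega) h2) (hx j h1 h2))
    (fun j h1 h2 => Ideal.mem_toTwoSided.2 ((hmem (j + 1) (by omega) h2 _).2 le_rfl))
    (fun j h1 h2 a ha => Ideal.mem_toTwoSided.2
      (hle (j + 1) (by omega) h2 (Ideal.mem_toTwoSided.1 ha))) j (by omega) hk
  have e := hψ.image_torusPoissonSpec h hs hΛ hb hT (Nat.le_of_succ_le hk) (hprime _ hkr hk)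
    (hbr _ hkr hk) (htor _ hkr hk) (hx j (by omega) hk)
  have H := hψ.isOreQuotient_toLaurent (Nat.le_of_succ_le hk) h hΛ
  exact ⟨((H.isEmbedding_comap.homeomorphImage _).trans (Homeomorph.setCongr e)).symm⟩

end PoissonStratum

/-! ### Expansions -/

section Expansion

variable {K : Type*} [Field K] {F : Type*} [Ring F] [Algebra K F] {n : ℕ} {v : Kˣ}
  {Λ : Matrix (Fin n) (Fin n) ℤ} (L : QTorus v Λ →ₐ[K] F) (hL : Function.Injective L)
  {A : Subalgebra K F} (hA : A ≤ L.range)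

/-- The inverse of an embedding of the quantum torus, on a subalgebra of its image. -/
def QTorus.expand : A →ₐ[K] QTorus v Λ :=
  (AlgEquiv.ofInjective L hL).symm.toAlgHom.comp (Subalgebra.inclusion hA)

theorem QTorus.map_expand (a : A) : L (QTorus.expand L hL hA a) = a :=
  congrArg Subtype.val ((AlgEquiv.ofInjective L hL).apply_symm_apply (Subalgebra.inclusion hA a))

theorem QTorus.isLaurentAlgebra_expand {x : Fin n → A}
    (hx : ∀ i, L (QTorus.mono v Λ (unitVec i)) = x i) :
    IsLaurentAlgebra (QTorus.expand L hL hA) x where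
  injective a b e := by
    ext
    rw [← QTorus.map_expand L hL hA a, e, QTorus.map_expand]
  map_var i := by
    apply hL
    rw [QTorus.map_expand, hx]

theorem QTorus.map_eq_map_diag {L : QTorus v Λ →ₐ[K] F} {φ : F →ₐ[K] F} {χ : (Fin n → ℤ) → K}
    (hφ : ∀ m, φ (L (QTorus.mono v Λ m)) = χ m • L (QTorus.mono v Λ m)) (f : QTorus v Λ) :
    φ (L f) = L (QTorus.diag χ f) := by
  induction f using QTorus.induction with
  | add f g hf hg => simp only [map_add, hf, hg]
  | smul c f hf => simp only [map_smul, hf]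
  | mono m => rw [QTorus.diag_mono, map_smul, hφ]

/-- By the Laurent phenomenon the Laurent monomials of the seed span a space that contains the
algebra. -/
theorem QSeed.IsGood.algebra_le_range_of_mono {F : Type*} [DivisionRing F] [Algebra K F]
    {ex : Finset (Fin n)} {d : ex → ℤ} {s : QSeed F ex} (h : s.IsGood v d) {R : Subalgebra K F}
    (hm : ∀ m, toricFrame v s.Λ s.X m ∈ R) : s.algebra v ≤ R := by
  refine h.algebra_le_range.trans ?_
  rintro _ ⟨f, rfl⟩
  change h.torusHom f ∈ R
  induction f using QTorus.induction with
  | add f g hf hg => rw [map_add]; exact add_mem hf hg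
  | smul c f hf => rw [map_smul]; exact Subalgebra.smul_mem _ hf c
  | mono m => rw [h.torusHom_mono]; exact hm m

end Expansion

/-! ### Strata of Poisson cluster algebras -/

section Poisson

variable {K : Type*} [Field K] {n : ℕ} {ex : Finset (Fin n)} {B : Matrix ex (Fin n) ℤ}
  {Λ : Matrix (Fin n) (Fin n) ℤ} {d : ex → ℤ}

theorem clusterAlgebra_le_range (hc : IsCompat B Λ d) :
    clusterAlgebra K B ≤ (laurentHom K Λ).range := by
  have h := Seed.init_isGood (K := K) hc
  rw [clusterAlgebra_eq h]
  refine h.algebra_le_range_of_mono fun m => ⟨QTorus.mono _ _ m, ?_⟩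
  exact (laurentHom_mono m).trans (toricFrame_one _ _).symm

/-- The Laurent expansion of the elements of the cluster algebra. -/
def clusterExpansion (K : Type*) [Field K] (B : Matrix ex (Fin n) ℤ)
    (Λ : Matrix (Fin n) (Fin n) ℤ) (hc : IsCompat B Λ d) :
    clusterAlgebra K B →ₐ[K] QTorus (1 : Kˣ) Λ :=
  QTorus.expand (laurentHom K Λ) laurentHom_injective (clusterAlgebra_le_range hc)

theorem laurentHom_clusterExpansion (hc : IsCompat B Λ d) (a : clusterAlgebra K B) :
    laurentHom K Λ (clusterExpansion K B Λ hc a) = a :=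
  QTorus.map_expand _ _ _ a

theorem isLaurentAlgebra_clusterExpansion (hc : IsCompat B Λ d) :
    IsLaurentAlgebra (clusterExpansion K B Λ hc) (clusterVar K B) :=
  QTorus.isLaurentAlgebra_expand _ _ _ fun i =>
    (laurentHom_mono _).trans (laurentMonomial_unitVec i)

theorem map_laurentMonomial {φ : RationalFunctions K n →ₐ[K] RationalFunctions K n} {α : Kˣ}
    {w : Fin n → ℤ} (hφ : ∀ i, φ (initVar K i) = vpow α (w i) • initVar K i) (m : Fin n → ℤ) :
    φ (laurentMonomial K m) = vpow α (w ⬝ᵥ m) • laurentMonomial K m := by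
  have := map_toricFrame (v := (1 : Kˣ)) (Λ := 0) hφ m
  rwa [toricFrame_one] at this

theorem map_mem_clusterAlgebra (hc : IsCompat B Λ d)
    {φ : RationalFunctions K n →ₐ[K] RationalFunctions K n} {w : Fin n → ℤ} (hw : B *ᵥ w = 0)
    {α : Kˣ} (hφ : ∀ i, φ (initVar K i) = vpow α (w i) • initVar K i) {a : RationalFunctions K n}
    (ha : a ∈ clusterAlgebra K B) : φ a ∈ clusterAlgebra K B := by
  have h := Seed.init_isGood (K := K) hc
  rw [clusterAlgebra_eq h] at ha ⊢
  exact h.map_mem_algebra hw hφ ha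

theorem exists_clusterAlgebra_restrict (hc : IsCompat B Λ d)
    {φ : RationalFunctions K n ≃ₐ[K] RationalFunctions K n}
    (hφ : φ ∈ toricAutomorphisms (K := K) B (initVar K)) :
    ∃ ψ : clusterAlgebra K B →ₐ[K] clusterAlgebra K B, (∀ a, (ψ a : RationalFunctions K n) = φ a) ∧
      ∀ i, ∃ c : K, ψ (clusterVar K B i) = c • clusterVar K B i := by
  obtain ⟨w, hw, α, hα⟩ := hφ
  exact ⟨(φ.toAlgHom.comp (clusterAlgebra K B).val).codRestrict (clusterAlgebra K B)
    fun a => map_mem_clusterAlgebra hc (φ := φ.toAlgHom) hw hα a.2,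
    fun _ => rfl, fun i => ⟨_, Subtype.ext (hα i)⟩⟩

theorem isScaleStable_of_isToricIdeal [CharZero K] (hc : IsCompat B Λ d)
    {I : Ideal (clusterAlgebra K B)} (hI : IsToricIdeal I) :
    IsScaleStable (clusterExpansion K B Λ hc) B (idealSubmodule K I.toTwoSided) := by
  intro w hw a ha
  obtain ⟨φ, hφ⟩ := exists_toricAutomorphism (K := K) w (unitTwo K)
  obtain ⟨b, hb, e⟩ := hI φ ⟨w, hw, unitTwo K, hφ⟩ a ⟨a, Ideal.mem_toTwoSided.1 ha, rfl⟩
  refine ⟨b, Ideal.mem_toTwoSided.2 hb, laurentHom_injective ?_⟩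
  rw [laurentHom_clusterExpansion, e, ← QTorus.map_eq_map_diag (φ := φ.toAlgHom) (fun m => ?_),
    laurentHom_clusterExpansion]
  · rfl
  · rw [laurentHom_mono]
    exact map_laurentMonomial (φ := φ.toAlgHom) hφ m

theorem isToricIdeal_span (hc : IsCompat B Λ d) (i : Fin n) :
    IsToricIdeal (Ideal.span {clusterVar K B i}) := by
  rintro φ hφ _ ⟨a, ha, rfl⟩
  obtain ⟨ψ, hψ, hψ'⟩ := exists_clusterAlgebra_restrict hc hφ
  have hle : Ideal.span {clusterVar K B i} ≤ (Ideal.span {clusterVar K B i}).comap ψ := by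
    rw [Ideal.span_le, Set.singleton_subset_iff, SetLike.mem_coe, Ideal.mem_comap]
    obtain ⟨c, hc⟩ := hψ' i
    rw [hc]
    exact Submodule.smul_of_tower_mem _ c (Ideal.mem_span_singleton_self _)
  exact ⟨ψ a, Ideal.mem_comap.1 (hle ha), hψ a⟩

theorem isToricPredicate_isToricIdeal [CharZero K] (hc : IsCompat B Λ d) :
    IsToricPredicate (clusterExpansion K B Λ hc) B (clusterVar K B) IsToricIdeal :=
  ⟨fun _ hI => isScaleStable_of_isToricIdeal hc hI, isToricIdeal_span hc⟩

variable (hA : IsPoissonClusterAlgebra K B Λ)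

/-- The bracket of the cluster algebra. -/
def clusterBracket (a b : clusterAlgebra K B) : clusterAlgebra K B :=
  ⟨logBracket K Λ a b, hA a a.2 b b.2⟩

theorem isPoissonIdeal_iff {I : Ideal (clusterAlgebra K B)} :
    IsPoissonIdeal Λ I ↔ IsBracketStable (clusterBracket hA) I := by
  refine forall₃_congr fun a _ b => ⟨?_, fun h => ⟨_, h, rfl⟩⟩
  rintro ⟨c, hc, e⟩
  rwa [← show c = clusterBracket hA a b from Subtype.ext e]

theorem isLogBracket_clusterBracket (hc : IsCompat B Λ d) :
    IsLogBracket (clusterExpansion K B Λ hc) (clusterBracket hA) where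
  swap a b := Subtype.ext (logBracket_swap hc.skew _ _)
  add_left a b c := by
    ext
    change logBracket K Λ ((a : RationalFunctions K n) + b) c =
      logBracket K Λ a c + logBracket K Λ b c
    rw [logBracket_eq_hamiltonian, logBracket_eq_hamiltonian, logBracket_eq_hamiltonian, map_add]
  smul_left r a b := by
    ext
    change logBracket K Λ (r • (a : RationalFunctions K n)) b = r • logBracket K Λ a b
    rw [logBracket_eq_hamiltonian, logBracket_eq_hamiltonian, Derivation.map_smul]
  mul_left a b c := by
    ext
    change logBracket K Λ ((a : RationalFunctions K n) * b) c =
      a * logBracket K Λ b c + b * logBracket K Λ a c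
    rw [logBracket_eq_hamiltonian, logBracket_eq_hamiltonian, logBracket_eq_hamiltonian,
      Derivation.leibniz, smul_eq_mul, smul_eq_mul]
  map_mono a p m hp := by
    apply laurentHom_injective
    rw [laurentHom_clusterExpansion, ← logBracket_laurentHom, laurentHom_clusterExpansion,
      ← laurentHom_mono, ← hp, laurentHom_clusterExpansion]
    rfl

include hA in
theorem nonempty_poissonStratum_homeomorph [CharZero K] (hc : IsCompat B Λ d)
    (hs : IsSuperToric B Λ) {r : ℕ} {I : ℕ → Ideal (clusterAlgebra K B)} (hI : IsPoissonCOS Λ r I)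
    {k : ℕ} (hkr : n < k + r) (hk : k ≤ n) : Nonempty (poissonStratum Λ (I k) ≃ₜ
      torusPoissonSpec K (principal Λ (k - 1) ((Nat.sub_le k 1).trans hk))) := by
  have e : poissonStratum Λ (I k) = bracketStratum (clusterBracket hA) IsToricIdeal (I k) :=
    Set.ext fun P => and_congr_left fun _ => isPoissonIdeal_iff hA
  rw [e]
  exact nonempty_bracketStratum_homeomorph (A := clusterAlgebra K B) (Λ := Λ)
    (ι := clusterExpansion K B Λ hc) (x := clusterVar K B) (br := clusterBracket hA)
    (Tor := IsToricIdeal) (isLaurentAlgebra_clusterExpansion hc) hs hc.skew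
    (isLogBracket_clusterBracket hA hc) (isToricPredicate_isToricIdeal hc) hI.depth_le
    (fun k h1 h2 => (hI.isTIPP k h1 h2).isPrime)
    (fun k h1 h2 => (isPoissonIdeal_iff hA).1 (hI.isTIPP k h1 h2).isPoisson)
    (fun k h1 h2 => (hI.isTIPP k h1 h2).isToric) hI.mem_iff hI.le hkr hk

end Poisson

end

end ClusterSpectra

/-! ### The theorem for Poisson and quantum cluster algebras. -/

theorem mainTheorem2 (K : Type*) [Field K] [CharZero K] (n : ℕ) (ex : Finset (Fin n))
    (B : Matrix ex (Fin n) ℤ) (Λ : Matrix (Fin n) (Fin n) ℤ)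
    (hcompat : ClusterSpectra.IsCompatiblePair B Λ)
    (hsuper : ClusterSpectra.IsSuperToric B Λ) (r : ℕ) :
    (IsNoetherianRing (ClusterSpectra.clusterAlgebra K B) →
      ClusterSpectra.IsPoissonClusterAlgebra K B Λ →
      ∀ I : ℕ → Ideal (ClusterSpectra.clusterAlgebra K B),
        ClusterSpectra.IsPoissonCOS Λ r I →
        ∀ (k : ℕ) (_ : n < k + r) (hk : k ≤ n),
          Nonempty (ClusterSpectra.poissonStratum Λ (I k) ≃ₜ
            ClusterSpectra.torusPoissonSpec K
              (ClusterSpectra.principal Λ (k - 1) ((Nat.sub_le k 1).trans hk)))) ∧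
    (∀ v : Kˣ, (∀ j : ℕ, 0 < j → v ^ j ≠ 1) →
      IsNoetherianRing (ClusterSpectra.quantumClusterAlgebra v B Λ) →
      IsNoetherianRing (ClusterSpectra.quantumClusterAlgebra v B Λ)ᵐᵒᵖ →
      ClusterSpectra.PrimesAreCompletelyPrime (ClusterSpectra.quantumClusterAlgebra v B Λ) →
      ∀ I : ℕ → TwoSidedIdeal (ClusterSpectra.quantumClusterAlgebra v B Λ),
        ClusterSpectra.IsQuantumCOS r I →
        ∀ (k : ℕ) (_ : n < k + r) (hk : k ≤ n),
          Nonempty (ClusterSpectra.quantumStratum (I k) ≃ₜ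
            ClusterSpectra.NCSpec (ClusterSpectra.QTorus v
              (ClusterSpectra.principal Λ (k - 1) ((Nat.sub_le k 1).trans hk))))) := by
  obtain ⟨d, hc⟩ := hcompat.exists_isCompat
  refine ⟨fun _ hA I hI k hkr hk =>
    ClusterSpectra.nonempty_poissonStratum_homeomorph hA hc hsuper hI hkr hk, ?_⟩
  intro v hv hN _ hR I hI k hkr hk
  exact ClusterSpectra.nonempty_quantumStratum_homeomorph hc hsuper hv hR hI hkr hk
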